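/- A deterministic Muller acceptor (DMA) $\mathcal U=\langle\Sigma,Q,q_\iota,\delta,\mathcal F\rangle$ consists of a finite alphabet $\Sigma$, a finite set $Q$ of states, an initial state $q_\iota\in Q$, a total transition function $\delta:Q\times\Sigma\to Q$, and a family $\mathcal F$ of subsets of $Q$. It accepts an infinite word $w\in\Sigma^\omega$ iff the set of states that occur infinitely often in its run on $w$ is an element of $\mathcal F$; $L(\mathcal U)$ denotes the set of accepted words. The size of $\mathcal U$ is $|Q|\cdot|\Sigma|+|Q|\cdot|\mathcal F|$. The computation model is a random access machine with unit-cost instructions (constants, addition, truncated subtraction, multiplication, integer division, indirect load and store, test for zero) and words of $O(\log n)$ bits, where $n=|\Sigma|+|Q_1|+|Q_2|+|\mathcal F_1|+|\mathcal F_2|+1$. The input is given in memory as the numbers $|\Sigma|,|Q_1|,|Q_2|,|\mathcal F_1|,|\mathcal F_2|$ and, for each acceptor, its initial state, its transition table, and the table of the membership of each state in each final state set, with respect to an arbitrary numbering of letters, states and final state sets. For two DMAs $\mathcal U_1,\mathcal U_2$ over the same alphabet $\Sigma$, with state sets $Q_i$ and families of final state sets $\mathcal F_i$, put $$T(\mathcal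 U_1,\mathcal U_2)=|\mathcal F_1|\cdot|\mathcal F_2|\cdot|Q_1|^2\cdot|Q_2|^3+|\Sigma|\cdot|\mathcal F_1|\cdot|Q_1|^2\cdot|Q_2|^2 .$$ (1) Inclusion. There is a program that, for any two DMAs $\mathcal U_1,\mathcal U_2$ over the same alphabet, halts and answers "yes" if $L(\mathcal U_1)\subseteq L(\mathcal U_2)$; otherwise it answers "no" and returns words $u\in\Sigma^*$ and $v\in\Sigma^+$ with $u(v)^\omega\in L(\mathcal U_1)\setminus L(\mathcal U_2)$ and $|u|+|v|=O((|Q_1|\cdot|Q_2|)^2)$. Its running time is $O(T(\mathcal U_1,\mathcal U_2)+1)$. (2) Equivalence. There is a program that, for any two DMAs $\mathcal U_1,\mathcal U_2$ over the same alphabet, halts and answers "yes" if $L(\mathcal U_1)=L(\mathcal U_2)$; otherwise it answers "no" and returns words $u\in\Sigma^*$ and $v\in\Sigma^+$ such that $u(v)^\omega$ belongs to exactly one of $L(\mathcal U_1),L(\mathcal U_2)$ and $|u|+|v|=O((|Q_1|\cdot|Q_2|)^2)$. Its running time is $O(T(\mathcal U_1,\mathcal U_2)+T(\mathcal U_2,\mathcal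 U_1)+1)$. The constants in the $O$-notation are absolute, and both running times are bounded by a polynomial in the sum of the sizes of $\mathcal U_1$ and $\mathcal U_2$. -/

import Mathlib

/-! ### Deterministic Muller acceptors -/

/-- A complete deterministic Muller acceptor with alphabet `A` and state set `Q`
(both are assumed finite wherever acceptors are used as inputs). -/
structure DMA (A Q : Type*) where
  /-- the initial state -/
  start : Q
  /-- the transition function -/
  step : Q → A → Q
  /-- the family of final state sets -/
  family : Finset (Finset Q)

namespace DMA

variable {A Q : Type*}

/-- The run on an infinite word `w`; letters are indexed from `0`. -/
def run (U : DMA A Q) (w : ℕ → A) : ℕ → Q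
  | 0 => U.start
  | i + 1 => U.step (U.run w i) (w i)

/-- The set of states visited infinitely often in the run on `w`. -/
def infSet (U : DMA A Q) (w : ℕ → A) : Set Q :=
  {q | ∃ᶠ i in Filter.atTop, U.run w i = q}

/-- The set of infinite words accepted by `U`. -/
def language (U : DMA A Q) : Set (ℕ → A) :=
  {w | ∃ F ∈ U.family, (F : Set Q) = U.infSet w}

/-- The size of an acceptor: transition table plus membership table of the final state sets. -/
def size [Fintype A] [Fintype Q] (U : DMA A Q) : ℕ :=
  Fintype.card Q * Fintype.card A + Fintype.card Q * U.family.card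

end DMA

/-- The ultimately periodic infinite word `u v v v ...`. -/
def ultPeriodic {A : Type*} (u v : List A) (hv : v ≠ []) : ℕ → A := fun i =>
  if h : i < u.length then u[i]
  else v[(i - u.length) % v.length]'(Nat.mod_lt _ (List.length_pos_of_ne_nil hv))

/-! ### A random access machine with unit cost and bounded word length

A machine state consists of registers, which a program addresses directly, and of a memory that
is accessed through addresses held in registers. -/

/-- A state of the machine. -/
structure RAMState where
  /-- the contents of the registers -/
  reg : ℕ → ℕ
  /-- the contents of the memory -/
  mem : ℕ → ℕ

/-- The arithmetic operations (on natural numbers: truncated subtraction, division rounding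
down). -/
inductive RAMOp
  | add
  | sub
  | mul
  | div

/-- The result of an arithmetic operation. -/
def RAMOp.eval : RAMOp → ℕ → ℕ → ℕ
  | add, x, y => x + y
  | sub, x, y => x - y
  | mul, x, y => x * y
  | div, x, y => x / y

/-- Elementary instructions; each of them writes one word. -/
inductive RAMInstr
  /-- `reg r := k` -/
  | const (r k : ℕ)
  /-- `reg r := reg s op reg t` -/
  | arith (op : RAMOp) (r s t : ℕ)
  /-- `reg r := mem (reg s)` -/
  | load (r s : ℕ)
  /-- `mem (reg r) := reg s` -/
  | store (r s : ℕ)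

/-- The word that an instruction writes. -/
def RAMInstr.value : RAMInstr → RAMState → ℕ
  | const _ k, _ => k
  | arith op _ s t, x => op.eval (x.reg s) (x.reg t)
  | load _ s, x => x.mem (x.reg s)
  | store _ s, x => x.reg s

/-- The effect of an instruction. -/
def RAMInstr.apply (i : RAMInstr) (x : RAMState) : RAMState :=
  match i with
  | const r _ => { x with reg := Function.update x.reg r (i.value x) }
  | arith _ r _ _ => { x with reg := Function.update x.reg r (i.value x) }
  | load r _ => { x with reg := Function.update x.reg r (i.value x) }
  | store r _ => { x with mem := Function.update x.mem (x.reg r) (i.value x) }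

/-- Programs: a finite control over elementary instructions. Tests are of the form
`reg r ≠ 0`. -/
inductive RAMProgram
  | skip
  | instr (i : RAMInstr)
  | seq (P P' : RAMProgram)
  /-- if `reg r ≠ 0` then `P` else `P'` -/
  | cond (r : ℕ) (P P' : RAMProgram)
  /-- while `reg r ≠ 0` do `P` -/
  | loop (r : ℕ) (P : RAMProgram)

/-- `Exec W P x t y`: started in state `x`, the program `P` halts in state `y` after exactly `t`
steps, and every word written during the computation is smaller than `W`. Every executed
instruction and every executed test costs one step. -/
inductive Exec (W : ℕ) : RAMProgram → RAMState → ℕ → RAMState → Prop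
  | skip (x : RAMState) : Exec W .skip x 1 x
  | instr (i : RAMInstr) (x : RAMState) (h : i.value x < W) : Exec W (.instr i) x 1 (i.apply x)
  | seq {P P' : RAMProgram} {x y z : RAMState} {t t' : ℕ}
      (h : Exec W P x t y) (h' : Exec W P' y t' z) : Exec W (.seq P P') x (t + t') z
  | condTrue {r : ℕ} {P P' : RAMProgram} {x y : RAMState} {t : ℕ}
      (hr : x.reg r ≠ 0) (h : Exec W P x t y) : Exec W (.cond r P P') x (t + 1) y
  | condFalse {r : ℕ} {P P' : RAMProgram} {x y : RAMState} {t : ℕ}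
      (hr : x.reg r = 0) (h : Exec W P' x t y) : Exec W (.cond r P P') x (t + 1) y
  | loopStop {r : ℕ} {P : RAMProgram} {x : RAMState}
      (hr : x.reg r = 0) : Exec W (.loop r P) x 1 x
  | loopStep {r : ℕ} {P : RAMProgram} {x y z : RAMState} {t t' : ℕ}
      (hr : x.reg r ≠ 0) (h : Exec W P x t y) (h' : Exec W (.loop r P) y t' z) :
      Exec W (.loop r P) x (t + t' + 1) z

/-- The machine is deterministic: the number of steps and the final state are determined by the
program and the initial state. -/
theorem Exec.deterministic {W : ℕ} {P : RAMProgram} {x y y' : RAMState} {t t' : ℕ}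
    (h : Exec W P x t y) (h' : Exec W P x t' y') : t = t' ∧ y = y' := by
  induction h generalizing t' y' with
  | skip x => cases h'; exact ⟨rfl, rfl⟩
  | instr i x hi => cases h'; exact ⟨rfl, rfl⟩
  | seq _ _ ih₁ ih₂ =>
    cases h' with
    | seq k₁ k₂ =>
      obtain ⟨rfl, rfl⟩ := ih₁ k₁
      obtain ⟨rfl, rfl⟩ := ih₂ k₂
      exact ⟨rfl, rfl⟩
  | condTrue hr _ ih =>
    cases h' with
    | condTrue _ k => obtain ⟨rfl, rfl⟩ := ih k; exact ⟨rfl, rfl⟩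
    | condFalse hr' _ => exact absurd hr' hr
  | condFalse hr _ ih =>
    cases h' with
    | condTrue hr' _ => exact absurd hr hr'
    | condFalse _ k => obtain ⟨rfl, rfl⟩ := ih k; exact ⟨rfl, rfl⟩
  | loopStop hr =>
    cases h' with
    | loopStop _ => exact ⟨rfl, rfl⟩
    | loopStep hr' _ _ => exact absurd hr hr'
  | loopStep hr _ _ ih₁ ih₂ =>
    cases h' with
    | loopStop hr' => exact absurd hr' hr
    | loopStep _ k₁ k₂ =>
      obtain ⟨rfl, rfl⟩ := ih₁ k₁
      obtain ⟨rfl, rfl⟩ := ih₂ k₂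
      exact ⟨rfl, rfl⟩

/-! ### Input and output -/

/-- An arbitrary numbering of the letters, states and final state sets of two acceptors over the
same alphabet, by which they are presented to a machine. -/
structure PairNumbering {A Q₁ Q₂ : Type*} [Fintype A] [Fintype Q₁] [Fintype Q₂]
    (U₁ : DMA A Q₁) (U₂ : DMA A Q₂) where
  letter : A ≃ Fin (Fintype.card A)
  state₁ : Q₁ ≃ Fin (Fintype.card Q₁)
  state₂ : Q₂ ≃ Fin (Fintype.card Q₂)
  final₁ : U₁.family ≃ Fin U₁.family.card
  final₂ : U₂.family ≃ Fin U₂.family.card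

open Classical in
/-- The encoding of one acceptor: the initial state, the transition table (one row for each
state), and the 0-1 membership table (one row for each final state set). -/
noncomputable def DMA.encode {A Q : Type*} [Fintype A] [Fintype Q] (U : DMA A Q)
    (letter : A ≃ Fin (Fintype.card A)) (state : Q ≃ Fin (Fintype.card Q))
    (final : U.family ≃ Fin U.family.card) : List ℕ :=
  [(state U.start : ℕ)] ++
  List.ofFn (fun k : Fin (Fintype.card Q * Fintype.card A) =>
    (state (U.step (state.symm k.divNat) (letter.symm k.modNat)) : ℕ)) ++
  List.ofFn (fun k : Fin (U.family.card * Fintype.card Q) =>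
    if state.symm k.modNat ∈ (final.symm k.divNat : Finset Q) then 1 else 0)

namespace PairNumbering

variable {A Q₁ Q₂ : Type*} [Fintype A] [Fintype Q₁] [Fintype Q₂]
  {U₁ : DMA A Q₁} {U₂ : DMA A Q₂}

/-- The input word sequence: the five parameters, then the two acceptors. -/
noncomputable def input (N : PairNumbering U₁ U₂) : List ℕ :=
  [Fintype.card A, Fintype.card Q₁, Fintype.card Q₂, U₁.family.card, U₂.family.card] ++
  U₁.encode N.letter N.state₁ N.final₁ ++ U₂.encode N.letter N.state₂ N.final₂

/-- The initial machine state: the input stands at the beginning of the memory, everything else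
is zero. -/
noncomputable def initial (N : PairNumbering U₁ U₂) : RAMState where
  reg := fun _ => 0
  mem := fun i => N.input.getD i 0

end PairNumbering

/-- The strict upper bound for the words of the machine: `d` is the constant in the word length
`O(log n)`. -/
def wordBound {A Q₁ Q₂ : Type*} [Fintype A] [Fintype Q₁] [Fintype Q₂]
    (U₁ : DMA A Q₁) (U₂ : DMA A Q₂) (d : ℕ) : ℕ :=
  (Fintype.card A + Fintype.card Q₁ + Fintype.card Q₂ + U₁.family.card + U₂.family.card + 1) ^ d

/-- The expression inside the `O` of the running time of an inclusion test. -/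
def timeBound {A Q₁ Q₂ : Type*} [Fintype A] [Fintype Q₁] [Fintype Q₂]
    (U₁ : DMA A Q₁) (U₂ : DMA A Q₂) : ℕ :=
  U₁.family.card * U₂.family.card * Fintype.card Q₁ ^ 2 * Fintype.card Q₂ ^ 3 +
    Fintype.card A * U₁.family.card * Fintype.card Q₁ ^ 2 * Fintype.card Q₂ ^ 2

/-- The final state `y` contains the right answer to a decision problem with witnesses.
If `Holds` is true, register `0` contains `1`, for "yes". Otherwise register `0` contains `0`,
for "no", and `u`, `v` with `IsWitness (u v v v ...)` and total length at most `len` are returned: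
registers `1` and `2` contain the lengths of `u` and `v`, and the letters of `u` and `v` stand in
the memory from the address in register `3` on. -/
def CorrectAnswer {A : Type*} (y : RAMState) (letter : A → ℕ)
    (Holds : Prop) (IsWitness : (ℕ → A) → Prop) (len : ℕ) : Prop :=
  (Holds → y.reg 0 = 1) ∧
  (¬ Holds → y.reg 0 = 0 ∧ ∃ (u v : List A) (hv : v ≠ []),
    y.reg 1 = u.length ∧ y.reg 2 = v.length ∧
    (∀ (i : ℕ) (h : i < (u ++ v).length), y.mem (y.reg 3 + i) = letter (u ++ v)[i]) ∧
    IsWitness (ultPeriodic u v hv) ∧ u.length + v.length ≤ len)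

/-!
Inclusion of the languages of two Muller acceptors is decided on the product automaton, all of
whose states are pairs. The infinitely often visited states of a run form a strongly connected set
with an inner edge. Inclusion fails iff some such set of reachable pairs has its first components
in the family `F₁` and its second components not in `F₂`. There are exponentially many such sets,
but few of them have to be examined (`Inst.not_bad_of_harmless`): for each `F ∈ F₁`, restrict the
product to the reachable pairs with first component in `F`, and then either do not restrict the
second components at all, or restrict them to `G \ {q}` for some `G ∈ F₂` and `q ∈ G`; only the
strongly connected components of these restrictions matter. Indeed, let `S` be the set of pairs
visited infinitely often by a counterexample. Its component in the first restriction has first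
components `F`, and if it is harmless, its second components form a set `G ∈ F₂` that contains those
of `S`. The latter do not form the set `G`, so that some `q ∈ G` is missing; the component of `S` in
the restriction to `G \ {q}` is harmless as well, and yields a strictly smaller `G' ∈ F₂` that
contains the second components of `S`. This cannot go on forever.

Thus `|F₁| * (1 + |F₂| * |Q₂|)` restrictions are examined. Kosaraju's algorithm finds the components
of one of them in time `O((|Q₁| * |Q₂|) ^ 2)` from the adjacency matrix (`reachable_of_order`,
`Prog.mem_component_iff`, `Prog.runs_components`), and a trie of the sets in `F₂` makes it possible
to test the second components of a component in time `O(|Q₂|)` (`Prog.runs_lookup`). The adjacency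
matrix takes time `O(|Σ| * |Q₁| * |Q₂| + (|Q₁| * |Q₂|) ^ 2)`. If a component refutes the inclusion,
then search trees of the product and of the component provide a path to a state `r` of the component
and, for each of its states, a path from `r` to this state and back to `r`; together they are the
words `u` and `v` (`Prog.runs_extract`). Equivalence is inclusion in both directions.

The algorithm is written in a while language with two-dimensional arrays. Its assignments and tests
cost one step, and values grow at most linearly with time. `Layout.exec_compile` shows that the
compiled program is slower by a constant factor only and that its words are bounded by a quadratic
polynomial in the time, hence by a power of the number of letters, states and final state sets. Time
bounds and correctness are proved together by means of weakest preconditions with a clock.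
-/

/-! ### Weakest preconditions for the machine -/

/-- Weakest precondition with a clock: started at time `t` in state `x`, the program `P` halts and
its final time and final state satisfy `R`. -/
def RAMProgram.wp (W : ℕ) (P : RAMProgram) (R : ℕ → RAMState → Prop) (t : ℕ) (x : RAMState) :
    Prop :=
  ∃ t' y, Exec W P x t' y ∧ R (t + t') y

namespace RAMProgram

variable {W : ℕ} {R : ℕ → RAMState → Prop} {t : ℕ} {x : RAMState}

theorem wp_instr {i : RAMInstr} (hv : i.value x < W) (h : R (t + 1) (i.apply x)) :
    wp W (.instr i) R t x :=
  ⟨1, _, .instr i x hv, h⟩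

theorem wp_const {r k : ℕ} (hv : k < W)
    (h : R (t + 1) { x with reg := Function.update x.reg r k }) :
    wp W (.instr (.const r k)) R t x :=
  wp_instr hv h

theorem wp_arith {op : RAMOp} {r s u : ℕ} (hv : op.eval (x.reg s) (x.reg u) < W)
    (h : R (t + 1) { x with reg := Function.update x.reg r (op.eval (x.reg s) (x.reg u)) }) :
    wp W (.instr (.arith op r s u)) R t x :=
  wp_instr hv h

theorem wp_load {r s : ℕ} (hv : x.mem (x.reg s) < W)
    (h : R (t + 1) { x with reg := Function.update x.reg r (x.mem (x.reg s)) }) :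
    wp W (.instr (.load r s)) R t x :=
  wp_instr hv h

theorem wp_store {r s : ℕ} (hv : x.reg s < W)
    (h : R (t + 1) { x with mem := Function.update x.mem (x.reg r) (x.reg s) }) :
    wp W (.instr (.store r s)) R t x :=
  wp_instr hv h

theorem wp_seq {P P' : RAMProgram} (h : wp W P (wp W P' R) t x) : wp W (.seq P P') R t x := by
  obtain ⟨t₁, y, h₁, t₂, z, h₂, hR⟩ := h
  exact ⟨t₁ + t₂, z, .seq h₁ h₂, by rwa [← add_assoc]⟩

end RAMProgram

/-! ### A while language with two-dimensional arrays -/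

/-- Expressions over variables named by `ν` and two-dimensional arrays named by `α`. No operation
can produce a value much larger than its arguments, so that all values which occur in a
computation are bounded by its running time. -/
inductive WExpr (ν α : Type)
  | lit (k : ℕ)
  | var (v : ν)
  | succ (e : WExpr ν α)
  | sub (e e' : WExpr ν α)
  /-- the minimum, used as conjunction -/
  | both (e e' : WExpr ν α)
  /-- the distance, used as inequality test -/
  | ne (e e' : WExpr ν α)
  | get (a : α) (e e' : WExpr ν α)

/-- Programs of the while language. -/
inductive WProg (ν α : Type)
  | skip
  | assign (v : ν) (e : WExpr ν α)
  | store (a : α) (e e' e'' : WExpr ν α)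
  /-- `v := e`-th word of the input -/
  | read (v : ν) (e : WExpr ν α)
  | seq (P P' : WProg ν α)
  | ite (e : WExpr ν α) (P P' : WProg ν α)
  | while (e : WExpr ν α) (P : WProg ν α)

/-- The contents of the variables and arrays. -/
structure WState (ν α : Type) where
  var : ν → ℕ
  arr : α → ℕ → ℕ → ℕ

namespace WState

variable {ν α : Type}

/-- Assignment to a variable. -/
def set [DecidableEq ν] (x : WState ν α) (v : ν) (n : ℕ) : WState ν α where
  var w := if w = v then n else x.var w
  arr := x.arr

/-- Assignment to an entry of an array. -/
def put [DecidableEq α] (x : WState ν α) (a : α) (i j n : ℕ) : WState ν α where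
  var := x.var
  arr b i' j' := if b = a ∧ i' = i ∧ j' = j then n else x.arr b i' j'

/-- All values are at most `M`. -/
def Bounded (x : WState ν α) (M : ℕ) : Prop :=
  (∀ v, x.var v ≤ M) ∧ ∀ a i j, x.arr a i j ≤ M

theorem Bounded.mono {x : WState ν α} {M M' : ℕ} (h : x.Bounded M) (hM : M ≤ M') :
    x.Bounded M' :=
  ⟨fun v => (h.1 v).trans hM, fun a i j => (h.2 a i j).trans hM⟩

theorem Bounded.set [DecidableEq ν] {x : WState ν α} {M n : ℕ} (h : x.Bounded M) (hn : n ≤ M)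
    (v : ν) : (x.set v n).Bounded M :=
  ⟨fun w => by simp only [WState.set]; split <;> simp [hn, h.1], h.2⟩

theorem Bounded.put [DecidableEq α] {x : WState ν α} {M n : ℕ} (h : x.Bounded M) (hn : n ≤ M)
    (a : α) (i j : ℕ) : (x.put a i j n).Bounded M :=
  ⟨h.1, fun b i' j' => by simp only [WState.put]; split <;> simp [hn, h.2]⟩

end WState

namespace WExpr

variable {ν α : Type}

/-- The value of an expression. -/
def eval (x : WState ν α) : WExpr ν α → ℕ
  | lit k => k
  | var v => x.var v
  | succ e => e.eval x + 1
  | sub e e' => e.eval x - e'.eval x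
  | both e e' => min (e.eval x) (e'.eval x)
  | ne e e' => (e.eval x - e'.eval x) + (e'.eval x - e.eval x)
  | get a e e' => x.arr a (e.eval x) (e'.eval x)

/-- A bound for the number of machine instructions that evaluate an expression, and also for the
amount by which its value can exceed all stored values. -/
def size : WExpr ν α → ℕ
  | lit k => k + 2
  | var _ => 2
  | succ e => e.size + 2
  | sub e e' => e.size + e'.size + 1
  | both e e' => e.size + e'.size + 2
  | ne e e' => e.size + e'.size + 3
  | get _ e e' => e.size + e'.size + 9

theorem eval_le {x : WState ν α} {M : ℕ} (h : x.Bounded M) (e : WExpr ν α) :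
    e.eval x ≤ M + e.size := by
  induction e with
  | lit k => simp only [eval, size]; omega
  | var v => simp only [eval, size]; have := h.1 v; omega
  | succ e ih => simp only [eval, size]; omega
  | sub e e' ih ih' => simp only [eval, size]; omega
  | both e e' ih ih' => simp only [eval, size]; omega
  | ne e e' ih ih' => simp only [eval, size]; omega
  | get a e e' ih ih' => simp only [eval, size]; have := h.2 a (e.eval x) (e'.eval x); omega

end WExpr

namespace WProg

variable {ν α : Type}

/-- A bound for the number of machine instructions per step of a program, and for the growth of
the values per step. -/
def size : WProg ν α → ℕ
  | skip => 1
  | assign _ e => e.size + 5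
  | store _ e e' e'' => e.size + e'.size + e''.size + 12
  | read _ e => e.size + 5
  | seq P P' => P.size + P'.size
  | ite e P P' => e.size + 1 + P.size + P'.size
  | .while e P => e.size + 2 + P.size

end WProg

/-- Big-step semantics of the while language; `inp` is the input, which cannot be changed. Every
assignment and every test costs one step. -/
inductive WExec {ν α : Type} [DecidableEq ν] [DecidableEq α] (inp : List ℕ) :
    WProg ν α → WState ν α → ℕ → WState ν α → Prop
  | skip (x) : WExec inp .skip x 1 x
  | assign (v e x) : WExec inp (.assign v e) x 1 (x.set v (e.eval x))
  | store (a e e' e'' x) :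
      WExec inp (.store a e e' e'') x 1 (x.put a (e.eval x) (e'.eval x) (e''.eval x))
  | read (v e x) (h : e.eval x < inp.length) : WExec inp (.read v e) x 1 (x.set v inp[e.eval x])
  | seq {P P' x y z t t'} (h : WExec inp P x t y) (h' : WExec inp P' y t' z) :
      WExec inp (.seq P P') x (t + t') z
  | iteTrue {e P P' x y t} (he : e.eval x ≠ 0) (h : WExec inp P x t y) :
      WExec inp (.ite e P P') x (t + 1) y
  | iteFalse {e P P' x y t} (he : e.eval x = 0) (h : WExec inp P' x t y) :
      WExec inp (.ite e P P') x (t + 1) y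
  | whileStop {e P x} (he : e.eval x = 0) : WExec inp (.while e P) x 1 x
  | whileStep {e P x y z t t'} (he : e.eval x ≠ 0) (h : WExec inp P x t y)
      (h' : WExec inp (.while e P) y t' z) : WExec inp (.while e P) x (t + t' + 1) z

/-! ### Compilation -/

/-- How variables and arrays are numbered: there are `K` arrays. -/
structure Layout (ν α : Type) where
  varCode : ν → ℕ
  arrCode : α → ℕ
  K : ℕ
  varCode_injective : Function.Injective varCode
  arrCode_injective : Function.Injective arrCode
  arrCode_lt : ∀ a, arrCode a < K

namespace Layout

variable {ν α : Type} (L : Layout ν α)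

/-- The address of an array entry. The arrays are interleaved above the address `B`, and
`(i, j) ↦ (i + j) ^ 2 + i` is an injective pairing, so that entries never collide. -/
def addr (B : ℕ) (a : α) (i j : ℕ) : ℕ :=
  B + L.K * ((i + j) * (i + j) + i) + L.arrCode a

/-- A bound for all words written by the machine while all values are at most `m`. -/
def word (B m : ℕ) : ℕ := B + L.K * (2 * m * (2 * m) + m) + 2 * L.K + 2 * m + 2

theorem word_mono (B : ℕ) {m m' : ℕ} (h : m ≤ m') : L.word B m ≤ L.word B m' := by
  unfold word; gcongr

theorem addr_inj {B : ℕ} {a b : α} {i j i' j' : ℕ} (h : L.addr B a i j = L.addr B b i' j') :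
    a = b ∧ i = i' ∧ j = j' := by
  have ha := L.arrCode_lt a
  have hb := L.arrCode_lt b
  unfold addr at h
  have hmod : L.arrCode a = L.arrCode b := by
    have : (L.arrCode a + L.K * ((i + j) * (i + j) + i)) % L.K =
        (L.arrCode b + L.K * ((i' + j') * (i' + j') + i')) % L.K := by congr 1; omega
    simpa [Nat.add_mul_mod_self_left, Nat.mod_eq_of_lt ha, Nat.mod_eq_of_lt hb] using this
  have hp : (i + j) * (i + j) + i = (i' + j') * (i' + j') + i' := by
    apply Nat.eq_of_mul_eq_mul_left (show 0 < L.K by omega); omega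
  have hs : i + j = i' + j' := by
    rcases lt_trichotomy (i + j) (i' + j') with hlt | heq | hlt
    · nlinarith [Nat.mul_le_mul (Nat.succ_le_of_lt hlt) (Nat.succ_le_of_lt hlt)]
    · exact heq
    · nlinarith [Nat.mul_le_mul (Nat.succ_le_of_lt hlt) (Nat.succ_le_of_lt hlt)]
  refine ⟨L.arrCode_injective hmod, ?_, ?_⟩ <;> rw [hs] at hp <;> omega

theorem le_addr (B : ℕ) (a : α) (i j : ℕ) : B ≤ L.addr B a i j := by
  unfold addr; omega

/-- The machine code that replaces the indices in the temporaries `k`, `k + 1` by the address of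
the array entry, using the temporary `m`. Temporary `k` is register `2 * k + 2`; register `0`
holds the base address. -/
def addrCode (a : α) (k m : ℕ) : RAMProgram :=
  .seq (.instr (.arith .add (2 * m + 2) (2 * k + 2) (2 * k + 4))) <|
  .seq (.instr (.arith .mul (2 * m + 2) (2 * m + 2) (2 * m + 2))) <|
  .seq (.instr (.arith .add (2 * m + 2) (2 * m + 2) (2 * k + 2))) <|
  .seq (.instr (.const (2 * k + 4) L.K)) <|
  .seq (.instr (.arith .mul (2 * m + 2) (2 * k + 4) (2 * m + 2))) <|
  .seq (.instr (.arith .add (2 * m + 2) 0 (2 * m + 2))) <|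
  .seq (.instr (.const (2 * k + 4) (L.arrCode a))) <|
  .instr (.arith .add (2 * k + 2) (2 * m + 2) (2 * k + 4))

/-- The machine code that evaluates an expression into the temporary `k`, using only
temporaries from `k` on. -/
def compileExpr : WExpr ν α → ℕ → RAMProgram
  | .lit n, k => .instr (.const (2 * k + 2) n)
  | .var v, k => .seq (.instr (.const (2 * k + 2) 0))
      (.instr (.arith .add (2 * k + 2) (2 * k + 2) (2 * L.varCode v + 1)))
  | .succ e, k => .seq (compileExpr e k) <| .seq (.instr (.const (2 * k + 4) 1))
      (.instr (.arith .add (2 * k + 2) (2 * k + 2) (2 * k + 4)))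
  | .sub e e', k => .seq (compileExpr e k) <| .seq (compileExpr e' (k + 1))
      (.instr (.arith .sub (2 * k + 2) (2 * k + 2) (2 * k + 4)))
  | .both e e', k => .seq (compileExpr e k) <| .seq (compileExpr e' (k + 1)) <|
      .seq (.instr (.arith .sub (2 * k + 4) (2 * k + 2) (2 * k + 4)))
      (.instr (.arith .sub (2 * k + 2) (2 * k + 2) (2 * k + 4)))
  | .ne e e', k => .seq (compileExpr e k) <| .seq (compileExpr e' (k + 1)) <|
      .seq (.instr (.arith .sub (2 * k + 6) (2 * k + 2) (2 * k + 4))) <|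
      .seq (.instr (.arith .sub (2 * k + 4) (2 * k + 4) (2 * k + 2)))
      (.instr (.arith .add (2 * k + 2) (2 * k + 6) (2 * k + 4)))
  | .get a e e', k => .seq (compileExpr e k) <| .seq (compileExpr e' (k + 1)) <|
      .seq (L.addrCode a k (k + 2)) (.instr (.load (2 * k + 2) (2 * k + 2)))

/-- The machine code of a program. -/
def compile : WProg ν α → RAMProgram
  | .skip => .skip
  | .assign v e => .seq (L.compileExpr e 0) <| .seq (.instr (.const (2 * L.varCode v + 1) 0))
      (.instr (.arith .add (2 * L.varCode v + 1) (2 * L.varCode v + 1) 2))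
  | .store a e e' e'' => .seq (L.compileExpr e 0) <| .seq (L.compileExpr e' 1) <|
      .seq (L.compileExpr e'' 2) <| .seq (L.addrCode a 0 3) (.instr (.store 2 6))
  | .read v e => .seq (L.compileExpr e 0) (.instr (.load (2 * L.varCode v + 1) 2))
  | .seq P P' => .seq (compile P) (compile P')
  | .ite e P P' => .seq (L.compileExpr e 0) (.cond 2 (compile P) (compile P'))
  | .while e P => .seq (L.compileExpr e 0) (.loop 2 (.seq (compile P) (L.compileExpr e 0)))

/-- The machine state `X` represents the state `x` of the while language: variables live in the odd
registers, the input below the address `B`, the arrays above it. -/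
structure Rep (B : ℕ) (inp : List ℕ) (x : WState ν α) (X : RAMState) : Prop where
  base : X.reg 0 = B
  length_le : inp.length ≤ B
  input : ∀ i (h : i < inp.length), X.mem i = inp[i]
  var : ∀ v, X.reg (2 * L.varCode v + 1) = x.var v
  arr : ∀ a i j, X.mem (L.addr B a i j) = x.arr a i j

/-- `Y` agrees with `X` except for temporaries from `k` on. -/
def SameUpTo (k : ℕ) (X Y : RAMState) : Prop :=
  Y.mem = X.mem ∧ ∀ r, r % 2 = 1 ∨ r < 2 * k + 2 → Y.reg r = X.reg r

theorem SameUpTo.trans {k k' : ℕ} {X Y Z : RAMState} (h : SameUpTo k X Y)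
    (h' : SameUpTo k' Y Z) (hk : k ≤ k') : SameUpTo k X Z :=
  ⟨h'.1.trans h.1, fun r hr => (h'.2 r (by omega)).trans (h.2 r hr)⟩

variable {L}

theorem Rep.of_sameUpTo {B : ℕ} {inp : List ℕ} {x : WState ν α} {X Y : RAMState} {k : ℕ}
    (h : L.Rep B inp x X) (hs : SameUpTo k X Y) : L.Rep B inp x Y where
  base := (hs.2 0 (by omega)).trans h.base
  length_le := h.length_le
  input i hi := by rw [hs.1]; exact h.input i hi
  var v := (hs.2 _ (by omega)).trans (h.var v)
  arr a i j := by rw [hs.1]; exact h.arr a i j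

theorem SameUpTo.update {k r : ℕ} {X Y : RAMState} (h : SameUpTo k X Y) (n : ℕ)
    (hr : r % 2 = 0) (hk : 2 * k + 2 ≤ r) :
    SameUpTo k X { Y with reg := Function.update Y.reg r n } :=
  ⟨h.1, fun s hs => by
    rw [← h.2 s hs]; exact Function.update_of_ne (by omega) _ _⟩

open RAMProgram in
theorem wp_addrCode {B W m k l i j t : ℕ} {a : α} {X : RAMState} {R : ℕ → RAMState → Prop}
    (hB : X.reg 0 = B) (hi : X.reg (2 * k + 2) = i) (hj : X.reg (2 * k + 4) = j)
    (hkl : k + 1 < l) (him : i ≤ m) (hjm : j ≤ m) (hW : L.word B m ≤ W)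
    (h : ∀ Y, Y.mem = X.mem → Y.reg (2 * k + 2) = L.addr B a i j →
      (∀ r, r ≠ 2 * k + 2 → r ≠ 2 * k + 4 → r ≠ 2 * l + 2 → Y.reg r = X.reg r) → R (t + 8) Y) :
    wp W (L.addrCode a k l) R t X := by
  have h1 : (i + j) * (i + j) ≤ 2 * m * (2 * m) := Nat.mul_le_mul (by omega) (by omega)
  have h2 : L.K * ((i + j) * (i + j) + i) ≤ L.K * (2 * m * (2 * m) + m) :=
    Nat.mul_le_mul_left _ (by omega)
  have h3 := L.arrCode_lt a
  have h4 : 2 * m * (2 * m) + m ≤ L.K * (2 * m * (2 * m) + m) := Nat.le_mul_of_pos_left _ (by omega)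
  unfold word at hW
  have e1 : k ≠ l := by omega
  have e2 : 2 * l ≠ 2 * k + 2 := by omega
  refine wp_seq (wp_arith ?_ (wp_seq (wp_arith ?_ (wp_seq (wp_arith ?_ (wp_seq (wp_const ?_
    (wp_seq (wp_arith ?_ (wp_seq (wp_arith ?_ (wp_seq (wp_const ?_ (wp_arith ?_
    (h _ rfl ?_ ?_)))))))))))))))
  all_goals
    try simp [Function.update_apply, RAMOp.eval, e1, e2, hi, hj, hB, addr]
  · omega
  · omega
  · omega
  · omega
  · omega
  · omega
  · omega
  · omega
  · intro r h1 h2 h3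
    simp [h1, h2, h3]

open RAMProgram in
/-- The compiled expression leaves its value in temporary `k` and changes no lower temporary, no
variable, and no memory. -/
theorem wp_compileExpr {B W M : ℕ} {inp : List ℕ} {x : WState ν α} (hx : x.Bounded M)
    (e : WExpr ν α) : ∀ (k t : ℕ) (X : RAMState) (R : ℕ → RAMState → Prop),
    L.Rep B inp x X → L.word B (M + e.size) ≤ W →
    (∀ t' Y, t' ≤ t + e.size → SameUpTo k X Y → Y.reg (2 * k + 2) = e.eval x → R t' Y) →
    wp W (L.compileExpr e k) R t X := by
  induction e with
  | lit n =>
    intro k t X R hX hW h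
    refine wp_const (by simp [word, WExpr.size] at hW; omega) (h _ _ (by simp [WExpr.size])
      (SameUpTo.update ⟨rfl, fun _ _ => rfl⟩ _ (by omega) le_rfl) (by simp [WExpr.eval]))
  | var v =>
    intro k t X R hX hW h
    have := hx.1 v
    have e0 : 2 * L.varCode v ≠ 2 * k + 1 := by omega
    refine wp_seq (wp_const (by simp [word, WExpr.size] at hW; omega) (wp_arith ?_
      (h _ _ (by simp [WExpr.size])
      (SameUpTo.update (SameUpTo.update ⟨rfl, fun _ _ => rfl⟩ _ (by omega) le_rfl) _
        (by omega) le_rfl) ?_)))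
    · simp [RAMOp.eval, e0, hX.var]
      simp [word, WExpr.size] at hW; omega
    · simp [RAMOp.eval, e0, hX.var, WExpr.eval]
  | succ e ih =>
    intro k t X R hX hW h
    refine wp_seq (ih k t X _ hX ((L.word_mono B (by simp [WExpr.size])).trans hW) ?_)
    intro t' Y ht' hY hv
    have := e.eval_le hx
    have hW' := hW
    simp [word, WExpr.size] at hW'
    refine wp_seq (wp_const (by omega) (wp_arith ?_
      (h _ _ (by simp [WExpr.size]; omega)
      ((hY.update _ (by omega) (by omega)).update _
        (by omega) le_rfl) ?_)))
    · simp [RAMOp.eval, hv]; omega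
    · simp [RAMOp.eval, hv, WExpr.eval]
  | sub e e' ih ih' =>
    intro k t X R hX hW h
    refine wp_seq (ih k t X _ hX ((L.word_mono B (by simp [WExpr.size]; omega)).trans hW) ?_)
    intro t' Y ht' hY hv
    refine wp_seq (ih' (k + 1) t' Y _ (hX.of_sameUpTo hY)
      ((L.word_mono B (by simp [WExpr.size]; omega)).trans hW) ?_)
    intro t'' Z ht'' hZ hv'
    have := e.eval_le hx
    have hv2 : Z.reg (2 * k + 2) = e.eval x := (hZ.2 _ (by omega)).trans hv
    rw [show 2 * (k + 1) + 2 = 2 * k + 4 by ring] at hv'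
    have hW' := hW
    simp [word, WExpr.size] at hW'
    refine wp_arith ?_
      (h _ _ (by simp [WExpr.size]; omega)
      ((hY.trans hZ (by omega)).update _ (by omega) (by omega)) ?_)
    · simp [RAMOp.eval, hv2]; omega
    · simp [RAMOp.eval, hv2, hv', WExpr.eval]
  | both e e' ih ih' =>
    -- the minimum is computed as `e - (e - e')`
    intro k t X R hX hW h
    refine wp_seq (ih k t X _ hX ((L.word_mono B (by simp [WExpr.size]; omega)).trans hW) ?_)
    intro t' Y ht' hY hv
    refine wp_seq (ih' (k + 1) t' Y _ (hX.of_sameUpTo hY)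
      ((L.word_mono B (by simp [WExpr.size]; omega)).trans hW) ?_)
    intro t'' Z ht'' hZ hv'
    have := e.eval_le hx
    have hv2 : Z.reg (2 * k + 2) = e.eval x := (hZ.2 _ (by omega)).trans hv
    rw [show 2 * (k + 1) + 2 = 2 * k + 4 by ring] at hv'
    have hW' := hW
    simp [word, WExpr.size] at hW'
    refine wp_seq (wp_arith ?_ (wp_arith ?_
      (h _ _ (by simp [WExpr.size]; omega)
      (((hY.trans hZ (by omega)).update _ (by omega) (by omega)).update _ (by omega)
        (by omega)) ?_)))
    · simp [RAMOp.eval, hv2]; omega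
    · simp [RAMOp.eval, hv2]; omega
    · simp [RAMOp.eval, hv2, hv', WExpr.eval]; omega
  | ne e e' ih ih' =>
    -- one of the two truncated differences vanishes, so that their sum is the distance
    intro k t X R hX hW h
    refine wp_seq (ih k t X _ hX ((L.word_mono B (by simp [WExpr.size]; omega)).trans hW) ?_)
    intro t' Y ht' hY hv
    refine wp_seq (ih' (k + 1) t' Y _ (hX.of_sameUpTo hY)
      ((L.word_mono B (by simp [WExpr.size]; omega)).trans hW) ?_)
    intro t'' Z ht'' hZ hv'
    have := e.eval_le hx
    have := e'.eval_le hx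
    have hv2 : Z.reg (2 * k + 2) = e.eval x := (hZ.2 _ (by omega)).trans hv
    rw [show 2 * (k + 1) + 2 = 2 * k + 4 by ring] at hv'
    have hW' := hW
    simp [word, WExpr.size] at hW'
    refine wp_seq (wp_arith ?_ (wp_seq (wp_arith ?_ (wp_arith ?_
      (h _ _ (by simp [WExpr.size]; omega)
      ((((hY.trans hZ (by omega)).update _ (by omega) (by omega)).update _ (by omega)
        (by omega)).update _ (by omega) (by omega)) ?_)))))
    · simp [RAMOp.eval, hv2]; omega
    · simp [RAMOp.eval, hv2, hv']; omega
    · simp [RAMOp.eval, hv2, hv']; omega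
    · simp [RAMOp.eval, hv2, hv', WExpr.eval]
  | get a e e' ih ih' =>
    intro k t X R hX hW h
    refine wp_seq (ih k t X _ hX ((L.word_mono B (by simp [WExpr.size]; omega)).trans hW) ?_)
    intro t' Y ht' hY hv
    refine wp_seq (ih' (k + 1) t' Y _ (hX.of_sameUpTo hY)
      ((L.word_mono B (by simp [WExpr.size]; omega)).trans hW) ?_)
    intro t'' Z ht'' hZ hv'
    have := e.eval_le hx
    have := e'.eval_le hx
    have hv2 : Z.reg (2 * k + 2) = e.eval x := (hZ.2 _ (by omega)).trans hv
    rw [show 2 * (k + 1) + 2 = 2 * k + 4 by ring] at hv'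
    have hW' := hW
    simp [word, WExpr.size] at hW'
    have hXZ := hY.trans hZ (by omega)
    have hRZ := hX.of_sameUpTo hXZ
    refine wp_seq (wp_addrCode hRZ.base hv2 hv' (by omega) (m := M + (e.size + e'.size + 9))
      (by omega) (by omega) hW ?_)
    intro Y' hm hr hs
    have hval : Y'.mem (Y'.reg (2 * k + 2)) = (WExpr.get a e e').eval x := by
      rw [hr, hm, hRZ.arr]; rfl
    refine wp_load ?_ (h _ _ (by simp [WExpr.size]; omega) (SameUpTo.update ?_ _ (by omega)
      le_rfl) (by simp [hval]))
    · rw [hval]; simp only [WExpr.eval]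
      have := hx.2 a (e.eval x) (e'.eval x)
      omega
    · exact ⟨hm.trans hXZ.1, fun r h => (hs r (by omega) (by omega) (by omega)).trans
        (hXZ.2 r h)⟩

theorem Rep.set [DecidableEq ν] {B : ℕ} {inp : List ℕ} {x : WState ν α} {X Y : RAMState}
    (h : L.Rep B inp x X) (v : ν) (n : ℕ) (hm : Y.mem = X.mem)
    (hv : Y.reg (2 * L.varCode v + 1) = n)
    (hr : ∀ r, r % 2 = 1 ∨ r = 0 → r ≠ 2 * L.varCode v + 1 → Y.reg r = X.reg r) :
    L.Rep B inp (x.set v n) Y where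
  base := (hr 0 (by omega) (by omega)).trans h.base
  length_le := h.length_le
  input i hi := by rw [hm]; exact h.input i hi
  var w := by
    by_cases hw : w = v
    · subst hw; simp [WState.set, hv]
    · have : L.varCode w ≠ L.varCode v := fun h => hw (L.varCode_injective h)
      rw [hr _ (by omega) (by omega), h.var w]; simp [WState.set, hw]
  arr a i j := by rw [hm]; exact h.arr a i j

open RAMProgram in
/-- The compiled program simulates the original one: it slows it down by a constant factor, and
its words are bounded in terms of the running time. -/
theorem exec_compile [DecidableEq ν] [DecidableEq α] {B W g M₀ : ℕ} {inp : List ℕ}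
    (hinp : ∀ n ∈ inp, n ≤ M₀) {P : WProg ν α} {x y : WState ν α} {t : ℕ}
    (h : WExec inp P x t y) :
    P.size ≤ g → ∀ M, M₀ ≤ M → x.Bounded M → L.word B (M + g * t) ≤ W →
    y.Bounded (M + g * t) ∧ ∀ X, L.Rep B inp x X →
    ∃ t' Y, Exec W (L.compile P) X t' Y ∧ t' ≤ g * t ∧ L.Rep B inp y Y := by
  induction h with
  | skip x =>
    intro hg M hM hx hW
    simp only [WProg.size] at hg
    exact ⟨hx.mono (by omega), fun X hX => ⟨1, X, .skip X, by omega, hX⟩⟩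
  | assign v e x =>
    intro hg M hM hx hW
    simp only [WProg.size] at hg
    rw [mul_one] at hW ⊢
    have he := e.eval_le hx
    refine ⟨(hx.mono (by omega)).set (by omega) _, fun X hX => ?_⟩
    have : wp W (L.compile (.assign v e)) (fun t' Y => t' ≤ g ∧ L.Rep B inp (x.set v (e.eval x)) Y)
        0 X := by
      refine wp_seq (wp_compileExpr hx e 0 0 X _ hX ((L.word_mono B (by omega)).trans hW) ?_)
      intro t' Y ht hY hv
      simp only [word] at hW
      simp only [mul_zero, zero_add] at hv
      refine wp_seq (wp_const (by omega) (wp_arith ?_ ⟨by omega, hX.set v _ hY.1 ?_ ?_⟩))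
      · simp [RAMOp.eval, hv]; omega
      · simp [RAMOp.eval, hv]
      · intro r hr hne
        simp only [Function.update_of_ne hne]
        exact hY.2 r (by omega)
    obtain ⟨t', Y, h1, h2, h3⟩ := this
    exact ⟨t', Y, h1, by omega, h3⟩
  | store a e e' e'' x =>
    intro hg M hM hx hW
    simp only [WProg.size] at hg
    rw [mul_one] at hW ⊢
    have he := e.eval_le hx
    have he' := e'.eval_le hx
    have he'' := e''.eval_le hx
    refine ⟨(hx.mono (by omega)).put (by omega) _ _ _, fun X hX => ?_⟩
    have : wp W (L.compile (.store a e e' e'')) (fun t' Y => t' ≤ g ∧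
        L.Rep B inp (x.put a (e.eval x) (e'.eval x) (e''.eval x)) Y) 0 X := by
      refine wp_seq (wp_compileExpr hx e 0 0 X _ hX ((L.word_mono B (by omega)).trans hW) ?_)
      intro t₁ Y ht₁ hY hv₁
      have hRY := hX.of_sameUpTo hY
      refine wp_seq (wp_compileExpr hx e' 1 t₁ Y _ hRY ((L.word_mono B (by omega)).trans hW) ?_)
      intro t₂ Z ht₂ hZ hv₂
      have hRZ := hRY.of_sameUpTo hZ
      refine wp_seq (wp_compileExpr hx e'' 2 t₂ Z _ hRZ ((L.word_mono B (by omega)).trans hW) ?_)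
      intro t₃ Z' ht₃ hZ' hv₃
      have hRZ' := hRZ.of_sameUpTo hZ'
      have hv₁' : Z'.reg 2 = e.eval x := by
        rw [hZ'.2 2 (by omega), hZ.2 2 (by omega)]; exact hv₁
      have hv₂' : Z'.reg 4 = e'.eval x := by
        rw [hZ'.2 4 (by omega)]; exact hv₂
      refine wp_seq (wp_addrCode hRZ'.base hv₁' hv₂' (by omega) (m := M + g) (by omega)
        (by omega) hW ?_)
      intro Y' hm hr hs
      have hv₃' : Y'.reg 6 = e''.eval x := by
        rw [hs 6 (by omega) (by omega) (by omega)]; exact hv₃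
      simp only [mul_zero, zero_add] at hr
      refine wp_store ?_ ⟨by omega, ?_⟩
      · rw [hv₃']; simp only [word] at hW; omega
      · have hreg : ∀ r, r % 2 = 1 ∨ r = 0 → Y'.reg r = Z'.reg r := fun r h =>
          hs r (by omega) (by omega) (by omega)
        constructor
        · exact (hreg 0 (by omega)).trans hRZ'.base
        · exact hX.length_le
        · intro i hi
          have := L.le_addr B a (e.eval x) (e'.eval x)
          have := hX.length_le
          simp only [hr]
          rw [Function.update_of_ne (by omega), hm]; exact hRZ'.input i hi
        · intro v
          exact (hreg _ (by omega)).trans (hRZ'.var v)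
        · intro b i j
          simp only [hr, hv₃', hm, WState.put, Function.update_apply]
          split_ifs with h1 h2 h2
          · rfl
          · exact absurd (L.addr_inj h1) h2
          · obtain ⟨rfl, rfl, rfl⟩ := h2; exact absurd rfl h1
          · exact hRZ'.arr b i j
    obtain ⟨t', Y, h1, h2, h3⟩ := this
    exact ⟨t', Y, h1, by omega, h3⟩
  | read v e x hlt =>
    intro hg M hM hx hW
    simp only [WProg.size] at hg
    rw [mul_one] at hW ⊢
    have hle := hinp _ (List.getElem_mem hlt)
    refine ⟨(hx.mono (by omega)).set (by omega) _, fun X hX => ?_⟩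
    have : wp W (L.compile (.read v e)) (fun t' Y => t' ≤ g ∧ L.Rep B inp (x.set v inp[e.eval x]) Y)
        0 X := by
      refine wp_seq (wp_compileExpr hx e 0 0 X _ hX ((L.word_mono B (by omega)).trans hW) ?_)
      intro t' Y ht hY hv
      simp only [mul_zero, zero_add] at hv
      have hval : Y.mem (Y.reg 2) = inp[e.eval x] := by rw [hv, hY.1]; exact hX.input _ hlt
      refine wp_load ?_ ⟨by omega, hX.set v _ hY.1 ?_ ?_⟩
      · simp only [word] at hW; omega
      · simp [hval]
      · intro r hr hne
        simp only [Function.update_of_ne hne]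
        exact hY.2 r (by omega)
    obtain ⟨t', Y, h1, h2, h3⟩ := this
    exact ⟨t', Y, h1, by omega, h3⟩
  | @seq P P' x y z t t' _ _ ih ih' =>
    intro hg M hM hx hW
    simp only [WProg.size] at hg
    rw [mul_add, ← add_assoc] at hW ⊢
    obtain ⟨hy, h⟩ := ih (by omega) M hM hx ((L.word_mono B (by omega)).trans hW)
    obtain ⟨hz, h'⟩ := ih' (by omega) (M + g * t) (by omega) hy hW
    refine ⟨hz, fun X hX => ?_⟩
    obtain ⟨t₁, Y, hXY, ht₁, hY⟩ := h X hX
    obtain ⟨t₂, Z, hYZ, ht₂, hZ⟩ := h' Y hY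
    exact ⟨_, Z, .seq hXY hYZ, by omega, hZ⟩
  | @iteTrue e P P' x y t he _ ih =>
    intro hg M hM hx hW
    simp only [WProg.size] at hg
    rw [mul_add, mul_one, ← add_assoc] at hW ⊢
    obtain ⟨hy, h⟩ := ih (by omega) M hM hx ((L.word_mono B (by omega)).trans hW)
    refine ⟨hy.mono (by omega), fun X hX => ?_⟩
    obtain ⟨t₁, Y, hXY, ht₁, hY, hv⟩ := wp_compileExpr hx e 0 0 X
      (fun t' Y => t' ≤ 0 + e.size ∧ SameUpTo 0 X Y ∧ Y.reg 2 = e.eval x) hX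
      ((L.word_mono B (by omega)).trans hW) (fun t' Y h1 h2 h3 => ⟨h1, h2, h3⟩)
    obtain ⟨t₂, Z, hYZ, ht₂, hZ⟩ := h Y (hX.of_sameUpTo hY)
    exact ⟨_, Z, .seq hXY (.condTrue (by omega) hYZ), by omega, hZ⟩
  | @iteFalse e P P' x y t he _ ih =>
    intro hg M hM hx hW
    simp only [WProg.size] at hg
    rw [mul_add, mul_one, ← add_assoc] at hW ⊢
    obtain ⟨hy, h⟩ := ih (by omega) M hM hx ((L.word_mono B (by omega)).trans hW)
    refine ⟨hy.mono (by omega), fun X hX => ?_⟩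
    obtain ⟨t₁, Y, hXY, ht₁, hY, hv⟩ := wp_compileExpr hx e 0 0 X
      (fun t' Y => t' ≤ 0 + e.size ∧ SameUpTo 0 X Y ∧ Y.reg 2 = e.eval x) hX
      ((L.word_mono B (by omega)).trans hW) (fun t' Y h1 h2 h3 => ⟨h1, h2, h3⟩)
    obtain ⟨t₂, Z, hYZ, ht₂, hZ⟩ := h Y (hX.of_sameUpTo hY)
    exact ⟨_, Z, .seq hXY (.condFalse (by omega) hYZ), by omega, hZ⟩
  | @whileStop e P x he =>
    intro hg M hM hx hW
    simp only [WProg.size] at hg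
    rw [mul_one] at hW ⊢
    refine ⟨hx.mono (by omega), fun X hX => ?_⟩
    obtain ⟨t₁, Y, hXY, ht₁, hY, hv⟩ := wp_compileExpr hx e 0 0 X
      (fun t' Y => t' ≤ 0 + e.size ∧ SameUpTo 0 X Y ∧ Y.reg 2 = e.eval x) hX
      ((L.word_mono B (by omega)).trans hW) (fun t' Y h1 h2 h3 => ⟨h1, h2, h3⟩)
    exact ⟨_, Y, .seq hXY (.loopStop (by omega)), by omega, hX.of_sameUpTo hY⟩
  | @whileStep e P x y z t t' he _ _ ih ih' =>
    intro hg M hM hx hW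
    have hg' := hg
    simp only [WProg.size] at hg
    have hmul : M + g * (t + t' + 1) = M + g * t + g * t' + g := by ring
    rw [hmul] at hW ⊢
    obtain ⟨hy, h⟩ := ih (by omega) M hM hx ((L.word_mono B (by omega)).trans hW)
    obtain ⟨hz, h'⟩ := ih' hg' (M + g * t) (by omega) hy ((L.word_mono B (by omega)).trans hW)
    refine ⟨hz.mono (by omega), fun X hX => ?_⟩
    obtain ⟨t₁, Y, hXY, ht₁, hY, hv⟩ := wp_compileExpr hx e 0 0 X
      (fun t' Y => t' ≤ 0 + e.size ∧ SameUpTo 0 X Y ∧ Y.reg 2 = e.eval x) hX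
      ((L.word_mono B (by omega)).trans hW) (fun t' Y h1 h2 h3 => ⟨h1, h2, h3⟩)
    obtain ⟨t₂, Z, hYZ, ht₂, hZ⟩ := h Y (hX.of_sameUpTo hY)
    obtain ⟨t₃, X', hZX', ht₃, hX'⟩ := h' Z hZ
    cases hZX' with
    | @seq _ _ _ Y' _ s s' hE hL =>
      have e3 : g * (t + t' + 1) = g * t + g * t' + g := by ring
      refine ⟨_, X', .seq hXY (.loopStep (by omega) (.seq hYZ hE) hL), by omega, hX'⟩

end Layout

/-! ### Program logic for the while language -/

namespace WState

variable {ν α : Type}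

@[simp] theorem set_var [DecidableEq ν] (x : WState ν α) (v w : ν) (n : ℕ) :
    (x.set v n).var w = if w = v then n else x.var w := rfl

@[simp] theorem set_arr [DecidableEq ν] (x : WState ν α) (v : ν) (n : ℕ) :
    (x.set v n).arr = x.arr := rfl

@[simp] theorem put_var [DecidableEq α] (x : WState ν α) (a : α) (i j n : ℕ) :
    (x.put a i j n).var = x.var := rfl

theorem put_arr [DecidableEq α] (x : WState ν α) (a b : α) (i j n i' j' : ℕ) :
    (x.put a i j n).arr b i' j' = if b = a ∧ i' = i ∧ j' = j then n else x.arr b i' j' := rfl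

@[simp] theorem put_arr_self [DecidableEq α] (x : WState ν α) (a : α) (i j n i' j' : ℕ) :
    (x.put a i j n).arr a i' j' = if i' = i ∧ j' = j then n else x.arr a i' j' := by
  simp [put_arr]

@[simp] theorem put_arr_of_ne [DecidableEq α] (x : WState ν α) {a b : α} (i j n : ℕ)
    (h : b ≠ a) : (x.put a i j n).arr b = x.arr b := by
  funext i' j'; simp [put_arr, h]

end WState

namespace WProg

variable {ν α : Type}

/-- The variables that a program may change. -/
def vars : WProg ν α → List ν
  | skip => []
  | assign v _ => [v]
  | store _ _ _ _ => []
  | read v _ => [v]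
  | seq P P' => P.vars ++ P'.vars
  | ite _ P P' => P.vars ++ P'.vars
  | .while _ P => P.vars

/-- The arrays that a program may change. -/
def arrs : WProg ν α → List α
  | skip => []
  | assign _ _ => []
  | store a _ _ _ => [a]
  | read _ _ => []
  | seq P P' => P.arrs ++ P'.arrs
  | ite _ P P' => P.arrs ++ P'.arrs
  | .while _ P => P.arrs

/-- The state `y` agrees with `x` on everything that `P` cannot change. -/
structure Frame (P : WProg ν α) (x y : WState ν α) : Prop where
  var : ∀ {v}, v ∉ P.vars → y.var v = x.var v
  arr : ∀ {a}, a ∉ P.arrs → y.arr a = x.arr a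

theorem Frame.refl (P : WProg ν α) (x : WState ν α) : Frame P x x := ⟨fun _ => rfl, fun _ => rfl⟩

theorem Frame.trans {P P' : WProg ν α} {x y z : WState ν α} (h : Frame P x y)
    (h' : Frame P' y z) (hv : P'.vars ⊆ P.vars) (ha : P'.arrs ⊆ P.arrs) : Frame P x z :=
  ⟨fun hw => (h'.var fun h => hw (hv h)).trans (h.var hw),
    fun hw => (h'.arr fun h => hw (ha h)).trans (h.arr hw)⟩

/-- `while i < n: P; i := i + 1`. -/
def upFrom (i n : ν) (P : WProg ν α) : WProg ν α :=
  .while (.sub (.var n) (.var i)) (.seq P (.assign i (.succ (.var i))))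

/-- `for i < n: P`. -/
def upTo (i n : ν) (P : WProg ν α) : WProg ν α :=
  .seq (.assign i (.lit 0)) (upFrom i n P)

theorem frame_upTo [DecidableEq ν] {i n : ν} {P : WProg ν α} {x y : WState ν α} {k : ℕ}
    (h : Frame (upFrom i n P) (x.set i k) y) : Frame (upTo i n P) x y := by
  refine ⟨fun {v} hv => ?_, fun {a} ha => ?_⟩
  · simp only [upTo, vars, List.mem_append, List.mem_singleton, not_or] at hv
    rw [h.var hv.2]; simp [hv.1]
  · simp only [upTo, arrs, List.nil_append] at ha
    rw [h.arr ha]; simp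

variable [DecidableEq ν] [DecidableEq α] {inp : List ℕ}

theorem frame_of_exec {P : WProg ν α} {x y : WState ν α} {t : ℕ} (h : WExec inp P x t y) :
    Frame P x y := by
  induction h with
  | skip | whileStop => exact .refl _ _
  | assign | read =>
    exact ⟨fun h => by simp only [vars, List.mem_singleton] at h; simp [h], fun _ => rfl⟩
  | store =>
    exact ⟨fun _ => rfl, fun h => by simp only [arrs, List.mem_singleton] at h; simp [h]⟩
  | seq _ _ ih ih' =>
    exact Frame.trans ⟨fun h => ih.var fun h' => h (List.mem_append_left _ h'),
      fun h => ih.arr fun h' => h (List.mem_append_left _ h')⟩ ih'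
      (List.subset_append_right _ _) (List.subset_append_right _ _)
  | iteTrue _ _ ih =>
    exact ⟨fun h => ih.var fun h' => h (List.mem_append_left _ h'),
      fun h => ih.arr fun h' => h (List.mem_append_left _ h')⟩
  | iteFalse _ _ ih =>
    exact ⟨fun h => ih.var fun h' => h (List.mem_append_right _ h'),
      fun h => ih.arr fun h' => h (List.mem_append_right _ h')⟩
  | whileStep _ _ _ ih ih' =>
    exact Frame.trans (P := .while _ _) ⟨ih.var, ih.arr⟩ ih' (by simp) (by simp)

/-- Weakest precondition with a clock: started at time `t` in state `x`, the program `P` halts and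
its final time and final state satisfy `R`. -/
def wp (inp : List ℕ) (P : WProg ν α) (R : ℕ → WState ν α → Prop) (t : ℕ) (x : WState ν α) :
    Prop :=
  ∃ t' y, WExec inp P x t' y ∧ R (t + t') y

variable {R : ℕ → WState ν α → Prop} {t : ℕ} {x : WState ν α}

theorem wp.mono {P : WProg ν α} {R' : ℕ → WState ν α → Prop} (h : wp inp P R t x)
    (hR : ∀ t' y, t ≤ t' → Frame P x y → R t' y → R' t' y) : wp inp P R' t x := by
  obtain ⟨t', y, h, h'⟩ := h
  exact ⟨t', y, h, hR _ _ (by omega) (frame_of_exec h) h'⟩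

theorem wp_skip : wp inp .skip R t x ↔ R (t + 1) x :=
  ⟨fun ⟨_, _, h, hR⟩ => by cases h; exact hR, fun h => ⟨_, _, .skip x, h⟩⟩

theorem wp_assign {v : ν} {e : WExpr ν α} :
    wp inp (.assign v e) R t x ↔ R (t + 1) (x.set v (e.eval x)) :=
  ⟨fun ⟨_, _, h, hR⟩ => by cases h; exact hR, fun h => ⟨_, _, .assign v e x, h⟩⟩

theorem wp_store {a : α} {e e' e'' : WExpr ν α} :
    wp inp (.store a e e' e'') R t x ↔
      R (t + 1) (x.put a (e.eval x) (e'.eval x) (e''.eval x)) :=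
  ⟨fun ⟨_, _, h, hR⟩ => by cases h; exact hR, fun h => ⟨_, _, .store a e e' e'' x, h⟩⟩

theorem wp_read {v : ν} {e : WExpr ν α} :
    wp inp (.read v e) R t x ↔
      ∃ h : e.eval x < inp.length, R (t + 1) (x.set v inp[e.eval x]) :=
  ⟨fun ⟨_, _, h, hR⟩ => by cases h with | read _ _ _ h => exact ⟨h, hR⟩,
    fun ⟨h, hR⟩ => ⟨_, _, .read v e x h, hR⟩⟩

theorem wp_seq {P P' : WProg ν α} : wp inp (.seq P P') R t x ↔ wp inp P (wp inp P' R) t x := by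
  constructor
  · rintro ⟨_, _, h, hR⟩
    cases h with
    | seq h₁ h₂ => exact ⟨_, _, h₁, _, _, h₂, by rwa [add_assoc]⟩
  · rintro ⟨t₁, y, h, t₂, z, h', hR⟩
    exact ⟨_, _, .seq h h', by rwa [← add_assoc]⟩

theorem wp_ite {e : WExpr ν α} {P P' : WProg ν α} :
    wp inp (.ite e P P') R t x ↔
      (e.eval x ≠ 0 → wp inp P R (t + 1) x) ∧ (e.eval x = 0 → wp inp P' R (t + 1) x) := by
  constructor
  · rintro ⟨_, _, h, hR⟩
    cases h with
    | iteTrue he h =>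
      exact ⟨fun _ => ⟨_, _, h, by rwa [add_assoc, add_comm 1]⟩, fun he' => absurd he' he⟩
    | iteFalse he h =>
      exact ⟨fun he' => absurd he he', fun _ => ⟨_, _, h, by rwa [add_assoc, add_comm 1]⟩⟩
  · rintro ⟨h₁, h₂⟩
    by_cases he : e.eval x = 0
    · obtain ⟨t', y, h, hR⟩ := h₂ he
      exact ⟨_, _, .iteFalse he h, by rwa [add_comm t', ← add_assoc]⟩
    · obtain ⟨t', y, h, hR⟩ := h₁ he
      exact ⟨_, _, .iteTrue he h, by rwa [add_comm t', ← add_assoc]⟩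

/-- Loops are verified with an invariant that mentions the clock; a bound `B` for the clock
guarantees termination. -/
theorem wp_while {e : WExpr ν α} {P : WProg ν α} (I : ℕ → WState ν α → Prop) (B : ℕ)
    (hB : ∀ t y, I t y → t ≤ B) (h0 : I t x)
    (hs : ∀ t y, I t y → Frame (.while e P) x y → e.eval y ≠ 0 → wp inp P I (t + 1) y)
    (hR : ∀ t y, I t y → Frame (.while e P) x y → e.eval y = 0 → R (t + 1) y) :
    wp inp (.while e P) R t x := by
  suffices H : ∀ m t y, B + 1 ≤ t + m → I t y → Frame (.while e P) x y →
      wp inp (.while e P) R t y from H (B + 1) t x (by omega) h0 (.refl _ _)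
  intro m
  induction m with
  | zero => intro t y hm hI _; have := hB t y hI; omega
  | succ m ih =>
    intro t y hm hI hF
    by_cases he : e.eval y = 0
    · exact ⟨1, y, .whileStop he, hR t y hI hF he⟩
    · obtain ⟨t₁, z, hz, hI'⟩ := hs t y hI hF he
      have hFz : Frame (.while e P) x z := hF.trans (P' := P) (frame_of_exec hz) (by simp [vars])
        (by simp [arrs])
      obtain ⟨t₂, z', hz', hR'⟩ := ih _ z (by omega) hI' hFz
      exact ⟨_, _, .whileStep he hz hz', by
        rwa [show t + (t₁ + t₂ + 1) = t + 1 + t₁ + t₂ by ring]⟩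

/-- `P` halts within `T` steps in a state that satisfies `Q`. -/
def Runs (inp : List ℕ) (P : WProg ν α) (x : WState ν α) (T : ℕ) (Q : WState ν α → Prop) : Prop :=
  wp inp P (fun t y => t ≤ T ∧ Q y) 0 x

theorem Runs.wp {P : WProg ν α} {T : ℕ} {Q : WState ν α → Prop} (h : Runs inp P x T Q)
    (hR : ∀ t' y, t' ≤ t + T → Frame P x y → Q y → R t' y) : wp inp P R t x := by
  obtain ⟨t', y, h, ht, hQ⟩ := h
  exact ⟨t', y, h, hR _ _ (by omega) (frame_of_exec h) hQ⟩

theorem Runs.mono {P : WProg ν α} {T T' : ℕ} {Q Q' : WState ν α → Prop} (h : Runs inp P x T Q)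
    (hT : T ≤ T') (hQ : ∀ y, Frame P x y → Q y → Q' y) : Runs inp P x T' Q' :=
  Runs.wp h fun _ y ht hF hy => ⟨by omega, hQ y hF hy⟩

theorem Runs.seq {P P' : WProg ν α} {T₁ T₂ T : ℕ} {Q Q' : WState ν α → Prop}
    (h : Runs inp P x T₁ Q) (h' : ∀ y, Frame P x y → Q y → Runs inp P' y T₂ Q')
    (hT : T₁ + T₂ ≤ T) : Runs inp (.seq P P') x T Q' :=
  wp_seq.2 <| h.wp fun _ y ht hF hy => (h' y hF hy).wp fun _ _ ht' _ hz => ⟨by omega, hz⟩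

/-- Rule for counting loops; the invariant depends on the counter and on the clock. -/
theorem wp_upFrom {i n : ν} {P : WProg ν α} {N k₀ : ℕ} (hi : i ∉ P.vars) (hn : n ∉ P.vars)
    (hin : n ≠ i) (hN : x.var n = N) (hk : x.var i = k₀) (hkN : k₀ ≤ N)
    (I : ℕ → ℕ → WState ν α → Prop) (h0 : I k₀ t x)
    (hs : ∀ k t y, k₀ ≤ k → k < N → y.var i = k → Frame (upFrom i n P) x y → I k t y →
      wp inp P (fun t' z => I (k + 1) (t' + 1) (z.set i (k + 1))) (t + 1) y)
    (hR : ∀ t y, y.var i = N → Frame (upFrom i n P) x y → I N t y → R (t + 1) y) :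
    wp inp (upFrom i n P) R t x := by
  have hn' : n ∉ (upFrom i n P).vars := by simp [upFrom, vars, hn, hin]
  suffices H : ∀ m k t y, k₀ ≤ k → k + m = N → y.var i = k → I k t y →
      Frame (upFrom i n P) x y → wp inp (upFrom i n P) R t y from
    H (N - k₀) k₀ t x le_rfl (by omega) hk h0 (.refl _ _)
  intro m
  induction m with
  | zero =>
    rintro k t y hk₀ rfl hik hI hF
    refine ⟨1, y, .whileStop ?_, hR t y hik hF hI⟩
    simp only [WExpr.eval, hF.var hn', hN]; omega
  | succ m ih =>
    intro k t y hk₀ hkm hik hI hF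
    obtain ⟨t₁, z, hz, hI'⟩ := hs k t y hk₀ (by omega) hik hF hI
    have hzi : z.var i = k := ((frame_of_exec hz).var hi).trans hik
    have hE : WExec inp (.seq P (.assign i (.succ (.var i)))) y (t₁ + 1) (z.set i (k + 1)) := by
      have := WExec.assign (inp := inp) i (.succ (.var i)) z
      simp only [WExpr.eval, hzi] at this
      exact .seq hz this
    obtain ⟨t₂, z', hz', hR'⟩ := ih (k + 1) _ (z.set i (k + 1)) (by omega) (by omega) (by simp) hI'
      (hF.trans (frame_of_exec hE) (by simp [upFrom, vars]) (by simp [upFrom, arrs]))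
    refine ⟨_, _, .whileStep ?_ hE hz', by
      rwa [show t + (t₁ + 1 + t₂ + 1) = t + 1 + t₁ + 1 + t₂ by ring]⟩
    simp only [WExpr.eval, hF.var hn', hN, hik]; omega

theorem wp_upTo {i n : ν} {P : WProg ν α} {N : ℕ} (hi : i ∉ P.vars) (hn : n ∉ P.vars)
    (hin : n ≠ i) (hN : x.var n = N)
    (I : ℕ → ℕ → WState ν α → Prop) (h0 : I 0 (t + 1) (x.set i 0))
    (hs : ∀ k t y, k < N → y.var i = k → Frame (upTo i n P) x y → I k t y →
      wp inp P (fun t' z => I (k + 1) (t' + 1) (z.set i (k + 1))) (t + 1) y)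
    (hR : ∀ t y, y.var i = N → Frame (upTo i n P) x y → I N t y → R (t + 1) y) :
    wp inp (upTo i n P) R t x := by
  refine wp_seq.2 (wp_assign.2 ?_)
  refine wp_upFrom hi hn hin (by simp [hin, hN]) (k₀ := 0) (by simp [WExpr.eval]) (by omega) I h0
    (fun k t y _ hk hik hF hI => hs k t y hk hik (frame_upTo hF) hI)
    (fun t y hiN hF hI => hR t y hiN (frame_upTo hF) hI)

/-- Rule for counting loops whose body takes at most `b` steps. -/
theorem runs_upFrom {i n : ν} {P : WProg ν α} {N k₀ b T : ℕ} {Q : WState ν α → Prop}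
    (hi : i ∉ P.vars) (hn : n ∉ P.vars)
    (hin : n ≠ i) (hN : x.var n = N) (hk : x.var i = k₀) (hkN : k₀ ≤ N)
    (I : ℕ → WState ν α → Prop) (h0 : I k₀ x)
    (hs : ∀ k y, k₀ ≤ k → k < N → y.var i = k → Frame (upFrom i n P) x y → I k y →
      Runs inp P y b (fun z => I (k + 1) (z.set i (k + 1))))
    (hQ : ∀ y, y.var i = N → Frame (upFrom i n P) x y → I N y → Q y)
    (hT : (N - k₀) * (b + 2) + 1 ≤ T) :
    Runs inp (upFrom i n P) x T Q := by
  refine wp_upFrom hi hn hin hN hk hkN (fun k t y => t ≤ (k - k₀) * (b + 2) ∧ I k y)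
    ⟨by simp, h0⟩ ?_ ?_
  · rintro k t y hk₀ hk hik hF ⟨ht, hI⟩
    refine (hs k y hk₀ hk hik hF hI).wp fun t' z ht' hF' hz => ⟨?_, hz⟩
    rw [show k + 1 - k₀ = k - k₀ + 1 by omega, add_mul]; omega
  · rintro t y hiN hF ⟨ht, hI⟩
    exact ⟨by omega, hQ y hiN hF hI⟩

theorem runs_upTo {i n : ν} {P : WProg ν α} {N b T : ℕ} {Q : WState ν α → Prop}
    (hi : i ∉ P.vars) (hn : n ∉ P.vars) (hin : n ≠ i) (hN : x.var n = N)
    (I : ℕ → WState ν α → Prop) (h0 : I 0 (x.set i 0))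
    (hs : ∀ k y, k < N → y.var i = k → Frame (upTo i n P) x y → I k y →
      Runs inp P y b (fun z => I (k + 1) (z.set i (k + 1))))
    (hQ : ∀ y, y.var i = N → Frame (upTo i n P) x y → I N y → Q y)
    (hT : N * (b + 2) + 2 ≤ T) :
    Runs inp (upTo i n P) x T Q := by
  refine wp_upTo hi hn hin hN (fun k t y => t ≤ k * (b + 2) + 1 ∧ I k y)
    ⟨by simp, h0⟩ ?_ ?_
  · rintro k t y hk hik hF ⟨ht, hI⟩
    refine (hs k y hk hik hF hI).wp fun t' z ht' hF' hz => ⟨?_, hz⟩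
    rw [add_mul]; omega
  · rintro t y hiN hF ⟨ht, hI⟩
    exact ⟨by omega, hQ y hiN hF hI⟩

end WProg

/-! ### The program -/

/-- The variables of the program. -/
inductive Var
  | A | n1 | n2 | f1 | f2 | i1 | i2 | p | tmp | row | col
  | V | s | q1 | q2 | i | a | tcnt | node | b | f | q
  | cnt | root | cur | go | ini | start | m | found | flag | sn | k
  | g | qq | r | e | np | y | pos | fin | lenU | lenV | ans
  deriving DecidableEq

/-- The arrays of the program. There are three sets of arrays for depth-first searches. -/
inductive Arr
  | step1 | step2 | memb1 | memb2 | fst | snd | code | mat | child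
  | alive | alw | proj1 | proj2 | nxt | out
  | vis (b : Fin 3) | par (b : Fin 3) | ord (b : Fin 3)
  deriving DecidableEq

/-- A number for each array. -/
def Arr.code' : Arr → ℕ
  | step1 => 0 | step2 => 1 | memb1 => 2 | memb2 => 3 | fst => 4 | snd => 5 | code => 6
  | mat => 7 | child => 8 | alive => 9 | alw => 10 | proj1 => 11 | proj2 => 12 | nxt => 13
  | out => 14 | vis b => 15 + b | par b => 18 + b | ord b => 21 + b

/-- The numbering of variables and arrays that is used for compilation. -/
def layout : Layout Var Arr where
  varCode := Var.ctorIdx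
  arrCode := Arr.code'
  K := 24
  varCode_injective v w h := by cases v <;> cases w <;> first | rfl | cases h
  arrCode_injective a b h := by
    cases a <;> cases b <;> simp only [Arr.code'] at h <;>
      first | rfl | omega | (congr 1; omega)
  arrCode_lt a := by cases a <;> simp only [Arr.code'] <;> omega

namespace Prog

open WExpr WProg

/-- Sequential composition of programs. -/
infixr:30 " ;; " => WProg.seq

/-- Expressions of the program. -/
abbrev Ex := WExpr Var Arr

/-- Programs over the variables and arrays of the program. -/
abbrev Pr := WProg Var Arr

/-- States of the program. -/
abbrev St := WState Var Arr

/-- An entry of an array that is used as one-dimensional array. -/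
abbrev get1 (a : Arr) (v : Var) : Ex := .get a (.var v) (.lit 0)

/-- Assignment to an entry of an array that is used as one-dimensional array. -/
abbrev put1 (a : Arr) (v : Var) (e : Ex) : Pr := .store a (.var v) (.lit 0) e

/-- `v := v + 1` -/
abbrev inc (v : Var) : Pr := .assign v (.succ (.var v))

/-- The entry of the adjacency matrix for the edge from `cur` to `i`, or in the opposite direction
if `tr` holds. -/
def entry (tr : Bool) : Ex :=
  if tr then .get .mat (.var .i) (.var .cur) else .get .mat (.var .cur) (.var .i)

/-- One step of the depth-first search: examine the next candidate `i` for a successor of the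
current node, or leave the current node if all candidates are exhausted. -/
def dfsStep (tr : Bool) (b : Fin 3) : Pr :=
  .assign .i (get1 .nxt .cur) ;;
  .ite (.sub (.var .V) (.var .i))
    (put1 .nxt .cur (.succ (.var .i)) ;;
      .ite (.both (entry tr) (.both (get1 .alive .i) (.sub (.lit 1) (get1 (.vis b) .i))))
        (put1 (.vis b) .i (.lit 1) ;; put1 .nxt .i (.lit 0) ;; put1 (.par b) .i (.var .cur) ;;
          .assign .cur (.var .i))
        .skip)
    (put1 (.ord b) .cnt (.var .cur) ;; inc .cnt ;;
      .ite (.ne (.var .cur) (.var .root)) (.assign .cur (get1 (.par b) .cur))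
        (.assign .go (.lit 0)))

/-- Depth-first search from `root` among the nodes that are alive and not yet visited. The nodes
are appended to the list `ord b` (of length `cnt`) in the order in which they are left; `par b`
are the parents in the search tree, and serve as the stack during the search. -/
def dfs (tr : Bool) (b : Fin 3) : Pr :=
  put1 (.vis b) .root (.lit 1) ;; put1 .nxt .root (.lit 0) ;; .assign .cur (.var .root) ;;
  .assign .go (.lit 1) ;; .while (.var .go) (dfsStep tr b)

/-- Read a table with `rows` rows and `cols` columns from the input. -/
def loadTable (rows cols : Var) (a : Arr) : Pr :=
  upTo .row rows (upTo .col cols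
    (.read .tmp (.var .p) ;; .store a (.var .row) (.var .col) (.var .tmp) ;; inc .p))

/-- Read one acceptor from the input. -/
def loadAcceptor (states finals init : Var) (step memb : Arr) : Pr :=
  .read init (.var .p) ;; inc .p ;; loadTable states .A step ;; loadTable finals states memb

/-- Read the five parameters, with exchanged acceptors if `sw` holds. -/
def loadParams (sw : Bool) : Pr :=
  .read .A (.lit 0) ;;
  (if sw then .read .n2 (.lit 1) ;; .read .n1 (.lit 2) ;; .read .f2 (.lit 3) ;; .read .f1 (.lit 4)
  else .read .n1 (.lit 1) ;; .read .n2 (.lit 2) ;; .read .f1 (.lit 3) ;; .read .f2 (.lit 4))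

/-- Read the two acceptors, with exchanged roles if `sw` holds. -/
def loadBoth (sw : Bool) : Pr :=
  .assign .p (.lit 5) ;;
  (if sw then loadAcceptor .n2 .f2 .i2 .step2 .memb2 ;; loadAcceptor .n1 .f1 .i1 .step1 .memb1
  else loadAcceptor .n1 .f1 .i1 .step1 .memb1 ;; loadAcceptor .n2 .f2 .i2 .step2 .memb2)

/-- Number the pairs of states. -/
def numbering : Pr :=
  .assign .V (.lit 0) ;;
  upTo .q1 .n1 (upTo .q2 .n2
    (put1 .fst .V (.var .q1) ;; put1 .snd .V (.var .q2) ;;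
      .store .code (.var .q1) (.var .q2) (.var .V) ;; inc .V))

/-- The adjacency matrix of the product automaton. A nonzero entry is the successor of a letter
that leads from the row to the column. -/
def matrix : Pr :=
  upTo .s .V (upTo .i .V (.store .mat (.var .s) (.var .i) (.lit 0))) ;;
  upTo .s .V (upTo .a .A
    (.store .mat (.var .s)
      (.get .code (.get .step1 (get1 .fst .s) (.var .a)) (.get .step2 (get1 .snd .s) (.var .a)))
      (.succ (.var .a))))

/-- Allocate a node of the trie. -/
def newNode : Pr :=
  .store .child (.var .tcnt) (.lit 0) (.lit 0) ;; .store .child (.var .tcnt) (.lit 1) (.lit 0)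

/-- Insert bit number `q` of the set number `f` into the trie. -/
def trieStep : Pr :=
  .assign .b (.get .memb2 (.var .f) (.var .q)) ;;
  .ite (.get .child (.var .node) (.var .b)) .skip
    (inc .tcnt ;; .store .child (.var .node) (.var .b) (.var .tcnt) ;; newNode) ;;
  .assign .node (.get .child (.var .node) (.var .b))

/-- The trie of all final state sets of the second acceptor. Its root is node `1`; node `0` is a
sink. The time of a search in the trie does not depend on the number of final state sets. -/
def trie : Pr :=
  .assign .tcnt (.lit 0) ;; newNode ;; inc .tcnt ;; newNode ;;
  upTo .f .f2 (.assign .node (.lit 1) ;; upTo .q .n2 trieStep)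

/-- Search for the set `proj2` in the trie; the answer is whether `node` is nonzero. -/
def lookup : Pr :=
  .assign .node (.lit 1) ;;
  upTo .q .n2 (.assign .node (.get .child (.var .node) (get1 .proj2 .q)))

/-- The states of the product that are reachable from the initial state `ini`. -/
def reach : Pr :=
  upTo .s .V (put1 .alive .s (.lit 1) ;; put1 (.vis 0) .s (.lit 0)) ;;
  .assign .cnt (.lit 0) ;; .assign .root (.get .code (.var .i1) (.var .i2)) ;;
  .assign .ini (.var .root) ;; dfs false 0

/-- Restrict the product to the states that are reachable, with first component in the set number
`f` and second component in `alw`. -/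
def restrict : Pr :=
  upTo .s .V
    (put1 .alive .s (.both (get1 (.vis 0) .s) (.both (.get .memb1 (.var .f) (get1 .fst .s))
      (.get .alw (get1 .snd .s) (.lit 0)))) ;;
    put1 (.vis 1) .s (.lit 0) ;; put1 (.vis 2) .s (.lit 0))

/-- The first pass of Kosaraju's algorithm. -/
def pass1 : Pr :=
  .assign .cnt (.lit 0) ;;
  upTo .s .V
    (.ite (.both (get1 .alive .s) (.sub (.lit 1) (get1 (.vis 1) .s)))
      (.assign .root (.var .s) ;; dfs false 1) .skip)

/-- The projections of the strongly connected component that stands in `ord 2` from `start` to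
`cnt`; `flag` is set if the component has an inner edge. -/
def project : Pr :=
  upTo .q .n1 (put1 .proj1 .q (.lit 0)) ;; upTo .q .n2 (put1 .proj2 .q (.lit 0)) ;;
  .assign .flag (.lit 0) ;; .assign .k (.var .start) ;;
  upFrom .k .cnt
    (.assign .s (get1 (.ord 2) .k) ;;
      .store .proj1 (get1 .fst .s) (.lit 0) (.lit 1) ;;
      .store .proj2 (get1 .snd .s) (.lit 0) (.lit 1) ;;
      .ite (.get .mat (.var .root) (.var .s)) (.assign .sn (.var .s) ;; .assign .flag (.lit 1))
        .skip)

/-- Test whether the component refutes the inclusion. -/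
def check : Pr :=
  project ;;
  upTo .q .n1
    (.ite (.ne (get1 .proj1 .q) (.get .memb1 (.var .f) (.var .q))) (.assign .flag (.lit 0))
      .skip) ;;
  .ite (.var .flag) (lookup ;; .ite (.var .node) .skip (.assign .found (.lit 1))) .skip

/-- The second pass of Kosaraju's algorithm, with a test of each component. -/
def pass2 : Pr :=
  .assign .m (.var .cnt) ;; .assign .cnt (.lit 0) ;;
  .while (.both (.var .m) (.sub (.lit 1) (.var .found)))
    (.assign .m (.sub (.var .m) (.lit 1)) ;; .assign .root (get1 (.ord 1) .m) ;;
      .ite (get1 (.vis 2) .root) .skip (.assign .start (.var .cnt) ;; dfs true 2 ;; check))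

/-- Test all components of the restricted product. -/
def components : Pr := restrict ;; pass1 ;; pass2

/-- Search for a component that refutes the inclusion, for all first components in a final state
set, and all second components, or those in a final state set without one of its elements. -/
def search : Pr :=
  .assign .found (.lit 0) ;;
  upTo .f .f1
    (.ite (.var .found) .skip
      (upTo .s .n2 (put1 .alw .s (.lit 1)) ;; components ;;
        upTo .g .f2 (upTo .qq .n2
          (.ite (.var .found) .skip
            (upTo .s .n2 (put1 .alw .s (.get .memb2 (.var .g) (.var .s))) ;;
              put1 .alw .qq (.lit 0) ;; components)))))

/-- Append to the output the letters of the path from `r` to `y` in a search tree. -/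
def upPath (b : Fin 3) : Pr :=
  .assign .e (.var .pos) ;; .assign .s (.var .y) ;;
  .while (.ne (.var .s) (.var .r)) (inc .e ;; .assign .s (get1 (.par b) .s)) ;;
  .assign .np (.var .e) ;; .assign .s (.var .y) ;;
  .while (.sub (.var .e) (.var .pos))
    (.assign .e (.sub (.var .e) (.lit 1)) ;;
      put1 .out .e (.sub (.get .mat (get1 (.par b) .s) (.var .s)) (.lit 1)) ;;
      .assign .s (get1 (.par b) .s)) ;;
  .assign .pos (.var .np)

/-- Append to the output the letters of the path from `s` to `r` in a search tree of the
transposed graph. -/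
def downPath : Pr :=
  .while (.ne (.var .s) (.var .r))
    (put1 .out .pos (.sub (.get .mat (.var .s) (get1 (.par 2) .s)) (.lit 1)) ;; inc .pos ;;
      .assign .s (get1 (.par 2) .s))

/-- A search tree for the component that stands in `ord 2` from `start` to `cnt`. -/
def componentTree : Pr :=
  upTo .s .V (put1 .alive .s (.lit 0) ;; put1 (.vis 1) .s (.lit 0)) ;;
  .assign .k (.var .start) ;;
  upFrom .k .cnt (.assign .s (get1 (.ord 2) .k) ;; put1 .alive .s (.lit 1)) ;;
  .assign .fin (.var .cnt) ;; .assign .cnt (.lit 0) ;; dfs false 1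

/-- Write the two words of the counterexample: a path from the initial state to `root`, and a
closed path that visits exactly the states of the component. -/
def extract : Pr :=
  componentTree ;;
  .assign .pos (.lit 0) ;; .assign .y (.var .root) ;; .assign .r (.var .ini) ;; upPath 0 ;;
  .assign .lenU (.var .pos) ;; .assign .r (.var .root) ;;
  put1 .out .pos (.sub (.get .mat (.var .root) (.var .sn)) (.lit 1)) ;; inc .pos ;;
  .assign .s (.var .sn) ;; downPath ;;
  .assign .k (.var .start) ;;
  upFrom .k .fin (.assign .y (get1 (.ord 2) .k) ;; upPath 1 ;; .assign .s (.var .y) ;;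
    downPath) ;;
  .assign .lenV (.sub (.var .pos) (.var .lenU))

/-- Everything after reading the input. -/
def decide : Pr :=
  numbering ;; matrix ;; trie ;; reach ;; search ;;
  .ite (.var .found) (extract ;; .assign .ans (.lit 0)) (.assign .ans (.lit 1))

/-- The inclusion test, with exchanged acceptors if `sw` holds. -/
def inclusion (sw : Bool) : Pr :=
  loadParams sw ;;
  .ite (.both (.var .A) (.var .f1)) (loadBoth sw ;; decide) (.assign .ans (.lit 1))

/-- The equivalence test. -/
def equivalence : Pr :=
  inclusion false ;; .ite (.var .ans) (inclusion true) .skip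

end Prog

/-! ### Depth-first search -/

namespace Prog

open WExpr WProg Relation

/-- The graph with edge relation `E` on the nodes below `n` that satisfy `al` is represented by the
adjacency matrix, which is transposed if `tr` holds. -/
structure GraphRep (tr : Bool) (n : ℕ) (al : ℕ → Prop) (E : ℕ → ℕ → Prop) (x : St) : Prop where
  V : x.var .V = n
  alive : ∀ s < n, (x.arr .alive s 0 ≠ 0 ↔ al s)
  edge : ∀ s < n, ∀ s' < n, al s → al s' →
    ((if tr then x.arr .mat s' s else x.arr .mat s s') ≠ 0 ↔ E s s')
  lt : ∀ s s', E s s' → (s < n ∧ al s) ∧ (s' < n ∧ al s')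

theorem GraphRep.congr {tr : Bool} {n : ℕ} {al : ℕ → Prop} {E : ℕ → ℕ → Prop} {x y : St}
    (h : GraphRep tr n al E x) (hV : y.var .V = x.var .V) (ha : y.arr .alive = x.arr .alive)
    (hm : y.arr .mat = x.arr .mat) : GraphRep tr n al E y := by
  obtain ⟨h1, h2, h3, h4⟩ := h
  exact ⟨hV.trans h1, by rwa [ha], by rwa [hm], h4⟩

/-- `L` lists the visited nodes in the order in which the depth-first searches have left them.
The field `order` is what makes Kosaraju's algorithm work: an edge from a node left at or before
the time of `L[k]` to a node left later ends in a node from which `L[k]` is reachable. -/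
structure Visited (n : ℕ) (al : ℕ → Prop) (E : ℕ → ℕ → Prop) (b : Fin 3) (x : St)
    (L : List ℕ) : Prop where
  cnt : x.var .cnt = L.length
  ord : ∀ k (h : k < L.length), x.arr (.ord b) k 0 = L[k]
  nodup : L.Nodup
  mem : ∀ s ∈ L, s < n ∧ al s
  vis : ∀ s < n, x.arr (.vis b) s 0 = if s ∈ L then 1 else 0
  closed : ∀ s ∈ L, ∀ s', E s s' → s' ∈ L
  order : ∀ k (h : k < L.length), ∀ s ∈ L.take (k + 1), ∀ w, E s w →
    w ∈ L.take (k + 1) ∨ ReflTransGen E w L[k]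

/-- The path of length `d` from `s` to `root` along the parents `par` stays inside `S` and
consists of reversed edges. -/
inductive TreePath (E : ℕ → ℕ → Prop) (par : ℕ → ℕ) (S : ℕ → Prop) (root : ℕ) : ℕ → ℕ → Prop
  | root : S root → TreePath E par S root root 0
  | step {s d : ℕ} : S s → s ≠ root → E (par s) s → TreePath E par S root (par s) d →
      TreePath E par S root s (d + 1)

theorem TreePath.mono {E : ℕ → ℕ → Prop} {par par' : ℕ → ℕ} {S S' : ℕ → Prop} {root s d : ℕ}
    (h : TreePath E par S root s d) (hS : ∀ s, S s → S' s) (hp : ∀ s, S s → par' s = par s) :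
    TreePath E par' S' root s d := by
  induction h with
  | root h => exact .root (hS _ h)
  | step h1 h2 h3 _ ih => exact .step (hS _ h1) h2 (by rwa [hp _ h1]) (by rwa [hp _ h1])

theorem TreePath.mem {E : ℕ → ℕ → Prop} {par : ℕ → ℕ} {S : ℕ → Prop} {root s d : ℕ}
    (h : TreePath E par S root s d) : S s := by
  cases h <;> assumption

/-- The invariant of the search from `root`, where `L` lists the nodes visited before, `st` is the
stack and `N` lists the nodes left so far. -/
structure DfsInv (n : ℕ) (al : ℕ → Prop) (E : ℕ → ℕ → Prop) (b : Fin 3) (L : List ℕ)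
    (root : ℕ) (st N : List ℕ) (x : St) : Prop where
  go : x.var .go ≠ 0 ↔ st ≠ []
  cur : ∀ s ∈ st.head?, x.var .cur = s
  last : ∀ s ∈ st.getLast?, s = root
  chain : st.IsChain fun s s' => x.arr (.par b) s 0 = s' ∧ E s' s
  nodup : (st ++ N).Nodup
  mem : ∀ s ∈ st ++ N, s < n ∧ al s ∧ s ∉ L
  vis : ∀ s < n, x.arr (.vis b) s 0 = if s ∈ L ++ (st ++ N) then 1 else 0
  cnt : x.var .cnt = (L ++ N).length
  ord : ∀ k (h : k < (L ++ N).length), x.arr (.ord b) k 0 = (L ++ N)[k]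
  nxt : ∀ s ∈ st, x.arr .nxt s 0 ≤ n ∧ ∀ i < x.arr .nxt s 0, E s i → i ∈ L ++ (st ++ N)
  closed : ∀ s ∈ N, ∀ i, E s i → i ∈ L ++ (st ++ N)
  order : ∀ k (h : k < (L ++ N).length), ∀ s ∈ (L ++ N).take (k + 1), ∀ w, E s w →
    w ∈ (L ++ N).take (k + 1) ∨ ReflTransGen E w (L ++ N)[k]
  root_mem : root ∈ st ++ N
  tree : ∀ s ∈ st ++ N, ∃ d < (st ++ N).length,
    TreePath E (fun s => x.arr (.par b) s 0) (· ∈ st ++ N) root s d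

theorem reflTransGen_of_isChain {E : ℕ → ℕ → Prop} {f : ℕ → ℕ} {st : List ℕ} :
    ∀ {a : ℕ}, (a :: st).IsChain (fun s s' => f s = s' ∧ E s' s) →
      ∀ s ∈ a :: st, ReflTransGen E s a := by
  induction st with
  | nil => intro a _ s hs; simp only [List.mem_singleton] at hs; rw [hs]
  | cons c st ih =>
    intro a h s hs
    rw [List.isChain_cons_cons] at h
    rcases List.mem_cons.1 hs with rfl | hs
    · exact .refl
    · exact (ih h.2 s hs).tail h.1.2

variable {inp : List ℕ} {tr : Bool} {n : ℕ} {al : ℕ → Prop} {E : ℕ → ℕ → Prop} {b : Fin 3}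
  {L : List ℕ} {root : ℕ}

/-- The potential that bounds the running time of the search: each step either advances the counter
`nxt` of the current node, which stays at most `n`, or leaves this node for good and trades its
exhausted counter for `n + 1`. -/
def dfsCost (n : ℕ) (st N : List ℕ) (x : St) : ℕ :=
  (st.map fun s => x.arr .nxt s 0).sum + (n + 1) * N.length

theorem eval_entry (tr : Bool) (x : St) : (entry tr).eval x =
    if tr then x.arr .mat (x.var .i) (x.var .cur) else x.arr .mat (x.var .cur) (x.var .i) := by
  cases tr <;> rfl

theorem vars_dfsStep (tr : Bool) (b : Fin 3) : (dfsStep tr b).vars = [.i, .cur, .cnt, .cur, .go] :=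
  rfl

theorem arrs_dfsStep (tr : Bool) (b : Fin 3) :
    (dfsStep tr b).arrs = [.nxt, .vis b, .nxt, .par b, .ord b] :=
  rfl

/-- One step of the search preserves the invariant and increases the potential. -/
theorem wp_dfsStep {x : St} {st N : List ℕ} {t : ℕ} {R : ℕ → St → Prop}
    (hG : GraphRep tr n al E x) (hr : x.var .root = root) (hL : ∀ s ∈ L, ∀ s', E s s' → s' ∈ L)
    (hI : DfsInv n al E b L root st N x) (hst : st ≠ [])
    (hR : ∀ t' y st' N', t' ≤ t + 8 → DfsInv n al E b L root st' N' y →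
      dfsCost n st N x + 1 ≤ dfsCost n st' N' y → R t' y) :
    wp inp (dfsStep tr b) R t x := by
  obtain ⟨c, st, rfl⟩ := List.exists_cons_of_ne_nil hst
  have hcur : x.var .cur = c := hI.cur c (by simp)
  have hV := hG.V
  have hc := hI.mem c (by simp)
  have hcn := hI.nxt c (by simp)
  have hnd := hI.nodup
  simp only [List.cons_append, List.nodup_cons, List.mem_append, not_or] at hnd
  simp only [dfsStep, wp_seq, wp_assign, wp_ite, wp_store, wp_skip, eval, eval_entry, hcur,
    WState.set_var, WState.set_arr, WState.put_var, if_true, reduceCtorEq, if_false, hV]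
  generalize hi : x.arr .nxt c 0 = i at *
  have hx1 : ((x.set .i i).put .nxt c 0 (i + 1)).arr .mat = x.arr .mat := by simp
  have hx2 : ((x.set .i i).put .nxt c 0 (i + 1)).arr .alive = x.arr .alive := by simp
  have hx3 : ((x.set .i i).put .nxt c 0 (i + 1)).arr (.vis b) = x.arr (.vis b) := by simp
  simp only [hx1, hx2, hx3]
  refine ⟨fun hlt => ?_, fun hge => ?_⟩
  · have hin : i < n := by omega
    have hvis := hI.vis i hin
    have hal := hG.alive i hin
    have hed := hG.edge c hc.1 i hin hc.2.1
    -- the sum of the counters grows by one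
    have hsum : ∀ y : St, y.arr .nxt c 0 = i + 1 → (∀ s ∈ st, y.arr .nxt s 0 = x.arr .nxt s 0) →
        dfsCost n (c :: st) N y = dfsCost n (c :: st) N x + 1 := by
      intro y h1 h2
      have : (st.map fun s => y.arr .nxt s 0) = st.map fun s => x.arr .nxt s 0 :=
        List.map_congr_left h2
      simp only [dfsCost, List.map_cons, List.sum_cons, this, h1, hi]; omega
    refine ⟨fun hnew => ?_, fun hold => ?_⟩
    -- the candidate is a new successor and becomes the current node
    · have hnew1 : al i := hal.1 (by omega)
      have hnew2 : E c i := (hed hnew1).1 (by omega)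
      have hnew3 : i ∉ L ++ (c :: st ++ N) := by
        intro h; rw [if_pos h] at hvis; omega
      have hic : i ≠ c := by rintro rfl; simp at hnew3
      simp only [List.cons_append, List.mem_append, List.mem_cons, not_or] at hnew3
      refine hR _ _ (i :: c :: st) N (by omega) ?_ ?_
      · constructor
        · simpa using hI.go
        · simp
        · intro s hs; exact hI.last s (by simpa using hs)
        · rw [List.isChain_cons_cons]
          refine ⟨by simp [hnew2], hI.chain.imp_of_mem_imp ?_⟩
          intro s s' hs _ h
          have : s ≠ i := by rintro rfl; simp at hs; tauto
          simpa [this] using h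
        · have := hI.nodup
          simp only [List.cons_append, List.nodup_cons, List.mem_cons, List.mem_append] at this ⊢
          tauto
        · intro s hs
          rw [List.cons_append, List.mem_cons] at hs
          rcases hs with rfl | hs
          · exact ⟨hin, hnew1, hnew3.1⟩
          · exact hI.mem s hs
        · intro s hs
          have := hI.vis s hs
          simp only [ne_eq, reduceCtorEq, not_false_eq_true, WState.put_arr_of_ne,
            WState.put_arr_self, WState.set_arr, and_true, this]
          by_cases hsi : s = i
          · simp [hsi]
          · simp [hsi]
        · simpa using hI.cnt
        · simpa using hI.ord
        · intro s hs
          have hmem : ∀ j, j ∈ L ++ (c :: st ++ N) → j ∈ L ++ (i :: c :: st ++ N) := by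
            intro j hj; simp only [List.mem_append, List.mem_cons] at hj ⊢; tauto
          simp only [List.mem_cons] at hs
          rcases hs with rfl | rfl | hs
          · simp
          · simp only [ne_eq, reduceCtorEq, not_false_eq_true, WState.put_arr_of_ne,
              WState.put_arr_self, WState.set_arr, and_true, if_true, Ne.symm hic,
              if_false]
            refine ⟨by omega, fun j hj hE => ?_⟩
            rcases Nat.lt_succ_iff_lt_or_eq.1 hj with hj | rfl
            · exact hmem _ (hcn.2 j hj hE)
            · simp
          · have h1 : s ≠ i := by rintro rfl; tauto
            have h2 : s ≠ c := by rintro rfl; tauto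
            have := hI.nxt s (by simp [hs])
            simp only [WState.set_arr, ne_eq, reduceCtorEq, not_false_eq_true,
              WState.put_arr_of_ne, WState.put_arr_self, h1, h2, false_and, if_false]
            exact ⟨this.1, fun j hj hE => hmem _ (this.2 j hj hE)⟩
        · intro s hs j hE
          have := hI.closed s hs j hE
          simp only [List.mem_append, List.mem_cons] at this ⊢; tauto
        · exact hI.order
        · have := hI.root_mem
          simp only [List.mem_append, List.mem_cons] at this ⊢; tauto
        · have hp : ∀ s, s ∈ c :: st ++ N → s ≠ i := by
            rintro s hs rfl
            simp only [List.cons_append, List.mem_append, List.mem_cons] at hs; tauto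
          have hmono : ∀ s d, TreePath E (fun s => x.arr (.par b) s 0) (· ∈ c :: st ++ N) root s d →
              TreePath E (fun s => if s = i then c else x.arr (.par b) s 0)
                (· ∈ i :: c :: st ++ N) root s d := by
            intro s d h
            exact h.mono (fun s h => List.mem_cons_of_mem _ h) (fun s h => by simp [hp s h])
          intro s hs
          simp only [WState.set_arr, WState.put_arr_self, and_true]
          rw [List.cons_append, List.mem_cons] at hs
          rcases hs with rfl | hs
          · obtain ⟨d, hd, h⟩ := hI.tree c (by simp)
            refine ⟨d + 1, by simpa using hd, .step (by simp) ?_ (by simpa using hnew2)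
              (by simpa using hmono _ _ h)⟩
            rintro rfl
            exact hp _ hI.root_mem rfl
          · obtain ⟨d, hd, h⟩ := hI.tree s hs
            exact ⟨d, by simp at hd ⊢; omega, by simpa using hmono _ _ h⟩
      · rw [← hsum ((x.set .i i).put .nxt c 0 (i + 1)) (by simp) ?_]
        · simp only [dfsCost, List.map_cons, List.sum_cons]
          have h3 : ∀ s ∈ c :: st, s ≠ i := by
            rintro s hs rfl; simp only [List.mem_cons] at hs; tauto
          have h4 : ∀ s ∈ st, s ≠ i := fun s hs => h3 s (by simp [hs])
          simp only [WState.set_arr, ne_eq, reduceCtorEq, not_false_eq_true,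
              WState.put_arr_of_ne, WState.put_arr_self, and_true, if_true,
              Ne.symm hic, if_false]
          have : (st.map fun s => if s = i then 0 else if s = c then i + 1 else x.arr .nxt s 0) =
              st.map fun s => if s = c then i + 1 else x.arr .nxt s 0 :=
            List.map_congr_left fun s hs => by simp [h4 s hs]
          rw [this]; omega
        · intro s hs
          have h2 : s ≠ c := by rintro rfl; tauto
          simp [h2]
    -- the candidate is no successor, or has been visited before
    · have hold' : ∀ j < i + 1, E c j → j ∈ L ++ (c :: st ++ N) := by
        intro j hj hE
        rcases Nat.lt_succ_iff_lt_or_eq.1 hj with hj | rfl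
        · exact hcn.2 j hj hE
        · by_contra hnot
          rw [if_neg hnot] at hvis
          have h1 := hal.2 (hG.lt _ _ hE).2.2
          have h2 := (hed (hG.lt _ _ hE).2.2).2 hE
          omega
      refine hR _ _ (c :: st) N (by omega) ?_ ?_
      · constructor
        · simpa using hI.go
        · simpa using hI.cur
        · exact hI.last
        · simpa using hI.chain
        · exact hI.nodup
        · exact hI.mem
        · simpa using hI.vis
        · simpa using hI.cnt
        · simpa using hI.ord
        · intro s hs
          simp only [List.mem_cons] at hs
          rcases hs with rfl | hs
          · simp only [WState.put_arr_self, and_true, if_true]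
            exact ⟨by omega, hold'⟩
          · have h2 : s ≠ c := by rintro rfl; tauto
            have := hI.nxt s (by simp [hs])
            simpa [h2] using this
        · exact hI.closed
        · exact hI.order
        · exact hI.root_mem
        · simpa using hI.tree
      · rw [← hsum ((x.set .i i).put .nxt c 0 (i + 1)) (by simp) ?_]
        intro s hs
        have h2 : s ≠ c := by rintro rfl; tauto
        simp [h2]
  -- all candidates are exhausted, and the search leaves the current node `c`
  · have hin : i = n := by omega
    subst hin
    have hcout : ∀ j, E c j → j ∈ L ++ (c :: st ++ N) := fun j hE =>
      hcn.2 j (hG.lt _ _ hE).2.1 hE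
    have hperm : ∀ j, j ∈ st ++ (N ++ [c]) ↔ j ∈ c :: st ++ N := by
      intro j; simp only [List.mem_append, List.mem_cons, List.not_mem_nil, or_false]; tauto
    have hlen : (L ++ (N ++ [c])).length = (L ++ N).length + 1 := by simp; omega
    have hord : ∀ y : St, (∀ k, y.arr (.ord b) k 0 =
        if k = (L ++ N).length then c else x.arr (.ord b) k 0) →
        ∀ k (h : k < (L ++ (N ++ [c])).length), y.arr (.ord b) k 0 = (L ++ (N ++ [c]))[k] := by
      intro y hy k hk
      rw [hy]
      by_cases hkl : k = (L ++ N).length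
      · simp only [← List.append_assoc]
        rw [if_pos hkl, List.getElem_append_right (by omega)]; simp
      · rw [if_neg hkl, hI.ord k (by omega)]
        simp only [← List.append_assoc (as := L)]
        rw [List.getElem_append_left (as := L ++ N)]
    have horder : ∀ k (h : k < (L ++ (N ++ [c])).length), ∀ s ∈ (L ++ (N ++ [c])).take (k + 1),
        ∀ w, E s w → w ∈ (L ++ (N ++ [c])).take (k + 1) ∨
          ReflTransGen E w (L ++ (N ++ [c]))[k] := by
      intro k hk s hs w hE
      simp only [← List.append_assoc] at hs ⊢
      by_cases hkl : k = (L ++ N).length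
      -- the nodes that have not been left are on the stack, and lead to `c`
      · rw [List.take_of_length_le (by simp [hkl]; omega)] at hs ⊢
        have hget : (L ++ N ++ [c])[k]'(by simp at hkl ⊢; omega) = c := by
          rw [List.getElem_append_right (by omega)]; simp
        rw [hget]
        have hw : w ∈ L ++ (c :: st ++ N) := by
          simp only [List.mem_append, List.mem_singleton] at hs
          rcases hs with (hs | hs) | rfl
          · exact List.mem_append_left _ (hL s hs w hE)
          · exact hI.closed s hs w hE
          · exact hcout w hE
        simp only [List.mem_append, List.mem_cons, List.not_mem_nil, or_false] at hw ⊢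
        rcases hw with hw | (rfl | hw) | hw
        · exact .inl (.inl (.inl hw))
        · exact .inr .refl
        · exact .inr (reflTransGen_of_isChain hI.chain w (by simp [hw]))
        · exact .inl (.inl (.inr hw))
      · have hkl' : k < (L ++ N).length := by omega
        rw [List.take_append_of_le_length (by omega)] at hs ⊢
        rw [List.getElem_append_left hkl']
        exact hI.order k hkl' s hs w hE
    have hcost : ∀ y : St, (∀ s ∈ st, y.arr .nxt s 0 = x.arr .nxt s 0) →
        dfsCost i (c :: st) N x + 1 ≤ dfsCost i st (N ++ [c]) y := by
      intro y h2
      have : (st.map fun s => y.arr .nxt s 0) = st.map fun s => x.arr .nxt s 0 :=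
        List.map_congr_left h2
      simp only [dfsCost, List.map_cons, List.sum_cons, this, hi, List.length_append,
        List.length_singleton, mul_add]; omega
    -- everything except for the fields that concern the control flow
    have key : ∀ y : St, (y.var .go ≠ 0 ↔ st ≠ []) → (∀ s ∈ st.head?, y.var .cur = s) →
        y.var .cnt = x.var .cnt + 1 → y.arr (.par b) = x.arr (.par b) →
        y.arr .nxt = x.arr .nxt → y.arr (.vis b) = x.arr (.vis b) →
        (∀ k, y.arr (.ord b) k 0 =
          if k = (L ++ N).length then c else x.arr (.ord b) k 0) →
        DfsInv i al E b L root st (N ++ [c]) y := by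
      intro y h1 h2 h3 h4 h5 h6 h7
      constructor
      · exact h1
      · exact h2
      · intro s hs
        refine hI.last s ?_
        cases st with
        | nil => simp at hs
        | cons a l => simpa using hs
      · rw [h4]; exact hI.chain.tail
      · have := hI.nodup
        refine List.Perm.nodup_iff ?_ |>.1 this
        rw [← List.append_assoc]
        exact (List.perm_append_singleton c (st ++ N)).symm
      · intro s hs; exact hI.mem s ((hperm s).1 hs)
      · intro s hs
        rw [h6, hI.vis s hs]
        simp only [List.mem_append (s := L), hperm]
      · rw [h3, hI.cnt, hlen]
      · exact hord y h7
      · intro s hs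
        have := hI.nxt s (by simp [hs])
        rw [h5]
        simpa only [List.mem_append (s := L), hperm] using this
      · intro s hs j hE
        rw [List.mem_append, hperm, ← List.mem_append]
        rcases List.mem_append.1 hs with hs | hs
        · exact hI.closed s hs j hE
        · rw [List.mem_singleton] at hs; subst hs; exact hcout j hE
      · exact horder
      · rw [hperm]; exact hI.root_mem
      · intro s hs
        rw [hperm] at hs
        obtain ⟨d, hd, h⟩ := hI.tree s hs
        refine ⟨d, by simp at hd ⊢; omega, ?_⟩
        rw [h4]
        exact h.mono (fun s h => (hperm s).2 h) (fun _ _ => rfl)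
    refine ⟨fun hne => ?_, fun heq => ?_⟩
    · have hne' : c ≠ root := by
        rintro rfl; simp [hr] at hne
      cases st with
      | nil => exact absurd (hI.last c (by simp)) hne'
      | cons c' st =>
        have hch := hI.chain
        rw [List.isChain_cons_cons] at hch
        refine hR _ _ (c' :: st) (N ++ [c]) (by omega) (key _ ?_ ?_ ?_ ?_ ?_ ?_ ?_) (hcost _ ?_)
        · have := hI.go; simpa using this
        · simp [hch.1.1]
        · simp
        · simp
        · simp
        · simp
        · intro k; simp [hI.cnt]
        · simp
    · have heq' : c = root := by
        simp only [hr] at heq; omega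
      have hst' : st = [] := by
        rcases List.eq_nil_or_concat st with h | ⟨l, a, rfl⟩
        · exact h
        · have := hI.last a (by
            rw [List.concat_eq_append, ← List.cons_append]; exact List.getLast?_concat)
          subst this heq'
          simp at hnd
      subst hst'
      refine hR _ _ [] (N ++ [c]) (by omega) (key _ ?_ ?_ ?_ ?_ ?_ ?_ ?_) (hcost _ ?_)
      · simp
      · simp
      · simp
      · simp
      · simp
      · simp
      · intro k; simp [hI.cnt]
      · simp

theorem length_le_of_nodup {n : ℕ} {l : List ℕ} (h : l.Nodup) (hl : ∀ s ∈ l, s < n) :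
    l.length ≤ n := by
  simpa using (h.subperm (l₂ := List.range n) fun s hs => List.mem_range.2 (hl s hs)).length_le

theorem DfsInv.cost_le {st N : List ℕ} {x : St} (h : DfsInv n al E b L root st N x) :
    dfsCost n st N x ≤ n * n + (n + 1) * n := by
  have h1 := length_le_of_nodup h.nodup fun s hs => (h.mem s hs).1
  rw [List.length_append] at h1
  have h2 : (st.map fun s => x.arr .nxt s 0).sum ≤ (st.map fun s => x.arr .nxt s 0).length * n := by
    refine List.sum_le_card_nsmul _ _ ?_
    simp only [List.mem_map]
    rintro _ ⟨s, hs, rfl⟩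
    exact (h.nxt s hs).1
  rw [List.length_map] at h2
  have h3 : st.length * n ≤ n * n := Nat.mul_le_mul_right _ (by omega)
  have h4 : (n + 1) * N.length ≤ (n + 1) * n := Nat.mul_le_mul_left _ (by omega)
  unfold dfsCost; omega

/-- The search from `root` appends the list `N` of the nodes that it visits to the list of visited
nodes; it takes linear time in `n` for each of them. -/
theorem wp_dfs {x : St} {t : ℕ} {R : ℕ → St → Prop} (hG : GraphRep tr n al E x)
    (hV : Visited n al E b x L) (hr : x.var .root = root) (hrn : root < n) (hra : al root)
    (hrL : root ∉ L)
    (hR : ∀ t' y N, t' ≤ t + 9 * ((n + 1) * N.length) + 5 → Frame (dfs tr b) x y →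
      Visited n al E b y (L ++ N) → root ∈ N →
      (∀ s ∈ N, ∃ d < N.length,
        TreePath E (fun s => y.arr (.par b) s 0) (· ∈ N) root s d) → R t' y) :
    wp inp (dfs tr b) R t x := by
  have hF : wp inp (dfs tr b) (fun t' y => Frame (dfs tr b) x y → R t' y) t x := by
    simp only [dfs, wp_seq, wp_assign, wp_store, eval, hr, WState.put_var]
    refine wp_while (fun t' y => ∃ st N, DfsInv n al E b L root st N y ∧
      t' ≤ t + 4 + 9 * dfsCost n st N y) (t + 4 + 9 * (n * n + (n + 1) * n)) ?_ ?_ ?_ ?_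
    · rintro t' y ⟨st, N, h, ht⟩
      have := h.cost_le; omega
    · refine ⟨[root], [], ?_, by omega⟩
      constructor
      · simp
      · simp
      · simp
      · simp
      · simp
      · simp [hrn, hra, hrL]
      · intro s hs
        have := hV.vis s hs
        by_cases h : s = root <;> simp [h, this]
      · simpa using hV.cnt
      · simpa using hV.ord
      · simp
      · simp
      · simpa using hV.order
      · simp
      · simpa using TreePath.root (by simp)
    · rintro t' y ⟨st, N, h, ht⟩ hFy hgo
      refine wp_dfsStep (n := n) (al := al) (hG.congr ?_ ?_ ?_) (root := root) ?_ hV.closed h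
        (h.go.1 hgo) ?_
      · rw [hFy.var (by simp [vars, vars_dfsStep])]; simp
      · rw [hFy.arr (by simp [arrs, arrs_dfsStep])]; simp
      · rw [hFy.arr (by simp [arrs, arrs_dfsStep])]; simp
      · rw [hFy.var (by simp [vars, vars_dfsStep])]; simp [hr]
      · intro t'' z st' N' ht'' hI' hc
        exact ⟨st', N', hI', by omega⟩
    · rintro t' y ⟨st, N, h, ht⟩ _ hgo hF
      obtain rfl : st = [] := by
        by_contra hne; exact (h.go.2 hne) hgo
      refine hR _ y N ?_ hF ?_ (by simpa using h.root_mem) (by simpa using h.tree)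
      · simp only [dfsCost, List.map_nil, List.sum_nil] at ht; omega
      · constructor
        · exact h.cnt
        · exact h.ord
        · refine List.nodup_append'.2 ⟨hV.nodup, by simpa using h.nodup, ?_⟩
          intro s hs hs'
          exact (h.mem s (by simpa using hs')).2.2 hs
        · intro s hs
          rcases List.mem_append.1 hs with hs | hs
          · exact hV.mem s hs
          · exact ⟨(h.mem s (by simpa using hs)).1, (h.mem s (by simpa using hs)).2.1⟩
        · simpa using h.vis
        · intro s hs s' hE
          rcases List.mem_append.1 hs with hs | hs
          · exact List.mem_append_left _ (hV.closed s hs s' hE)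
          · simpa using h.closed s hs s' hE
        · exact h.order
  exact hF.mono fun t' y _ hF' h => h hF'

end Prog

/-! ### Strongly connected components -/

open Relation

/-- The heart of Kosaraju's algorithm: if the order of `L` is a finishing order of a depth-first
search, and `L[i]` is reachable from `b` through nodes that were left no later than `L[i]`, then
`b` is reachable from `L[i]`. -/
theorem reachable_of_order {E : ℕ → ℕ → Prop} {L : List ℕ} (hnd : L.Nodup)
    (hord : ∀ k (h : k < L.length), ∀ s ∈ L.take (k + 1), ∀ w, E s w →
      w ∈ L.take (k + 1) ∨ ReflTransGen E w L[k])
    {i : ℕ} (hi : i < L.length) : ∀ m k (hk : k < L.length), k + m = i →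
    ReflTransGen (fun x y => E x y ∧ y ∈ L.take (i + 1)) L[k] L[i] → ReflTransGen E L[i] L[k] := by
  intro m
  induction m using Nat.strong_induction_on with
  | _ m ih =>
    intro k hk hkm hpath
    rcases Nat.eq_zero_or_pos m with rfl | hm
    · obtain rfl : k = i := by omega
      exact .refl
    · have hmem : L[k] ∈ L.take (k + 1) := List.mem_take_iff_getElem.2 ⟨k, by omega, rfl⟩
      have hnot : L[i] ∉ L.take (k + 1) := by
        rw [List.mem_take_iff_getElem]
        rintro ⟨j, hj, h⟩
        have := (hnd.getElem_inj_iff).1 h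
        omega
      -- the path leaves the prefix that ends with `L[k]` somewhere
      have hexit : ∀ x, ReflTransGen (fun x y => E x y ∧ y ∈ L.take (i + 1)) x L[i] →
          x ∈ L.take (k + 1) → ∃ y w, y ∈ L.take (k + 1) ∧ w ∉ L.take (k + 1) ∧ E y w ∧
            w ∈ L.take (i + 1) ∧
            ReflTransGen (fun x y => E x y ∧ y ∈ L.take (i + 1)) w L[i] := by
        intro x hx
        induction hx using ReflTransGen.head_induction_on with
        | refl => intro h; exact absurd h hnot
        | @head a c hac hc ih =>
          intro ha
          by_cases hcm : c ∈ L.take (k + 1)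
          · exact ih hcm
          · exact ⟨a, c, ha, hcm, hac.1, hac.2, hc⟩
      obtain ⟨y, w, hy, hw, hE, hwi, hwp⟩ := hexit _ hpath hmem
      obtain ⟨k', hk', rfl⟩ := List.mem_take_iff_getElem.1 hwi
      have hkk : k < k' := by
        by_contra h
        exact hw (List.mem_take_iff_getElem.2 ⟨k', by omega, rfl⟩)
      have h1 := (hord k hk y hy _ hE).resolve_left hw
      exact (ih (i - k') (by omega) k' (by omega) (by omega) hwp).trans h1

namespace Prog

/-- The set of new nodes that the second pass of Kosaraju's algorithm finds is a strongly
connected component. -/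
theorem mem_component_iff {E : ℕ → ℕ → Prop} {al : ℕ → Prop} {L L₂ N : List ℕ} (hnd : L.Nodup)
    (hord : ∀ k (h : k < L.length), ∀ s ∈ L.take (k + 1), ∀ w, E s w →
      w ∈ L.take (k + 1) ∨ ReflTransGen E w L[k])
    (hal : ∀ s, al s → s ∈ L) {i : ℕ} (hi : i < L.length)
    (hL₂ : ∀ k (h : k < L.length), i < k → L[k] ∈ L₂) (hr : L[i] ∉ L₂)
    (hc₂ : ∀ s ∈ L₂, ∀ s', E s' s → s' ∈ L₂)
    (hc : ∀ s ∈ L₂ ++ N, ∀ s', E s' s → s' ∈ L₂ ++ N)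
    (hdis : ∀ s ∈ N, s ∉ L₂) (hN : ∀ s ∈ N, al s) (hrN : L[i] ∈ N) {par : ℕ → ℕ}
    (htree : ∀ s ∈ N, ∃ d, TreePath (fun s s' => E s' s) par (· ∈ N) L[i] s d) (s : ℕ) :
    s ∈ N ↔ ReflTransGen E L[i] s ∧ ReflTransGen E s L[i] := by
  have hpre : ∀ L' : List ℕ, (∀ s ∈ L', ∀ s', E s' s → s' ∈ L') → ∀ a b, ReflTransGen E a b →
      b ∈ L' → a ∈ L' := by
    intro L' h a b hab
    induction hab using ReflTransGen.head_induction_on with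
    | refl => exact id
    | head h1 _ ih => exact fun hb => h _ (ih hb) _ h1
  have hidx : ∀ s ∈ N, ∃ k, ∃ h : k < L.length, k ≤ i ∧ L[k] = s := by
    intro s hs
    obtain ⟨k, hk, rfl⟩ := List.mem_iff_getElem.1 (hal s (hN s hs))
    refine ⟨k, hk, ?_, rfl⟩
    by_contra h
    exact hdis _ hs (hL₂ k hk (by omega))
  constructor
  -- the path in the search tree stays among nodes that were left no later than `L[i]`
  · intro hs
    obtain ⟨d, hd⟩ := htree s hs
    have hpath : ∀ s d, TreePath (fun s s' => E s' s) par (· ∈ N) L[i] s d →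
        ReflTransGen (fun x y => E x y ∧ y ∈ L.take (i + 1)) s L[i] := by
      intro s d h
      induction h with
      | root => exact .refl
      | @step s d h1 h2 h3 h4 ih =>
        refine .head ⟨h3, ?_⟩ ih
        obtain ⟨k, hk, hki, h⟩ := hidx _ h4.mem
        rw [List.mem_take_iff_getElem]
        exact ⟨k, by omega, h⟩
    have hp := hpath s d hd
    obtain ⟨k, hk, hki, rfl⟩ := hidx s hs
    exact ⟨reachable_of_order hnd hord hi (i - k) k hk (by omega) hp,
      ReflTransGen.mono (fun _ _ h => h.1) _ _ hp⟩
  -- `L₂` is closed under predecessors and does not contain `L[i]`, hence misses the component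
  · rintro ⟨h1, h2⟩
    have := hpre _ hc s _ h2 (List.mem_append_right _ hrN)
    rcases List.mem_append.1 this with h | h
    · exact absurd (hpre _ hc₂ _ _ h1 h) hr
    · exact h

end Prog

/-! ### Inclusion of languages in terms of the product automaton -/

/-- Two acceptors with numbered letters, states and final state sets. The values of the transition
and membership tables outside of their ranges are irrelevant. -/
structure Inst where
  (A n1 n2 f1 f2 i1 i2 : ℕ)
  (d1 d2 m1 m2 : ℕ → ℕ → ℕ)
  i1_lt : i1 < n1
  i2_lt : i2 < n2
  d1_lt : ∀ q a, d1 q a < n1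
  d2_lt : ∀ q a, d2 q a < n2
  m1_le : ∀ f q, m1 f q ≤ 1
  m2_le : ∀ f q, m2 f q ≤ 1

namespace Inst

variable (I : Inst)

/-- The number of states of the product. -/
def V : ℕ := I.n1 * I.n2

/-- The code of a pair of states. -/
def pair (q q' : ℕ) : ℕ := q * I.n2 + q'

/-- The initial state of the product. -/
def ini : ℕ := I.pair I.i1 I.i2

/-- The transition function of the product. -/
def D (s a : ℕ) : ℕ := I.pair (I.d1 (s / I.n2) a) (I.d2 (s % I.n2) a)

/-- The edges of the product. -/
def Ed (s s' : ℕ) : Prop := s < I.V ∧ ∃ a < I.A, I.D s a = s'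

/-- The run of the product. -/
def run (w : ℕ → ℕ) : ℕ → ℕ
  | 0 => I.ini
  | k + 1 => I.D (run w k) (w k)

/-- The states of the product that occur infinitely often. -/
def inf (w : ℕ → ℕ) : Set ℕ := {s | ∃ᶠ i in Filter.atTop, I.run w i = s}

/-- The first components of the states in `S` form a final state set, namely number `f`. -/
def Final1 (f : ℕ) (S : Set ℕ) : Prop := ∀ q < I.n1, (I.m1 f q = 1 ↔ ∃ s ∈ S, s / I.n2 = q)

/-- The second components of the states in `S` form a final state set, namely number `f`. -/
def Final2 (f : ℕ) (S : Set ℕ) : Prop := ∀ q < I.n2, (I.m2 f q = 1 ↔ ∃ s ∈ S, s % I.n2 = q)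

/-- The word refutes the inclusion. -/
def Bad (w : ℕ → ℕ) : Prop :=
  (∀ i, w i < I.A) ∧ (∃ f < I.f1, I.Final1 f (I.inf w)) ∧ ∀ f < I.f2, ¬ I.Final2 f (I.inf w)

theorem n2_pos : 0 < I.n2 := by have := I.i2_lt; omega

theorem n1_pos : 0 < I.n1 := by have := I.i1_lt; omega

theorem V_pos : 0 < I.V := Nat.mul_pos I.n1_pos I.n2_pos

theorem pair_lt {q q' : ℕ} (h : q < I.n1) (h' : q' < I.n2) : I.pair q q' < I.V := by
  have : (q + 1) * I.n2 ≤ I.n1 * I.n2 := Nat.mul_le_mul_right _ h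
  rw [add_mul] at this
  unfold pair V; omega

theorem D_lt (s a : ℕ) : I.D s a < I.V := I.pair_lt (I.d1_lt _ _) (I.d2_lt _ _)

theorem ini_lt : I.ini < I.V := I.pair_lt I.i1_lt I.i2_lt

theorem pair_div (q : ℕ) {q' : ℕ} (h' : q' < I.n2) : I.pair q q' / I.n2 = q := by
  rw [pair, mul_comm, Nat.mul_add_div I.n2_pos, Nat.div_eq_of_lt h', add_zero]

theorem pair_mod (q : ℕ) {q' : ℕ} (h' : q' < I.n2) : I.pair q q' % I.n2 = q' := by
  rw [pair, mul_comm, Nat.mul_add_mod, Nat.mod_eq_of_lt h']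

theorem pair_div_mod (s : ℕ) : I.pair (s / I.n2) (s % I.n2) = s := by
  rw [pair, mul_comm, Nat.div_add_mod]

theorem div_lt {s : ℕ} (h : s < I.V) : s / I.n2 < I.n1 := by
  rw [Nat.div_lt_iff_lt_mul I.n2_pos]; exact h

theorem mod_lt (s : ℕ) : s % I.n2 < I.n2 := Nat.mod_lt _ I.n2_pos

theorem run_lt (w : ℕ → ℕ) : ∀ k, I.run w k < I.V
  | 0 => I.ini_lt
  | _ + 1 => I.D_lt _ _

theorem Ed.lt {s s' : ℕ} (h : I.Ed s s') : s < I.V ∧ s' < I.V := by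
  obtain ⟨h, a, _, rfl⟩ := h
  exact ⟨h, I.D_lt _ _⟩

/-- The run on `u v v v ...`, where `u` leads to `r` and `v` leads from `r` to `r`. -/
theorem run_ultPeriodic {u v : List ℕ} (hv : v ≠ []) {r : ℕ} (hu : u.foldl I.D I.ini = r)
    (hr : v.foldl I.D r = r) (k : ℕ) {j : ℕ} (hj : j ≤ v.length) :
    I.run (ultPeriodic u v hv) (u.length + v.length * k + j) = (v.take j).foldl I.D r := by
  have hpre : ∀ i ≤ u.length, I.run (ultPeriodic u v hv) i = (u.take i).foldl I.D I.ini := by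
    intro i
    induction i with
    | zero => intro _; rfl
    | succ i ih =>
      intro hi
      rw [List.take_succ_eq_append_getElem (by omega), List.foldl_append, ← ih (by omega)]
      simp [run, ultPeriodic, show i < u.length by omega]
  have hper : ∀ k, I.run (ultPeriodic u v hv) (u.length + v.length * k) = r →
      ∀ j ≤ v.length,
      I.run (ultPeriodic u v hv) (u.length + v.length * k + j) = (v.take j).foldl I.D r := by
    intro k hk j
    induction j with
    | zero => intro _; simpa using hk
    | succ j ih =>
      intro hj
      rw [List.take_succ_eq_append_getElem (by omega), List.foldl_append, ← ih (by omega)]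
      have hmod : (u.length + v.length * k + j - u.length) % v.length = j := by
        rw [show u.length + v.length * k + j - u.length = v.length * k + j by omega,
          Nat.mul_add_mod, Nat.mod_eq_of_lt (by omega)]
      rw [← add_assoc]
      simp only [run, ultPeriodic, show ¬ u.length + v.length * k + j < u.length by omega,
        dite_false, hmod, List.foldl_cons, List.foldl_nil]
  refine hper k ?_ j hj
  induction k with
  | zero => rw [mul_zero, add_zero, hpre _ le_rfl, List.take_length, hu]
  | succ k ih =>
    have := hper k ih v.length le_rfl
    rwa [List.take_length, hr, add_assoc, ← Nat.mul_succ] at this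

/-- If the states on the cycle are exactly those in `S`, then these occur infinitely often. -/
theorem bad_ultPeriodic {u v : List ℕ} (hv : v ≠ []) {r : ℕ} (hu : u.foldl I.D I.ini = r)
    (hr : v.foldl I.D r = r) (hA : ∀ a ∈ u ++ v, a < I.A) {S : Set ℕ}
    (hS : ∀ s, s ∈ S ↔ ∃ j ≤ v.length, (v.take j).foldl I.D r = s)
    (h1 : ∃ f < I.f1, I.Final1 f S) (h2 : ∀ f < I.f2, ¬ I.Final2 f S) :
    I.Bad (ultPeriodic u v hv) := by
  have hpos := List.length_pos_of_ne_nil hv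
  have hinf : I.inf (ultPeriodic u v hv) = S := by
    ext s
    rw [hS]
    simp only [inf, Set.mem_ofPred_eq, Filter.frequently_atTop]
    constructor
    · intro h
      obtain ⟨i, hi, rfl⟩ := h u.length
      refine ⟨(i - u.length) % v.length, (Nat.mod_lt _ hpos).le, ?_⟩
      rw [← I.run_ultPeriodic hv hu hr ((i - u.length) / v.length) (Nat.mod_lt _ hpos).le]
      rw [add_assoc, Nat.div_add_mod, Nat.add_sub_cancel' hi]
    · rintro ⟨j, hj, rfl⟩ n
      refine ⟨u.length + v.length * n + j, ?_, I.run_ultPeriodic hv hu hr n hj⟩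
      have : n ≤ v.length * n := Nat.le_mul_of_pos_left _ hpos
      omega
  refine ⟨fun i => ?_, by rwa [hinf], by rwa [hinf]⟩
  unfold ultPeriodic
  split
  · exact hA _ (List.mem_append_left _ (List.getElem_mem _))
  · exact hA _ (List.mem_append_right _ (List.getElem_mem _))

/-- The restriction of the product to the nodes that satisfy `al`. -/
def Sub (al : ℕ → Prop) (s s' : ℕ) : Prop := I.Ed s s' ∧ al s ∧ al s'

/-- The states that are reachable from the initial state. -/
def Reach (s : ℕ) : Prop := ReflTransGen I.Ed I.ini s

/-- The reachable states of the product with first component in the final state set number `f`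
and second component in `alw`. -/
def Alive (f : ℕ) (alw : ℕ → Prop) (s : ℕ) : Prop :=
  s < I.V ∧ I.Reach s ∧ I.m1 f (s / I.n2) ≠ 0 ∧ alw (s % I.n2)

/-- The strongly connected component of `r` in the restricted product. -/
def comp (al : ℕ → Prop) (r : ℕ) : Set ℕ :=
  {s | ReflTransGen (I.Sub al) r s ∧ ReflTransGen (I.Sub al) s r}

/-- The component of `r` does not refute the inclusion. A component without an inner edge is a
single state that no run can stay in. -/
def Harmless (f : ℕ) (al : ℕ → Prop) (r : ℕ) : Prop :=
  (∃ s ∈ I.comp al r, I.Ed r s) → I.Final1 f (I.comp al r) → ∃ g < I.f2, I.Final2 g (I.comp al r)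

theorem reach_run {w : ℕ → ℕ} (hw : ∀ i, w i < I.A) : ∀ k, I.Reach (I.run w k)
  | 0 => .refl
  | k + 1 => (reach_run hw k).tail ⟨I.run_lt w k, _, hw k, rfl⟩

/-- From some time on, the run only visits states that occur infinitely often. -/
theorem exists_forall_mem_inf (w : ℕ → ℕ) : ∃ k₀, ∀ i ≥ k₀, I.run w i ∈ I.inf w := by
  have h : ∀ s ∈ Finset.range I.V, ∀ᶠ i in Filter.atTop, I.run w i = s → s ∈ I.inf w := by
    intro s _
    by_cases hs : s ∈ I.inf w
    · exact Filter.Eventually.of_forall fun _ _ => hs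
    · have := Filter.not_frequently.1 hs
      exact this.mono fun i hi h => absurd h hi
  have := (Filter.eventually_all_finset _).2 h
  obtain ⟨k₀, hk⟩ := Filter.eventually_atTop.1 this
  exact ⟨k₀, fun i hi => hk i hi _ (Finset.mem_range.2 (I.run_lt w i)) rfl⟩

/-- The states that occur infinitely often are strongly connected. -/
theorem transGen_of_mem_inf {w : ℕ → ℕ} (hw : ∀ i, w i < I.A) {al : ℕ → Prop}
    (hal : ∀ s ∈ I.inf w, al s) {s s' : ℕ} (hs : s ∈ I.inf w) (hs' : s' ∈ I.inf w) :
    TransGen (I.Sub al) s s' := by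
  obtain ⟨k₀, hk₀⟩ := I.exists_forall_mem_inf w
  obtain ⟨i, hi, rfl⟩ := Filter.frequently_atTop.1 hs k₀
  obtain ⟨j, hj, rfl⟩ := Filter.frequently_atTop.1 hs' (i + 1)
  have : ∀ m, TransGen (I.Sub al) (I.run w i) (I.run w (i + 1 + m)) := by
    intro m
    induction m with
    | zero =>
      exact .single ⟨⟨I.run_lt w i, _, hw i, rfl⟩, hal _ (hk₀ _ hi), hal _ (hk₀ (i + 1) (by omega))⟩
    | succ m ih =>
      exact ih.tail ⟨⟨I.run_lt w _, _, hw _, rfl⟩, hal _ (hk₀ _ (by omega)),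
        hal _ (hk₀ (i + 1 + m + 1) (by omega))⟩
  simpa [Nat.add_sub_cancel' hj] using this (j - (i + 1))

theorem mem_inf_lt {w : ℕ → ℕ} {s : ℕ} (hs : s ∈ I.inf w) : s < I.V := by
  obtain ⟨i, _, rfl⟩ := Filter.frequently_atTop.1 hs 0
  exact I.run_lt w i

/-- If there is a bad word, then some component refutes the inclusion. The second components of
the states that occur infinitely often lie in a final state set of minimal size among all that
contain them; without one of its further elements, the component cannot be harmless. -/
theorem not_bad_of_harmless
    (h0 : ∀ f < I.f1, ∀ r, I.Alive f (fun _ => True) r → I.Harmless f (I.Alive f fun _ => True) r)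
    (h1 : ∀ f < I.f1, ∀ g < I.f2, ∀ q < I.n2, ∀ r, I.Alive f (fun p => I.m2 g p ≠ 0 ∧ p ≠ q) r →
      I.Harmless f (I.Alive f fun p => I.m2 g p ≠ 0 ∧ p ≠ q) r) (w : ℕ → ℕ) : ¬ I.Bad w := by
  rintro ⟨hw, ⟨f, hf, hF1⟩, hF2⟩
  obtain ⟨k₀, hk₀⟩ := I.exists_forall_mem_inf w
  have hr := hk₀ k₀ le_rfl
  set r := I.run w k₀ with hrdef
  -- the component around the infinite run has the first components of `I.inf w`, and since it is
  -- harmless, its second components form a final state set that lies between those of `I.inf w`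
  -- and `alw`
  have key : ∀ alw : ℕ → Prop, (∀ s ∈ I.inf w, alw (s % I.n2)) →
      (∀ r, I.Alive f alw r → I.Harmless f (I.Alive f alw) r) →
      ∃ g < I.f2, (∀ s ∈ I.inf w, I.m2 g (s % I.n2) = 1) ∧
        ∀ q < I.n2, I.m2 g q = 1 → alw q := by
    intro alw halw hH
    have hal : ∀ s ∈ I.inf w, I.Alive f alw s := by
      intro s hs
      have hlt := I.mem_inf_lt hs
      refine ⟨hlt, ?_, ?_, halw s hs⟩
      · obtain ⟨i, _, rfl⟩ := Filter.frequently_atTop.1 hs 0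
        exact I.reach_run hw i
      · have := (hF1 _ (I.div_lt hlt)).2 ⟨s, hs, rfl⟩
        omega
    have hsub : I.inf w ⊆ I.comp (I.Alive f alw) r := fun s hs =>
      ⟨(I.transGen_of_mem_inf hw hal hr hs).to_reflTransGen,
        (I.transGen_of_mem_inf hw hal hs hr).to_reflTransGen⟩
    have hcal : ∀ s ∈ I.comp (I.Alive f alw) r, I.Alive f alw s := by
      rintro s ⟨h, -⟩
      rcases ReflTransGen.cases_tail h with rfl | ⟨_, _, h⟩
      · exact hal _ hr
      · exact h.2.2
    have hne : ∃ s ∈ I.comp (I.Alive f alw) r, I.Ed r s := by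
      have h := I.transGen_of_mem_inf hw hal hr hr
      obtain ⟨s, hs, hsr⟩ := TransGen.head'_iff.1 h
      exact ⟨s, ⟨.single hs, hsr⟩, hs.1⟩
    have hfin : I.Final1 f (I.comp (I.Alive f alw) r) := by
      intro q hq
      constructor
      · intro h
        obtain ⟨s, hs, h'⟩ := (hF1 q hq).1 h
        exact ⟨s, hsub hs, h'⟩
      · rintro ⟨s, hs, rfl⟩
        have := (hcal s hs).2.2.1
        have := I.m1_le f (s / I.n2)
        omega
    obtain ⟨g, hg, hG⟩ := hH r (hal r hr) hne hfin
    refine ⟨g, hg, fun s hs => (hG _ (I.mod_lt s)).2 ⟨s, hsub hs, rfl⟩, fun q hq hm => ?_⟩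
    obtain ⟨s, hs, rfl⟩ := (hG q hq).1 hm
    exact (hcal s hs).2.2.2
  -- the number of states in the final state set number `g`
  let size : ℕ → ℕ := fun g => ((Finset.range I.n2).filter fun q => I.m2 g q = 1).card
  suffices H : ∀ m g, size g ≤ m → g < I.f2 → (∀ s ∈ I.inf w, I.m2 g (s % I.n2) = 1) → False by
    obtain ⟨g, hg, h, -⟩ := key (fun _ => True) (fun _ _ => trivial) (h0 f hf)
    exact H _ g le_rfl hg h
  intro m
  induction m with
  | zero =>
    intro g hm hg h
    have : r % I.n2 ∈ (Finset.range I.n2).filter fun q => I.m2 g q = 1 := by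
      simp [I.mod_lt, h r hr]
    have := Finset.card_pos.2 ⟨_, this⟩
    simp only [size] at hm
    omega
  | succ m ih =>
    intro g hm hg h
    have hnot := hF2 g hg
    have : ∃ q < I.n2, I.m2 g q = 1 ∧ ∀ s ∈ I.inf w, s % I.n2 ≠ q := by
      by_contra hcon
      push Not at hcon
      refine hnot fun q hq => ⟨hcon q hq, ?_⟩
      rintro ⟨s, hs, rfl⟩
      exact h s hs
    -- the set number `g` contains a superfluous state `q`; removing it yields a smaller set `g'`
    obtain ⟨q, hq, hmq, hqs⟩ := this
    obtain ⟨g', hg', h', hsub⟩ := key (fun p => I.m2 g p ≠ 0 ∧ p ≠ q)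
      (fun s hs => ⟨by rw [h s hs]; exact one_ne_zero, hqs s hs⟩) (h1 f hf g hg q hq)
    refine ih g' ?_ hg' h'
    have hlt : size g' < size g := by
      refine Finset.card_lt_card ((Finset.ssubset_iff_of_subset ?_).2 ⟨q, ?_, ?_⟩)
      · intro p hp
        simp only [Finset.mem_filter, Finset.mem_range] at hp ⊢
        have := I.m2_le g p
        exact ⟨hp.1, by have := (hsub p hp.1 hp.2).1; omega⟩
      · simp [hq, hmq]
      · simp only [Finset.mem_filter, Finset.mem_range, not_and]
        intro _ hm
        exact (hsub q hq hm).2 rfl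
    omega

end Inst

/-! ### The product automaton -/

namespace Prog

open WExpr WProg Relation

variable {inp : List ℕ} {I : Inst} {x y : St} {P : Pr}

/-- The two acceptors stand in the arrays. -/
structure Loaded (I : Inst) (x : St) : Prop where
  A : x.var .A = I.A
  n1 : x.var .n1 = I.n1
  n2 : x.var .n2 = I.n2
  f1 : x.var .f1 = I.f1
  f2 : x.var .f2 = I.f2
  i1 : x.var .i1 = I.i1
  i2 : x.var .i2 = I.i2
  step1 : ∀ q < I.n1, ∀ a < I.A, x.arr .step1 q a = I.d1 q a
  step2 : ∀ q < I.n2, ∀ a < I.A, x.arr .step2 q a = I.d2 q a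
  memb1 : ∀ f < I.f1, ∀ q < I.n1, x.arr .memb1 f q = I.m1 f q
  memb2 : ∀ f < I.f2, ∀ q < I.n2, x.arr .memb2 f q = I.m2 f q

/-- The variables on which `Loaded` depends. -/
def loadedVars : List Var := [.A, .n1, .n2, .f1, .f2, .i1, .i2]

/-- The arrays on which `Loaded` depends. -/
def loadedArrs : List Arr := [.step1, .step2, .memb1, .memb2]

theorem Loaded.frame (h : Loaded I x) (hF : Frame P x y) (hv : ∀ v ∈ loadedVars, v ∉ P.vars)
    (ha : ∀ a ∈ loadedArrs, a ∉ P.arrs) : Loaded I y := by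
  obtain ⟨h1, h2, h3, h4, h5, h6, h7, h8, h9, h10, h11⟩ := h
  constructor
  · rwa [hF.var (hv _ (by decide))]
  · rwa [hF.var (hv _ (by decide))]
  · rwa [hF.var (hv _ (by decide))]
  · rwa [hF.var (hv _ (by decide))]
  · rwa [hF.var (hv _ (by decide))]
  · rwa [hF.var (hv _ (by decide))]
  · rwa [hF.var (hv _ (by decide))]
  · rwa [hF.arr (ha _ (by decide))]
  · rwa [hF.arr (ha _ (by decide))]
  · rwa [hF.arr (ha _ (by decide))]
  · rwa [hF.arr (ha _ (by decide))]

/-- The first `m` pairs of states are numbered. -/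
structure Numbered (I : Inst) (m : ℕ) (x : St) : Prop where
  V : x.var .V = m
  fst : ∀ s < m, x.arr .fst s 0 = s / I.n2
  snd : ∀ s < m, x.arr .snd s 0 = s % I.n2
  code : ∀ s < m, x.arr .code (s / I.n2) (s % I.n2) = s

theorem Numbered.frame {m : ℕ} (h : Numbered I m x) (hF : Frame P x y) (hv : .V ∉ P.vars)
    (ha : ∀ a ∈ [Arr.fst, .snd, .code], a ∉ P.arrs) : Numbered I m y := by
  obtain ⟨h1, h2, h3, h4⟩ := h
  constructor
  · rwa [hF.var hv]
  · rwa [hF.arr (ha _ (by decide))]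
  · rwa [hF.arr (ha _ (by decide))]
  · rwa [hF.arr (ha _ (by decide))]

theorem runs_numbering (h : Loaded I x) :
    Runs inp numbering x (13 * I.V) (Numbered I I.V) := by
  have hn1 := I.n1_pos
  have hn2 := I.n2_pos
  unfold numbering
  refine Runs.seq (Q := Numbered I 0) (T₁ := 1) (T₂ := I.n1 * (I.n2 * 6 + 4) + 2) ?_ ?_ ?_
  · simp only [Runs, wp_assign]
    exact ⟨le_rfl, by simp [eval], by simp, by simp, by simp⟩
  · intro y hF hy
    have hL := h.frame hF (by decide) (by decide)
    refine runs_upTo (N := I.n1) (b := I.n2 * 6 + 2) (by decide) (by decide) (by decide) hL.n1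
      (fun k z => Numbered I (k * I.n2) z) ?_ ?_ ?_ le_rfl
    · obtain ⟨h1, h2, h3, h4⟩ := hy
      exact ⟨by simpa using h1, by simp, by simp, by simp⟩
    · intro k z hk hzk hFz hz
      have hL := hL.frame hFz (by decide) (by decide)
      refine runs_upTo (N := I.n2) (b := 4) (by decide) (by decide) (by decide) hL.n2
        (fun j u => Numbered I (k * I.n2 + j) u) ?_ ?_ ?_ (by omega)
      · obtain ⟨h1, h2, h3, h4⟩ := hz
        exact ⟨by simpa using h1, by simpa using h2, by simpa using h3, by simpa using h4⟩
      · intro j u hj huj hFu hu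
        have huk : u.var .q1 = k := (hFu.var (by decide)).trans hzk
        have e1 : (k * I.n2 + j) / I.n2 = k := I.pair_div k hj
        have e2 : (k * I.n2 + j) % I.n2 = j := I.pair_mod k hj
        obtain ⟨h1, h2, h3, h4⟩ := hu
        simp only [Runs, wp_seq, wp_store, wp_assign, eval, WState.put_var, h1, huk, huj]
        refine ⟨le_rfl, ?_, ?_, ?_, ?_⟩
        · simp; ring
        · intro s hs
          by_cases hsm : s = k * I.n2 + j
          · simp [hsm, e1]
          · simpa [hsm] using h2 s (by omega)
        · intro s hs
          by_cases hsm : s = k * I.n2 + j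
          · simp [hsm, e2]
          · simpa [hsm] using h3 s (by omega)
        · intro s hs
          by_cases hsm : s = k * I.n2 + j
          · simp [hsm, e1, e2]
          · have : ¬ (s / I.n2 = k ∧ s % I.n2 = j) := by
              rintro ⟨rfl, rfl⟩
              exact hsm (I.pair_div_mod s).symm
            simpa [this] using h4 s (by omega)
      · intro u _ _ hu
        obtain ⟨h1, h2, h3, h4⟩ := hu
        have e : (k + 1) * I.n2 = k * I.n2 + I.n2 := by ring
        exact ⟨by simpa [e] using h1, by simpa [e] using h2, by simpa [e] using h3,
          by simpa [e] using h4⟩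
    · intro z _ _ hz
      exact hz
  · have : I.n1 * (I.n2 * 6 + 4) = 6 * I.V + 4 * I.n1 := by unfold Inst.V; ring
    have : I.n1 ≤ I.V := Nat.le_mul_of_pos_right _ hn2
    omega

/-- The adjacency matrix of the product. -/
def MatrixRep (I : Inst) (x : St) : Prop :=
  ∀ s < I.V, ∀ s' < I.V, (x.arr .mat s s' = 0 → ¬ I.Ed s s') ∧
    (x.arr .mat s s' ≠ 0 → x.arr .mat s s' - 1 < I.A ∧ I.D s (x.arr .mat s s' - 1) = s')

theorem MatrixRep.ne_zero_iff (h : MatrixRep I x) {s s' : ℕ} (hs : s < I.V) (hs' : s' < I.V) :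
    x.arr .mat s s' ≠ 0 ↔ I.Ed s s' := by
  constructor
  · intro hne
    exact ⟨hs, _, ((h s hs s' hs').2 hne).1, ((h s hs s' hs').2 hne).2⟩
  · intro hE h0
    exact (h s hs s' hs').1 h0 hE

theorem runs_matrix (h : Loaded I x) (hN : Numbered I I.V x) :
    Runs inp matrix x (15 * (I.V * I.V) + 3 * (I.A * I.V)) (MatrixRep I) := by
  have hV := I.V_pos
  unfold matrix
  refine Runs.seq (Q := fun y => ∀ s < I.V, ∀ s' < I.V, y.arr .mat s s' = 0)
    (T₁ := I.V * (I.V * 3 + 4) + 2) (T₂ := I.V * (I.A * 3 + 4) + 2) ?_ ?_ ?_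
  · refine runs_upTo (N := I.V) (b := I.V * 3 + 2) (by decide) (by decide) (by decide) hN.V
      (fun k z => ∀ s < k, ∀ s' < I.V, z.arr .mat s s' = 0) (by simp) ?_ ?_ le_rfl
    · intro k z hk hzk hFz hz
      have hN := hN.frame hFz (by decide) (by decide)
      refine runs_upTo (N := I.V) (b := 1) (by decide) (by decide) (by decide) hN.V
        (fun j u => (∀ s < k, ∀ s' < I.V, u.arr .mat s s' = 0) ∧ ∀ s' < j, u.arr .mat k s' = 0)
        ⟨by simpa using hz, by simp⟩ ?_ ?_ (by omega)
      · intro j u hj huj hFu hu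
        have huk : u.var .s = k := (hFu.var (by decide)).trans hzk
        simp only [Runs, wp_store, eval, huk, huj]
        refine ⟨le_rfl, fun s hs s' hs' => ?_, fun s' hs' => ?_⟩
        · simp only [WState.set_arr, WState.put_arr_self]
          split
          · rfl
          · exact hu.1 s hs s' hs'
        · simp only [WState.set_arr, WState.put_arr_self]
          split_ifs with h
          · rfl
          · exact hu.2 s' (by simp only [true_and] at h; omega)
      · intro u _ _ hu s hs s' hs'
        simp only [WState.set_arr]
        rcases Nat.lt_succ_iff_lt_or_eq.1 hs with hs | rfl
        · exact hu.1 s hs s' hs'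
        · exact hu.2 s' hs'
    · intro z _ _ hz
      exact hz
  · intro y hF hy
    have hL := h.frame hF (by decide) (by decide)
    have hN := hN.frame hF (by decide) (by decide)
    refine runs_upTo (N := I.V) (b := I.A * 3 + 2) (by decide) (by decide) (by decide) hN.V
      (fun k z => ∀ s < I.V, ∀ s' < I.V,
        (z.arr .mat s s' = 0 → s < k → ∀ a < I.A, I.D s a ≠ s') ∧
        (z.arr .mat s s' ≠ 0 → z.arr .mat s s' - 1 < I.A ∧ I.D s (z.arr .mat s s' - 1) = s'))
      ?_ ?_ ?_ le_rfl
    · intro s hs s' hs'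
      simp [hy s hs s' hs']
    · intro k z hk hzk hFz hz
      have hL := hL.frame hFz (by decide) (by decide)
      have hN := hN.frame hFz (by decide) (by decide)
      refine runs_upTo (N := I.A) (b := 1) (by decide) (by decide) (by decide) hL.A
        (fun j u => ∀ s < I.V, ∀ s' < I.V,
          (u.arr .mat s s' = 0 → s ≤ k → ∀ a < I.A, s < k ∨ a < j → I.D s a ≠ s') ∧
          (u.arr .mat s s' ≠ 0 → u.arr .mat s s' - 1 < I.A ∧
            I.D s (u.arr .mat s s' - 1) = s')) ?_ ?_ ?_ (by omega)
      · intro s hs s' hs'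
        refine ⟨fun h0 _ a ha hlt => (hz s hs s' hs').1 h0 (by omega) a ha, (hz s hs s' hs').2⟩
      · intro j u hj huj hFu hu
        have hL := hL.frame hFu (by decide) (by decide)
        have hN := hN.frame hFu (by decide) (by decide)
        have huk : u.var .s = k := (hFu.var (by decide)).trans hzk
        have hcode : u.arr .code (I.d1 (k / I.n2) j) (I.d2 (k % I.n2) j) = I.D k j := by
          have := hN.code (I.D k j) (I.D_lt k j)
          rwa [Inst.D, I.pair_div _ (I.d2_lt _ _), I.pair_mod _ (I.d2_lt _ _)] at this
        simp only [Runs, wp_store, eval, huk, huj, hN.fst k hk, hN.snd k hk,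
          hL.step1 _ (I.div_lt hk) j hj, hL.step2 _ (I.mod_lt k) j hj, hcode]
        refine ⟨le_rfl, fun s hs s' hs' => ?_⟩
        simp only [WState.set_arr, WState.put_arr_self]
        by_cases hc : s = k ∧ s' = I.D k j
        · obtain ⟨rfl, rfl⟩ := hc
          simp [hj]
        · simp only [hc, if_false]
          refine ⟨fun h0 hsk a ha hor => ?_, (hu s hs s' hs').2⟩
          by_cases hor' : s < k ∨ a < j
          · exact (hu s hs s' hs').1 h0 hsk a ha hor'
          · have : s = k := by omega
            have : a = j := by omega
            subst s a
            exact fun h => hc ⟨rfl, h.symm⟩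
      · intro u _ _ hu s hs s' hs'
        refine ⟨fun h0 hsk a ha => (hu s hs s' hs').1 h0 (by omega) a ha (.inr ha),
          (hu s hs s' hs').2⟩
    · rintro z _ _ hz s hs s' hs'
      refine ⟨fun h0 => ?_, (hz s hs s' hs').2⟩
      rintro ⟨-, a, ha, hD⟩
      exact (hz s hs s' hs').1 h0 hs a ha hD
  · have e1 : I.V * (I.V * 3 + 4) = 3 * (I.V * I.V) + 4 * I.V := by ring
    have e2 : I.V * (I.A * 3 + 4) = 3 * (I.A * I.V) + 4 * I.V := by ring
    have e3 : I.V ≤ I.V * I.V := Nat.le_mul_of_pos_left _ hV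
    omega

/-! ### The trie of the final state sets -/

/-- The node of the trie that is reached from its root by the first `k` bits. -/
def walk (c : ℕ → ℕ → ℕ) (bits : ℕ → ℕ) : ℕ → ℕ
  | 0 => 1
  | k + 1 => c (walk c bits k) (bits k)

/-- A trie with nodes `1`, ..., `T`, in which every node represents a list of bits that
satisfies `S`. -/
structure TrieInv (S : List ℕ → Prop) (c : ℕ → ℕ → ℕ) (T : ℕ) (lab : ℕ → List ℕ) : Prop where
  sink : ∀ b ≤ 1, c 0 b = 0
  pos : 1 ≤ T
  root : lab 1 = []
  le : ∀ v b, 1 ≤ v → v ≤ T → b ≤ 1 → c v b ≤ T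
  lab_child : ∀ v b, 1 ≤ v → v ≤ T → b ≤ 1 → c v b ≠ 0 → lab (c v b) = lab v ++ [b]
  sound : ∀ v, 1 ≤ v → v ≤ T → S (lab v)

/-- A walk that does not end in the sink ends in the node for the bits read, and it survives all
extensions of the trie. -/
theorem TrieInv.walk_spec {S : List ℕ → Prop} {c : ℕ → ℕ → ℕ} {T : ℕ} {lab : ℕ → List ℕ}
    (h : TrieInv S c T lab) {bits : ℕ → ℕ} {n : ℕ} (hb : ∀ i < n, bits i ≤ 1) : ∀ k ≤ n,
    walk c bits k ≠ 0 → walk c bits k ≤ T ∧ lab (walk c bits k) = (List.range k).map bits ∧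
      ∀ c' : ℕ → ℕ → ℕ, (∀ v b, 1 ≤ v → v ≤ T → b ≤ 1 → c v b ≠ 0 → c' v b = c v b) →
        walk c' bits k = walk c bits k := by
  intro k
  induction k with
  | zero => intro _ _; exact ⟨h.pos, by simpa [walk] using h.root, fun _ _ => rfl⟩
  | succ k ih =>
    intro hk hne
    have hbk := hb k (by omega)
    have hne' : walk c bits k ≠ 0 := by
      intro h0
      rw [walk, h0, h.sink _ hbk] at hne
      exact hne rfl
    obtain ⟨h1, h2, h3⟩ := ih (by omega) hne'
    rw [walk] at hne ⊢
    refine ⟨h.le _ _ (by omega) h1 hbk, ?_, fun c' hc' => ?_⟩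
    · rw [h.lab_child _ _ (by omega) h1 hbk hne, h2, List.range_succ, List.map_append]
      rfl
    · rw [walk, h3 c' hc', hc' _ _ (by omega) h1 hbk hne]

/-- The node `T + 1` is added as child number `b` of the node `v`. -/
theorem TrieInv.insert {S : List ℕ → Prop} {c c' : ℕ → ℕ → ℕ} {T : ℕ} {lab : ℕ → List ℕ}
    (h : TrieInv S c T lab) {v b : ℕ} (hv : 1 ≤ v)
    (hS : S (lab v ++ [b])) (hc1 : c' v b = T + 1) (hc2 : ∀ b' ≤ 1, c' (T + 1) b' = 0)
    (hc3 : ∀ w b', w ≤ T → ¬ (w = v ∧ b' = b) → c' w b' = c w b') :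
    TrieInv S c' (T + 1) (Function.update lab (T + 1) (lab v ++ [b])) := by
  have hup : ∀ w, w ≤ T → Function.update lab (T + 1) (lab v ++ [b]) w = lab w := fun w hw =>
    Function.update_of_ne (by omega) _ _
  constructor
  · intro b' hb'
    rw [hc3 0 b' (by omega) (by omega), h.sink _ hb']
  · omega
  · rw [hup 1 h.pos, h.root]
  · intro w b' h1 h2 h3
    rcases Nat.le_or_eq_of_le_succ h2 with h2 | rfl
    · by_cases he : w = v ∧ b' = b
      · rw [he.1, he.2, hc1]
      · rw [hc3 w b' h2 he]
        exact (h.le w b' h1 h2 h3).trans (by omega)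
    · rw [hc2 _ h3]; omega
  · intro w b' h1 h2 h3 h4
    rcases Nat.le_or_eq_of_le_succ h2 with h2 | rfl
    · rw [hup w h2]
      by_cases he : w = v ∧ b' = b
      · rw [he.1, he.2, hc1, Function.update_self]
      · rw [hc3 w b' h2 he] at h4 ⊢
        rw [hup _ (h.le w b' h1 h2 h3), h.lab_child w b' h1 h2 h3 h4]
    · exact absurd (hc2 _ h3) h4
  · intro w h1 h2
    rcases Nat.le_or_eq_of_le_succ h2 with h2 | rfl
    · rw [hup w h2]; exact h.sound w h1 h2
    · rwa [Function.update_self]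

/-- The trie represents the second family of final state sets. -/
def TrieRep (I : Inst) (x : St) : Prop :=
  ∀ bits : ℕ → ℕ, (∀ q < I.n2, bits q ≤ 1) →
    (walk (x.arr .child) bits I.n2 ≠ 0 ↔ ∃ g < I.f2, ∀ q < I.n2, I.m2 g q = bits q)

/-- The list is empty or consists of the first bits of some final state set. -/
def IsPrefix (I : Inst) (l : List ℕ) : Prop :=
  l = [] ∨ ∃ g < I.f2, ∃ j ≤ I.n2, l = (List.range j).map (I.m2 g)

/-- The invariants of the insertion of the set number `f`: the node `node` represents its first `q`
bits, and all earlier sets are in the trie. -/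
theorem runs_trieStep {lab : ℕ → List ℕ} {f q : ℕ} (hL : Loaded I x) (hf : f < I.f2)
    (hq : q < I.n2) (hxf : x.var .f = f) (hxq : x.var .q = q)
    (hT : TrieInv (IsPrefix I) (x.arr .child) (x.var .tcnt) lab)
    (hn : x.var .node = walk (x.arr .child) (I.m2 f) q) (hn0 : x.var .node ≠ 0)
    (hc : ∀ g < f, walk (x.arr .child) (I.m2 g) I.n2 ≠ 0) :
    Runs inp trieStep x 7 fun y =>
      (∃ lab, TrieInv (IsPrefix I) (y.arr .child) (y.var .tcnt) lab) ∧
      y.var .node = walk (y.arr .child) (I.m2 f) (q + 1) ∧ y.var .node ≠ 0 ∧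
      ∀ g < f, walk (y.arr .child) (I.m2 g) I.n2 ≠ 0 := by
  have hbits : ∀ g, ∀ i < I.n2, I.m2 g i ≤ 1 := fun g i _ => I.m2_le g i
  have hws := hT.walk_spec (hbits f) q (by omega) (hn ▸ hn0)
  rw [← hn] at hws
  simp only [trieStep, newNode, Runs, wp_seq, wp_assign, wp_ite, wp_store, wp_skip, eval, hxf, hxq,
    hL.memb2 f hf q hq, WState.set_var, WState.set_arr, WState.put_var, reduceCtorEq, if_false,
    if_true]
  refine ⟨fun hne => ⟨by omega, ⟨lab, by simpa using hT⟩, ?_, by simpa using hne,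
    by simpa using hc⟩, fun h0 => ?_⟩
  · simp only [walk, ← hn]
  · set b := I.m2 f q with hb
    have hb1 : b ≤ 1 := I.m2_le f q
    set n := x.var .node with hnode
    set T := x.var .tcnt with hTdef
    set c := x.arr .child with hcdef
    simp only [WState.put_arr_self, WState.set_arr, ← hcdef]
    -- the updated child function
    set c' : ℕ → ℕ → ℕ := fun v b' => if v = T + 1 ∧ b' = 1 then 0 else
      if v = T + 1 ∧ b' = 0 then 0 else if v = n ∧ b' = b then T + 1 else c v b' with hc'
    have hchild : ∀ z : St, (∀ v b', z.arr .child v b' = c' v b') → z.arr .child = c' :=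
      fun z hz => by funext v b'; exact hz v b'
    have hne : n ≠ T + 1 := by omega
    have hTi := hT.insert (c' := c') (v := n) (b := b) (by omega)
      (.inr ⟨f, hf, q + 1, by omega, by rw [hws.2.1, List.range_succ, List.map_append]; rfl⟩)
      (by simp [hc', hne])
      (by
        intro b' hb'
        have : b' = 0 ∨ b' = 1 := by omega
        rcases this with rfl | rfl <;> simp [hc'])
      (by
        intro w b' hw hnot
        have h1 : w ≠ T + 1 := by omega
        simp [hc', h1, hnot])
    have hold : ∀ v b', 1 ≤ v → v ≤ T → b' ≤ 1 → c v b' ≠ 0 → c' v b' = c v b' := by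
      intro v b' h1 h2 h3 h4
      have h5 : v ≠ T + 1 := by omega
      have h6 : ¬ (v = n ∧ b' = b) := by rintro ⟨rfl, rfl⟩; exact h4 h0
      simp [hc', h5, h6]
    have hval : (if n = T + 1 ∧ b = 1 then 0 else if n = T + 1 ∧ b = 0 then 0 else
        if True ∧ True then T + 1 else c n b) = T + 1 := by simp [hne]
    rw [hval, hchild _ (fun v b' => by simp [hc', hcdef])]
    refine ⟨by omega, ⟨_, hTi⟩, ?_, by omega, fun g hg => ?_⟩
    · rw [walk, hws.2.2 c' hold]; simp [hc', hne, hb]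
    · rw [(hT.walk_spec (hbits g) I.n2 le_rfl (hc g hg)).2.2 c' hold]; exact hc g hg

theorem runs_trie (hL : Loaded I x) :
    Runs inp trie x (I.f2 * (I.n2 * 9 + 5) + 8) (TrieRep I) := by
  unfold trie
  refine Runs.seq (T₁ := 1) (T₂ := I.f2 * (I.n2 * 9 + 5) + 7) (Q := fun y => y.var .tcnt = 0) ?_ ?_
    (by omega)
  · simp [Runs, wp_assign, eval]
  intro y hF hy
  replace hL := hL.frame hF (by decide) (by decide)
  refine Runs.seq (T₁ := 2) (T₂ := I.f2 * (I.n2 * 9 + 5) + 5)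
    (Q := fun y => y.var .tcnt = 0 ∧ ∀ b ≤ 1, y.arr .child 0 b = 0) ?_ ?_ (by omega)
  · simp only [newNode, Runs, wp_seq, wp_store, eval, WState.put_var, hy]
    refine ⟨by omega, trivial, fun b hb => ?_⟩
    have : b = 0 ∨ b = 1 := by omega
    rcases this with rfl | rfl <;> simp
  rintro y' hF' ⟨hy', hy0⟩
  replace hL := hL.frame hF' (by decide) (by decide)
  refine Runs.seq (T₁ := 1) (T₂ := I.f2 * (I.n2 * 9 + 5) + 4)
    (Q := fun y => y.var .tcnt = 1 ∧ ∀ b ≤ 1, y.arr .child 0 b = 0) ?_ ?_ (by omega)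
  · simp [Runs, wp_assign, eval, hy']; exact fun b hb => hy0 b hb
  rintro u hFu ⟨hu, hu0⟩
  replace hL := hL.frame hFu (by decide) (by decide)
  refine Runs.seq (T₁ := 2) (T₂ := I.f2 * (I.n2 * 9 + 5) + 2)
    (Q := fun y => y.var .tcnt = 1 ∧ (∀ b ≤ 1, y.arr .child 0 b = 0) ∧
      ∀ b ≤ 1, y.arr .child 1 b = 0) ?_ ?_ (by omega)
  · simp only [newNode, Runs, wp_seq, wp_store, eval, WState.put_var, hu]
    refine ⟨by omega, trivial, fun b hb => ?_, fun b hb => ?_⟩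
    · simpa using hu0 b hb
    · have : b = 0 ∨ b = 1 := by omega
      rcases this with rfl | rfl <;> simp
  rintro z hFz ⟨hz, hz0, hz1⟩
  replace hL := hL.frame hFz (by decide) (by decide)
  refine runs_upTo (N := I.f2) (b := I.n2 * 9 + 3) (by decide) (by decide) (by decide) hL.f2
    (fun k w => (∃ lab, TrieInv (IsPrefix I) (w.arr .child) (w.var .tcnt) lab) ∧
      ∀ g < k, walk (w.arr .child) (I.m2 g) I.n2 ≠ 0) ?_ ?_ ?_ le_rfl
  · refine ⟨⟨fun _ => [], ?_⟩, by simp⟩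
    have htc : (z.set .f 0).var .tcnt = 1 := by simpa using hz
    rw [htc]
    have h1 : ∀ v b, 1 ≤ v → v ≤ 1 → b ≤ 1 → z.arr .child v b = 0 := by
      intro v b h1 h2 h3
      obtain rfl : v = 1 := by omega
      exact hz1 b h3
    constructor
    · exact hz0
    · exact le_rfl
    · rfl
    · intro v b hv hv' hb; exact (h1 v b hv hv' hb).le.trans (by omega)
    · intro v b hv hv' hb hne; exact absurd (h1 v b hv hv' hb) hne
    · exact fun _ _ _ => .inl rfl
  · rintro k w hk hwk hFw ⟨hlab, hwg⟩
    have hLw := hL.frame hFw (by decide) (by decide)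
    refine Runs.seq (T₁ := 1) (T₂ := I.n2 * 9 + 2) (Q := fun y => y.var .node = 1 ∧
      (∃ lab, TrieInv (IsPrefix I) (y.arr .child) (y.var .tcnt) lab) ∧
      ∀ g < k, walk (y.arr .child) (I.m2 g) I.n2 ≠ 0) ?_ ?_ (by omega)
    · simp only [Runs, wp_assign, eval]
      exact ⟨le_rfl, by simp, by simpa using hlab, by simpa using hwg⟩
    rintro w' hFw' ⟨hnode, hlab', hwg'⟩
    have hLw' := hLw.frame hFw' (by decide) (by decide)
    have hfk : w'.var .f = k := (hFw'.var (by decide)).trans hwk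
    refine runs_upTo (N := I.n2) (b := 7) (by decide) (by decide) (by decide) hLw'.n2
      (fun j y => (∃ lab, TrieInv (IsPrefix I) (y.arr .child) (y.var .tcnt) lab) ∧
        y.var .node = walk (y.arr .child) (I.m2 k) j ∧ y.var .node ≠ 0 ∧
        ∀ g < k, walk (y.arr .child) (I.m2 g) I.n2 ≠ 0) ?_ ?_ ?_ le_rfl
    · exact ⟨by simpa using hlab', by simpa [walk] using hnode, by simp [hnode],
        by simpa using hwg'⟩
    · rintro j u hj huj hFu ⟨⟨lab, hlab⟩, hnode, hn0, hwg⟩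
      refine (runs_trieStep (hLw'.frame hFu (by decide) (by decide)) hk hj
        ((hFu.var (by decide)).trans hfk) huj hlab hnode hn0 hwg).mono le_rfl ?_
      rintro y - ⟨h1, h2, h3, h4⟩
      exact ⟨by simpa using h1, by simpa using h2, by simpa using h3, by simpa using h4⟩
    · rintro u - hFu ⟨hlab, hnode, hn0, hwg⟩
      refine ⟨by simpa using hlab, fun g hg => ?_⟩
      simp only [WState.set_arr]
      rcases Nat.lt_succ_iff_lt_or_eq.1 hg with hg | rfl
      · exact hwg g hg
      · exact hnode ▸ hn0
  · rintro w - - ⟨⟨lab, hlab⟩, hwg⟩ bits hbits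
    constructor
    · intro hne
      obtain ⟨h1, h2, -⟩ := hlab.walk_spec hbits I.n2 le_rfl hne
      have := hlab.sound _ (Nat.one_le_iff_ne_zero.2 hne) h1
      rw [h2] at this
      have hn2 := I.n2_pos
      rcases this with h | ⟨g, hg, j, hj, h⟩
      · simp at h; omega
      · have hlen := congrArg List.length h
        simp only [List.length_map, List.length_range] at hlen
        subst hlen
        refine ⟨g, hg, fun q hq => ?_⟩
        exact ((List.map_inj_left.1 h) q (List.mem_range.2 hq)).symm
    · rintro ⟨g, hg, hgb⟩
      have : ∀ k ≤ I.n2, walk (w.arr .child) bits k = walk (w.arr .child) (I.m2 g) k := by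
        intro k
        induction k with
        | zero => intro _; rfl
        | succ k ih => intro hk; rw [walk, walk, ih (by omega), hgb k (by omega)]
      rw [this _ le_rfl]
      exact hwg g hg

/-! ### Reachability -/

/-- The states that are reachable from the initial state, with a search tree. -/
structure ReachRep (I : Inst) (x : St) : Prop where
  ini : x.var .ini = I.ini
  vis : ∀ s < I.V, x.arr (.vis 0) s 0 ≠ 0 ↔ I.Reach s
  tree : ∀ s, I.Reach s → ∃ d < I.V,
    TreePath I.Ed (fun s => x.arr (.par 0) s 0) (fun _ => True) I.ini s d

theorem GraphRep.of_matrix {al : ℕ → Prop} (hV : x.var .V = I.V) (hM : MatrixRep I x)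
    (ha : ∀ s < I.V, (x.arr .alive s 0 ≠ 0 ↔ al s)) : GraphRep false I.V al (I.Sub al) x where
  V := hV
  alive := ha
  edge s hs s' hs' h h' := by
    simp only [Bool.false_eq_true, if_false, hM.ne_zero_iff hs hs']
    exact ⟨fun h1 => ⟨h1, h, h'⟩, fun h => h.1⟩
  lt s s' h := ⟨⟨(h.1.lt I).1, h.2.1⟩, (h.1.lt I).2, h.2.2⟩

theorem GraphRep.of_matrix_transpose {al : ℕ → Prop} (hV : x.var .V = I.V) (hM : MatrixRep I x)
    (ha : ∀ s < I.V, (x.arr .alive s 0 ≠ 0 ↔ al s)) :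
    GraphRep true I.V al (fun s s' => I.Sub al s' s) x where
  V := hV
  alive := ha
  edge s hs s' hs' h h' := by
    simp only [if_true, hM.ne_zero_iff hs' hs]
    exact ⟨fun h1 => ⟨h1, h', h⟩, fun h => h.1⟩
  lt s s' h := ⟨⟨(h.1.lt I).2, h.2.2⟩, (h.1.lt I).1, h.2.1⟩

theorem Visited.nil {n : ℕ} {al : ℕ → Prop} {E : ℕ → ℕ → Prop} {b : Fin 3}
    (hc : x.var .cnt = 0) (hv : ∀ s < n, x.arr (.vis b) s 0 = 0) : Visited n al E b x [] := by
  constructor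
  · simpa using hc
  · simp
  · simp
  · simp
  · simpa using hv
  · simp
  · simp

theorem MatrixRep.frame (h : MatrixRep I x) (hF : Frame P x y) (ha : .mat ∉ P.arrs) :
    MatrixRep I y := by
  unfold MatrixRep at *
  rwa [hF.arr ha]

theorem TrieRep.frame (h : TrieRep I x) (hF : Frame P x y) (ha : .child ∉ P.arrs) :
    TrieRep I y := by
  unfold TrieRep at *
  rwa [hF.arr ha]

theorem Visited.length_le {n : ℕ} {al : ℕ → Prop} {E : ℕ → ℕ → Prop} {b : Fin 3} {L : List ℕ}
    (h : Visited n al E b x L) : L.length ≤ n :=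
  length_le_of_nodup h.nodup fun s hs => (h.mem s hs).1

theorem runs_reach (hL : Loaded I x) (hN : Numbered I I.V x) (hM : MatrixRep I x) :
    Runs inp reach x (9 * ((I.V + 1) * I.V) + 4 * I.V + 15) (ReachRep I) := by
  unfold reach
  refine Runs.seq (T₁ := I.V * 4 + 2) (T₂ := 9 * ((I.V + 1) * I.V) + 13)
    (Q := fun y => ∀ s < I.V, y.arr .alive s 0 = 1 ∧ y.arr (.vis 0) s 0 = 0) ?_ ?_ (by omega)
  · refine runs_upTo (N := I.V) (b := 2) (by decide) (by decide) (by decide) hN.V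
      (fun k y => ∀ s < k, y.arr .alive s 0 = 1 ∧ y.arr (.vis 0) s 0 = 0) (by simp) ?_ ?_ le_rfl
    · intro k y hk hyk hF hy
      simp only [Runs, wp_seq, wp_store, eval, hyk, WState.put_var]
      refine ⟨le_rfl, fun s hs => ?_⟩
      by_cases hsk : s = k
      · simp [hsk]
      · simpa [hsk] using hy s (by omega)
    · intro y _ _ hy; exact hy
  intro y hF hy
  replace hL := hL.frame hF (by decide) (by decide)
  replace hN := hN.frame hF (by decide) (by decide)
  replace hM := hM.frame hF (by decide)
  have hcode : y.arr .code I.i1 I.i2 = I.ini := by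
    have := hN.code I.ini I.ini_lt
    rwa [Inst.ini, I.pair_div _ I.i2_lt, I.pair_mod _ I.i2_lt] at this
  simp only [Runs, wp_seq, wp_assign, eval, WState.set_var, WState.set_arr, reduceCtorEq, if_false,
    if_true, hL.i1, hL.i2, hcode]
  have hG : GraphRep false I.V (fun _ => True) (I.Sub fun _ => True) y :=
    .of_matrix hN.V hM fun s hs => by simp [(hy s hs).1]
  refine wp_dfs (L := []) (root := I.ini) (hG.congr ?_ ?_ ?_) (.nil ?_ ?_) ?_ I.ini_lt trivial
    (by simp) ?_
  · simp
  · simp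
  · simp
  · simp
  · exact fun s hs => (hy s hs).2
  · simp
  intro t z N ht hFz hv hmem htree
  rw [List.nil_append] at hv
  have hNle := hv.length_le
  have hmul : (I.V + 1) * N.length ≤ (I.V + 1) * I.V := Nat.mul_le_mul_left _ hNle
  have hreach : ∀ s, I.Reach s ↔ s ∈ N := by
    intro s
    constructor
    · intro h
      induction h with
      | refl => exact hmem
      | tail _ hE ih => exact hv.closed _ ih _ ⟨hE, trivial, trivial⟩
    · intro h
      obtain ⟨d, -, hd⟩ := htree s h
      induction hd with
      | root => exact .refl
      | step h1 _ h3 h4 ih => exact (ih h4.mem).tail h3.1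
  refine ⟨by omega, ?_, ?_, ?_⟩
  · rw [hFz.var (by decide)]; simp
  · intro s hs
    rw [hv.vis s hs, hreach]; simp
  · intro s hs
    obtain ⟨d, hd, h⟩ := htree s ((hreach s).1 hs)
    refine ⟨d, by omega, ?_⟩
    clear hd
    induction h with
    | root => exact .root trivial
    | step h1 h2 h3 h4 ih => exact .step trivial h2 h3.1 (ih ((hreach _).2 h4.mem))

end Prog

/-! ### Testing the strongly connected components -/

namespace Inst

open Relation

variable {I : Inst} {al : ℕ → Prop} {r r' s : ℕ}

theorem comp_eq (h : r' ∈ I.comp al r) : I.comp al r' = I.comp al r := by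
  ext s
  exact ⟨fun hs => ⟨h.1.trans hs.1, hs.2.trans h.2⟩, fun hs => ⟨h.2.trans hs.1, hs.2.trans h.1⟩⟩

theorem Harmless.of_mem_comp {f : ℕ} (h : I.Harmless f al r) (hr : r' ∈ I.comp al r) :
    I.Harmless f al r' := by
  unfold Harmless
  rw [comp_eq hr]
  rintro ⟨s, hs, hE⟩
  refine h ?_
  rcases ReflTransGen.cases_head hr.1 with rfl | ⟨x, hx, hxr⟩
  · exact ⟨s, hs, hE⟩
  · exact ⟨x, ⟨.single hx, hxr.trans hr.2⟩, hx.1⟩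

theorem reflTransGen_of_mem_comp (h : s ∈ I.comp al r) :
    ReflTransGen (I.Sub (· ∈ I.comp al r)) r s := by
  obtain ⟨h1, h2⟩ := h
  induction h1 with
  | refl => exact .refl
  | @tail b c hb hbc ih =>
    have hcr : ReflTransGen (I.Sub al) b r := (ReflTransGen.single hbc).trans h2
    exact (ih hcr).tail ⟨hbc.1, ⟨hb, hcr⟩, hb.tail hbc, h2⟩

end Inst

namespace Prog

open WExpr WProg Relation

variable {inp : List ℕ} {I : Inst} {x y : St} {P : Pr}

/-- Everything that is computed before the search. -/
structure Ctx (I : Inst) (x : St) : Prop where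
  loaded : Loaded I x
  numbered : Numbered I I.V x
  matrix : MatrixRep I x
  trie : TrieRep I x
  reach : ReachRep I x

/-- The variables on which `Ctx` depends. -/
def ctxVars : List Var := loadedVars ++ [.V, .ini]

/-- The arrays on which `Ctx` depends. -/
def ctxArrs : List Arr := loadedArrs ++ [.fst, .snd, .code, .mat, .child, .vis 0, .par 0]

theorem ReachRep.frame (h : ReachRep I x) (hF : Frame P x y) (hv : .ini ∉ P.vars)
    (ha : .vis 0 ∉ P.arrs) (hp : .par 0 ∉ P.arrs) : ReachRep I y := by
  obtain ⟨h1, h2, h3⟩ := h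
  constructor
  · rwa [hF.var hv]
  · rwa [hF.arr ha]
  · rwa [hF.arr hp]

theorem Ctx.frame (h : Ctx I x) (hF : Frame P x y) (hv : ∀ v ∈ ctxVars, v ∉ P.vars)
    (ha : ∀ a ∈ ctxArrs, a ∉ P.arrs) : Ctx I y where
  loaded := h.loaded.frame hF (fun v h => hv v (List.mem_append_left _ h))
    (fun v h => ha v (List.mem_append_left _ h))
  numbered := h.numbered.frame hF (hv _ (by decide)) (by
    intro a h; refine ha a ?_; revert a; decide)
  matrix := h.matrix.frame hF (ha _ (by decide))
  trie := h.trie.frame hF (ha _ (by decide))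
  reach := h.reach.frame hF (hv _ (by decide)) (ha _ (by decide)) (ha _ (by decide))

theorem Ctx.set {v : Var} {n : ℕ} (h : Ctx I x) (hv : v ∉ ctxVars) : Ctx I (x.set v n) := by
  refine h.frame (P := .assign v (.lit n)) (y := x.set v n) ⟨fun {w} hw => ?_, fun _ => rfl⟩ ?_
    (by simp [arrs])
  · simp only [vars, List.mem_singleton] at hw; simp [hw]
  · intro w hw
    simp only [vars, List.mem_singleton]
    rintro rfl; exact hv hw

/-- The list `N` stands in `ord 2` from `start` to `cnt`. -/
structure Segment (N : List ℕ) (x : St) : Prop where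
  cnt : x.var .cnt = x.var .start + N.length
  ord : ∀ k (h : k < N.length), x.arr (.ord 2) (x.var .start + k) 0 = N[k]

theorem Segment.frame {N : List ℕ} (h : Segment N x) (hF : Frame P x y) (hc : .cnt ∉ P.vars)
    (hs : .start ∉ P.vars) (ho : .ord 2 ∉ P.arrs) : Segment N y := by
  obtain ⟨h1, h2⟩ := h
  exact ⟨by rwa [hF.var hc, hF.var hs], by rwa [hF.arr ho, hF.var hs]⟩

theorem runs_project {N : List ℕ} {r : ℕ} (hC : Ctx I x) (hS : Segment N x)
    (hN : ∀ s ∈ N, s < I.V) (hr : x.var .root = r) (hrV : r < I.V) :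
    Runs inp project x (3 * I.n1 + 3 * I.n2 + 8 * N.length + 7) fun y =>
      (∀ q < I.n1, y.arr .proj1 q 0 ≤ 1 ∧ (y.arr .proj1 q 0 = 1 ↔ ∃ s ∈ N, s / I.n2 = q)) ∧
      (∀ q < I.n2, y.arr .proj2 q 0 ≤ 1 ∧ (y.arr .proj2 q 0 = 1 ↔ ∃ s ∈ N, s % I.n2 = q)) ∧
      (y.var .flag ≠ 0 → y.var .sn ∈ N ∧ I.Ed r (y.var .sn)) ∧
      (y.var .flag = 0 → ∀ s ∈ N, ¬ I.Ed r s) := by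
  unfold project
  refine Runs.seq (T₁ := I.n1 * 3 + 2) (T₂ := 3 * I.n2 + 8 * N.length + 5)
    (Q := fun y => ∀ q < I.n1, y.arr .proj1 q 0 = 0) ?_ ?_ (by omega)
  · refine runs_upTo (N := I.n1) (b := 1) (by decide) (by decide) (by decide) hC.loaded.n1
      (fun k y => ∀ q < k, y.arr .proj1 q 0 = 0) (by simp) ?_ (fun _ _ _ h => h) le_rfl
    intro k y hk hyk hF hy
    simp only [Runs, wp_store, eval, hyk]
    refine ⟨le_rfl, fun s hs => ?_⟩
    by_cases hsk : s = k
    · simp [hsk]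
    · simpa [hsk] using hy s (by omega)
  intro y hFy hy1
  replace hC := hC.frame hFy (by decide) (by decide)
  replace hS := hS.frame hFy (by decide) (by decide) (by decide)
  replace hr : y.var .root = r := (hFy.var (by decide)).trans hr
  refine Runs.seq (T₁ := I.n2 * 3 + 2) (T₂ := 8 * N.length + 3)
    (Q := fun y => ∀ q < I.n2, y.arr .proj2 q 0 = 0) ?_ ?_ (by omega)
  · refine runs_upTo (N := I.n2) (b := 1) (by decide) (by decide) (by decide) hC.loaded.n2
      (fun k y => ∀ q < k, y.arr .proj2 q 0 = 0) (by simp) ?_ (fun _ _ _ h => h) le_rfl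
    intro k y hk hyk hF hy
    simp only [Runs, wp_store, eval, hyk]
    refine ⟨le_rfl, fun s hs => ?_⟩
    by_cases hsk : s = k
    · simp [hsk]
    · simpa [hsk] using hy s (by omega)
  intro z hFz hz2
  replace hC := hC.frame hFz (by decide) (by decide)
  replace hS := hS.frame hFz (by decide) (by decide) (by decide)
  replace hr : z.var .root = r := (hFz.var (by decide)).trans hr
  rw [← hFz.arr (by decide)] at hy1
  refine Runs.seq (T₁ := 1) (T₂ := 8 * N.length + 2) (Q := fun y => y.var .flag = 0) ?_ ?_
    (by omega)
  · simp [Runs, wp_assign, eval]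
  intro w hFw hw
  replace hC := hC.frame hFw (by decide) (by decide)
  replace hS := hS.frame hFw (by decide) (by decide) (by decide)
  replace hr : w.var .root = r := (hFw.var (by decide)).trans hr
  rw [← hFw.arr (by decide)] at hy1 hz2
  refine Runs.seq (T₁ := 1) (T₂ := 8 * N.length + 1)
    (Q := fun y => y.var .k = y.var .start) ?_ ?_ (by omega)
  · simp [Runs, wp_assign, eval]
  intro u hFu hu
  replace hC := hC.frame hFu (by decide) (by decide)
  replace hS := hS.frame hFu (by decide) (by decide) (by decide)
  replace hr : u.var .root = r := (hFu.var (by decide)).trans hr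
  rw [← hFu.arr (by decide)] at hy1 hz2
  rw [← hFu.var (by decide)] at hw
  generalize hst : u.var .start = st at *
  refine runs_upFrom (N := st + N.length) (k₀ := st) (b := 6) (by decide) (by decide) (by decide)
    (by rw [hS.cnt, hst]) hu (by omega)
    (fun k y =>
      (∀ q < I.n1, y.arr .proj1 q 0 ≤ 1 ∧
        (y.arr .proj1 q 0 = 1 ↔ ∃ s ∈ N.take (k - st), s / I.n2 = q)) ∧
      (∀ q < I.n2, y.arr .proj2 q 0 ≤ 1 ∧
        (y.arr .proj2 q 0 = 1 ↔ ∃ s ∈ N.take (k - st), s % I.n2 = q)) ∧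
      (y.var .flag ≠ 0 → y.var .sn ∈ N ∧ I.Ed r (y.var .sn)) ∧
      (y.var .flag = 0 → ∀ s ∈ N.take (k - st), ¬ I.Ed r s)) ?_ ?_ ?_
    (by rw [Nat.add_sub_cancel_left]; omega)
  · refine ⟨fun q hq => ?_, fun q hq => ?_, fun h => absurd hw h, fun _ => ?_⟩
    · simp [hy1 q hq]
    · simp [hz2 q hq]
    · simp
  · rintro k v hk hkN hvk hFv ⟨h1, h2, h3, h4⟩
    replace hC := hC.frame hFv (by decide) (by decide)
    replace hS := hS.frame hFv (by decide) (by decide) (by decide)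
    replace hr : v.var .root = r := (hFv.var (by decide)).trans hr
    replace hst : v.var .start = st := (hFv.var (by decide)).trans hst
    obtain ⟨j, rfl⟩ : ∃ j, k = st + j := ⟨k - st, by omega⟩
    have hj : j < N.length := by omega
    have hord := hS.ord j hj
    rw [hst] at hord
    have hjV : N[j] < I.V := hN _ (List.getElem_mem hj)
    have htake : N.take (st + j + 1 - st) = N.take j ++ [N[j]] := by
      rw [show st + j + 1 - st = j + 1 by omega, List.take_succ_eq_append_getElem hj]
    rw [show st + j - st = j by omega] at h1 h2 h4
    simp only [Runs, wp_seq, wp_store, wp_assign, wp_ite, wp_skip, eval, WState.set_var,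
      WState.set_arr, WState.put_var, hvk, hord, reduceCtorEq, if_false, if_true, hr,
      WState.put_arr_of_ne, ne_eq, not_false_eq_true, hC.numbered.fst _ hjV,
      hC.numbered.snd _ hjV]
    have hmat := hC.matrix.ne_zero_iff hrV hjV
    have key : ∀ z : St, z.arr .proj1 = ((v.put .proj1 (N[j] / I.n2) 0 1).arr .proj1) →
        z.arr .proj2 = ((v.put .proj2 (N[j] % I.n2) 0 1).arr .proj2) →
        (∀ q < I.n1, z.arr .proj1 q 0 ≤ 1 ∧
          (z.arr .proj1 q 0 = 1 ↔ ∃ s ∈ N.take j ++ [N[j]], s / I.n2 = q)) ∧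
        (∀ q < I.n2, z.arr .proj2 q 0 ≤ 1 ∧
          (z.arr .proj2 q 0 = 1 ↔ ∃ s ∈ N.take j ++ [N[j]], s % I.n2 = q)) := by
      intro z hz1 hz2
      have hor : ∀ p : ℕ → Prop, (∃ s ∈ N.take j ++ [N[j]], p s) ↔
          (∃ s ∈ N.take j, p s) ∨ p N[j] := by
        intro p
        simp only [List.mem_append, List.mem_singleton, or_and_right, exists_or, exists_eq_left]
      constructor
      · intro q hq
        rw [hz1, hor, WState.put_arr_self]
        by_cases hqj : q = N[j] / I.n2
        · simp [hqj]
        · simpa [hqj, Ne.symm hqj] using h1 q hq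
      · intro q hq
        rw [hz2, hor, WState.put_arr_self]
        by_cases hqj : q = N[j] % I.n2
        · simp [hqj]
        · simpa [hqj, Ne.symm hqj] using h2 q hq
    constructor
    · intro hne
      refine ⟨le_rfl, ?_⟩
      rw [htake]
      obtain ⟨k1, k2⟩ := key ((((v.set .s N[j]).put .proj1 (N[j] / I.n2) 0 1).put .proj2
        (N[j] % I.n2) 0 1)) (by simp [WState.put]) (by simp [WState.put])
      refine ⟨k1, k2, fun _ => ?_, fun h => ?_⟩
      · exact ⟨List.getElem_mem hj, hmat.1 hne⟩
      · simp at h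
    · intro h0
      refine ⟨by omega, ?_⟩
      rw [htake]
      obtain ⟨k1, k2⟩ := key ((((v.set .s N[j]).put .proj1 (N[j] / I.n2) 0 1).put .proj2
        (N[j] % I.n2) 0 1)) (by simp [WState.put]) (by simp [WState.put])
      refine ⟨k1, k2, by simpa using h3, fun hf s hs => ?_⟩
      rcases List.mem_append.1 hs with hs | hs
      · exact h4 (by simpa using hf) s hs
      · rw [List.mem_singleton.1 hs]
        exact fun hE => hmat.2 hE h0
  · rintro v - - h
    rwa [Nat.add_sub_cancel_left, List.take_length] at h

theorem runs_lookup (hC : Ctx I x) (hb : ∀ q < I.n2, x.arr .proj2 q 0 ≤ 1) :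
    Runs inp lookup x (3 * I.n2 + 3) fun y =>
      (y.var .node ≠ 0 ↔ ∃ g < I.f2, ∀ q < I.n2, I.m2 g q = x.arr .proj2 q 0) := by
  unfold lookup
  refine Runs.seq (T₁ := 1) (T₂ := I.n2 * 3 + 2) (Q := fun y => y.var .node = 1) ?_ ?_ (by omega)
  · simp [Runs, wp_assign, eval]
  intro y hFy hy
  have hC' := hC.frame hFy (by decide) (by decide)
  refine runs_upTo (N := I.n2) (b := 1) (by decide) (by decide) (by decide) hC'.loaded.n2
    (fun k y => y.var .node = walk (x.arr .child) (fun q => x.arr .proj2 q 0) k)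
    (by simpa [walk] using hy) ?_ ?_ le_rfl
  · intro k z hk hzk hF hz
    simp only [Runs, wp_assign, eval, hz, hzk]
    rw [hF.arr (by decide), hF.arr (by decide), hFy.arr (by decide), hFy.arr (by decide)]
    exact ⟨le_rfl, by simp [walk]⟩
  · intro z _ _ hz
    rw [hz]
    exact hC.trie _ hb

/-- The component refutes the inclusion, and `sn` is a successor of its element `r` in it. -/
structure Refuting (I : Inst) (f : ℕ) (N : List ℕ) (r sn : ℕ) : Prop where
  mem : sn ∈ N
  edge : I.Ed r sn
  final1 : I.Final1 f {s | s ∈ N}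
  final2 : ∀ g < I.f2, ¬ I.Final2 g {s | s ∈ N}

theorem runs_check {N : List ℕ} {r f : ℕ} (hC : Ctx I x) (hS : Segment N x)
    (hN : ∀ s ∈ N, s < I.V) (hr : x.var .root = r) (hrV : r < I.V) (hf : x.var .f = f)
    (hfI : f < I.f1) (h0 : x.var .found = 0) :
    Runs inp check x (7 * I.n1 + 6 * I.n2 + 8 * N.length + 17) fun y =>
      (y.var .found ≠ 0 → Refuting I f N r (y.var .sn)) ∧
      (y.var .found = 0 → (∃ s ∈ N, I.Ed r s) → I.Final1 f {s | s ∈ N} →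
        ∃ g < I.f2, I.Final2 g {s | s ∈ N}) := by
  unfold check
  refine (runs_project hC hS hN hr hrV).seq ?_ (T₂ := 4 * I.n1 + 3 * I.n2 + 10) (by omega)
  rintro y hFy ⟨hp1, hp2, hfl1, hfl0⟩
  replace hC := hC.frame hFy (by decide) (by decide)
  replace hf : y.var .f = f := (hFy.var (by decide)).trans hf
  replace h0 : y.var .found = 0 := (hFy.var (by decide)).trans h0
  refine Runs.seq (T₁ := I.n1 * 4 + 2) (T₂ := 3 * I.n2 + 7)
    (Q := fun z => z.var .flag ≠ 0 ↔ y.var .flag ≠ 0 ∧ I.Final1 f {s | s ∈ N}) ?_ ?_ (by omega)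
  · refine runs_upTo (N := I.n1) (b := 2) (by decide) (by decide) (by decide) hC.loaded.n1
      (fun k z => z.var .flag ≠ 0 ↔ y.var .flag ≠ 0 ∧ ∀ q < k, y.arr .proj1 q 0 = I.m1 f q)
      (by simp) ?_ ?_ le_rfl
    · intro k z hk hzk hF hz
      have hC := hC.frame hF (by decide) (by decide)
      have hf : z.var .f = f := (hF.var (by decide)).trans hf
      simp only [Runs, wp_ite, wp_assign, wp_skip, eval, hzk, hf, hC.loaded.memb1 f hfI k hk,
        hF.arr (show Arr.proj1 ∉ _ by decide)]
      constructor
      · intro hne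
        refine ⟨le_rfl, ?_⟩
        simp only [WState.set_var, reduceCtorEq, if_false, if_true, ne_eq, not_true, false_iff,
          not_and]
        intro _ h
        have := h k (by omega)
        omega
      · intro heq
        refine ⟨le_rfl, ?_⟩
        simp only [WState.set_var, reduceCtorEq, if_false]
        rw [hz]
        refine and_congr_right fun _ => ⟨fun h q hq => ?_, fun h q hq => h q (by omega)⟩
        rcases Nat.lt_succ_iff_lt_or_eq.1 hq with hq | rfl
        · exact h q hq
        · omega
    · intro z _ _ hz
      rw [hz]
      refine and_congr_right fun _ => forall₂_congr fun q hq => ?_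
      have h1 := hp1 q hq
      have h2 := I.m1_le f q
      have h3 : (∃ s ∈ {s | s ∈ N}, s / I.n2 = q) ↔ ∃ s ∈ N, s / I.n2 = q := Iff.rfl
      rw [h3, ← h1.2]
      omega
  intro z hFz hz
  replace hC := hC.frame hFz (by decide) (by decide)
  have h0z : z.var .found = 0 := (hFz.var (by decide)).trans h0
  have hsn : z.var .sn = y.var .sn := hFz.var (by decide)
  have hp2z : z.arr .proj2 = y.arr .proj2 := hFz.arr (by decide)
  simp only [Runs, wp_ite, wp_seq, wp_skip, eval]
  refine ⟨fun hne => ?_, fun heq => ⟨by omega, fun h => absurd h0z h, fun _ h1 h2 => ?_⟩⟩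
  · obtain ⟨hy, hF1⟩ := hz.1 hne
    refine (runs_lookup hC (by rw [hp2z]; exact fun q hq => (hp2 q hq).1)).wp ?_
    intro t w ht hFw hw
    rw [hp2z] at hw
    have hw' : w.var .node ≠ 0 ↔ ∃ g < I.f2, I.Final2 g {s | s ∈ N} := by
      rw [hw]
      refine exists_congr fun g => and_congr_right fun _ => forall₂_congr fun q hq => ?_
      have h1 := hp2 q hq
      have h2 := I.m2_le g q
      have h3 : (∃ s ∈ {s | s ∈ N}, s % I.n2 = q) ↔ ∃ s ∈ N, s % I.n2 = q := Iff.rfl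
      rw [h3, ← h1.2]
      omega
    simp only [wp_ite, wp_skip, wp_assign, eval]
    refine ⟨fun hnode => ⟨by omega, fun h => ?_, fun _ _ _ => hw'.1 hnode⟩,
      fun hnode => ⟨by omega, fun _ => ?_, fun h => ?_⟩⟩
    · exact absurd ((hFw.var (by decide)).trans h0z) h
    · obtain ⟨h1, h2⟩ := hfl1 hy
      have : (w.set .found 1).var .sn = y.var .sn := by
        simp [hFw.var (show Var.sn ∉ lookup.vars by decide), hsn]
      rw [this]
      refine ⟨h1, h2, hF1, fun g hg hG => ?_⟩
      exact (hw'.2 ⟨g, hg, hG⟩) hnode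
    · simp at h
  · by_contra _
    have hy : y.var .flag = 0 := by
      by_contra hy
      exact hz.2 ⟨hy, h2⟩ heq
    obtain ⟨s, hs, hE⟩ := h1
    exact hfl0 hy s hs hE

end Prog

/-! ### The search for a refuting component -/

namespace Prog

open WExpr WProg Relation

variable {inp : List ℕ} {I : Inst} {x y : St} {P : Pr}

/-- The result of a successful search: a component that refutes the inclusion. -/
structure Found (I : Inst) (N : List ℕ) (r f : ℕ) (x : St) : Prop where
  root : x.var .root = r
  segment : Segment N x
  length_le : N.length ≤ I.V
  root_mem : r ∈ N
  mem : ∀ s ∈ N, s < I.V ∧ I.Reach s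
  f_lt : f < I.f1
  refuting : Refuting I f N r (x.var .sn)
  tree : ∀ s ∈ N, ∃ d < I.V,
    TreePath (fun s s' => I.Ed s' s) (fun s => x.arr (.par 2) s 0) (· ∈ N) r s d
  reachable : ∀ s ∈ N, ReflTransGen (I.Sub (· ∈ N)) r s

theorem Found.frame {N : List ℕ} {r f : ℕ} (h : Found I N r f x) (hF : Frame P x y)
    (hv : ∀ v ∈ [Var.root, .cnt, .start, .sn], v ∉ P.vars)
    (ha : ∀ a ∈ [Arr.ord 2, .par 2], a ∉ P.arrs) : Found I N r f y := by
  obtain ⟨h1, h2, h3, h4, h5, h6, h7, h8, h9⟩ := h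
  refine ⟨?_, h2.frame hF (hv _ (by decide)) (hv _ (by decide)) (ha _ (by decide)), h3, h4, h5, h6,
    ?_, ?_, h9⟩
  · rwa [hF.var (hv _ (by decide))]
  · rwa [hF.var (hv _ (by decide))]
  · rwa [hF.arr (ha _ (by decide))]

/-- Either no refuting component has been found, and then `Q` holds, or one has been found. -/
def Outcome (I : Inst) (Q : Prop) (x : St) : Prop :=
  x.var .found = 0 ∧ Q ∨ x.var .found ≠ 0 ∧ ∃ N r f, Found I N r f x

variable {f : ℕ} {alw : ℕ → Prop} {al : ℕ → Prop}

theorem runs_restrict (hC : Ctx I x) (hf : x.var .f = f) (hfI : f < I.f1)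
    (ha : ∀ p < I.n2, (x.arr .alw p 0 ≠ 0 ↔ alw p)) :
    Runs inp restrict x (5 * I.V + 2) fun y =>
      ∀ s < I.V, (y.arr .alive s 0 ≠ 0 ↔ I.Alive f alw s) ∧ y.arr (.vis 1) s 0 = 0 ∧
        y.arr (.vis 2) s 0 = 0 := by
  unfold restrict
  refine runs_upTo (N := I.V) (b := 3) (by decide) (by decide) (by decide) hC.numbered.V
    (fun k y => ∀ s < k, (y.arr .alive s 0 ≠ 0 ↔ I.Alive f alw s) ∧ y.arr (.vis 1) s 0 = 0 ∧
        y.arr (.vis 2) s 0 = 0) (by simp) ?_ (fun _ _ _ h => h) (by omega)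
  intro k y hk hyk hF hy
  have hC := hC.frame hF (by decide) (by decide)
  have hf : y.var .f = f := (hF.var (by decide)).trans hf
  have ha' := ha (k % I.n2) (I.mod_lt k)
  rw [← hF.arr (by decide)] at ha'
  simp only [Runs, wp_seq, wp_store, eval, hyk, hf, WState.put_var, hC.numbered.fst k hk,
    hC.numbered.snd k hk, hC.loaded.memb1 f hfI _ (I.div_lt hk)]
  refine ⟨le_rfl, fun s hs => ?_⟩
  by_cases hsk : s = k
  · subst hsk
    have h1 := hC.reach.vis s hk
    simp only [WState.set_arr, ne_eq, reduceCtorEq, not_false_eq_true, WState.put_arr_of_ne,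
      WState.put_arr_self, and_self, if_true, Inst.Alive, ← h1, hk, ← ha', true_and,
      Arr.vis.injEq, Fin.reduceEq, and_true]
    omega
  · simpa [hsk] using hy s (by omega)

/-- The first pass finds a finishing order `L` of all nodes. -/
theorem runs_pass1 (hC : Ctx I x) (hal : ∀ s, al s → s < I.V)
    (ha : ∀ s < I.V, (x.arr .alive s 0 ≠ 0 ↔ al s)) (hv : ∀ s < I.V, x.arr (.vis 1) s 0 = 0) :
    Runs inp pass1 x (9 * ((I.V + 1) * I.V) + 9 * I.V + 3) fun y =>
      ∃ L, Visited I.V al (I.Sub al) 1 y L ∧ ∀ s, al s → s ∈ L := by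
  unfold pass1
  refine wp_seq.2 (wp_assign.2 ?_)
  refine wp_upTo (N := I.V) (by decide) (by decide) (by decide) (by simpa using hC.numbered.V)
    (fun k t y => ∃ L, Visited I.V al (I.Sub al) 1 y L ∧ (∀ s < k, al s → s ∈ L) ∧
      t ≤ 2 + 9 * ((I.V + 1) * L.length) + 9 * k) ?_ ?_ ?_
  · exact ⟨[], .nil (by simp [eval]) (by simpa using hv), by simp, by simp⟩
  · rintro k t y hk hyk hF ⟨L, hL, hLk, ht⟩
    have hG : GraphRep false I.V al (I.Sub al) y :=
      (GraphRep.of_matrix hC.numbered.V hC.matrix ha).congr (hF.var (by decide))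
        (hF.arr (by decide)) (hF.arr (by decide))
    have hak := hG.alive k hk
    have hvk := hL.vis k hk
    simp only [wp_ite, wp_seq, wp_assign, wp_skip, eval, hyk]
    have hstep : ∀ (z : St) (L' : List ℕ), Visited I.V al (I.Sub al) 1 z L' →
        Visited I.V al (I.Sub al) 1 (z.set .s (k + 1)) L' := by
      rintro z L' ⟨h1, h2, h3, h4, h5, h6, h7⟩
      exact ⟨by simpa using h1, by simpa using h2, h3, h4, by simpa using h5, h6, h7⟩
    refine ⟨fun hne => ?_, fun h0 => ?_⟩
    · have hkL : k ∉ L := by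
        intro h; rw [if_pos h] at hvk; omega
      have hkal : al k := hak.1 (by omega)
      refine wp_dfs (L := L) (root := k) (hG.congr (by simp) (by simp) (by simp)) ?_ (by simp) hk
        hkal hkL ?_
      · obtain ⟨h1, h2, h3, h4, h5, h6, h7⟩ := hL
        exact ⟨by simpa using h1, by simpa using h2, h3, h4, by simpa using h5, h6, h7⟩
      · intro t' z N ht' hFz hz hkN _
        refine ⟨L ++ N, hstep _ _ hz, fun s hs hsal => ?_, ?_⟩
        · rcases Nat.lt_succ_iff_lt_or_eq.1 hs with hs | rfl
          · exact List.mem_append_left _ (hLk s hs hsal)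
          · exact List.mem_append_right _ hkN
        · rw [List.length_append, mul_add]; omega
    · refine ⟨L, hstep _ _ hL, fun s hs hsal => ?_, by omega⟩
      rcases Nat.lt_succ_iff_lt_or_eq.1 hs with hs | rfl
      · exact hLk s hs hsal
      · by_contra h
        rw [if_neg h] at hvk
        have := hak.2 hsal
        omega
  · rintro t y - - ⟨L, hL, hLk, ht⟩
    have : (I.V + 1) * L.length ≤ (I.V + 1) * I.V := Nat.mul_le_mul_left _ hL.length_le
    exact ⟨by omega, L, hL, fun s hs => hLk s (hal s hs) hs⟩

/-- One round of the second pass: the nodes visited by the search in the transposed graph from the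
latest unvisited node `L[m]` form its component `N`, and this component is tested. -/
theorem wp_testComponent {L L₂ : List ℕ} {m t : ℕ} {R : ℕ → St → Prop} (hC : Ctx I x)
    (hf : x.var .f = f) (hfI : f < I.f1) (hal : ∀ s, al s → s < I.V ∧ I.Reach s)
    (hG : GraphRep true I.V al (fun s s' => I.Sub al s' s) x)
    (hnd : L.Nodup)
    (hord : ∀ k (h : k < L.length), ∀ s ∈ L.take (k + 1), ∀ w, I.Sub al s w →
      w ∈ L.take (k + 1) ∨ ReflTransGen (I.Sub al) w L[k])
    (hL : ∀ s, al s ↔ s ∈ L)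
    (hv : Visited I.V al (fun s s' => I.Sub al s' s) 2 x L₂) (hm : m < L.length)
    (hL₂ : ∀ k (h : k < L.length), m < k → L[k] ∈ L₂) (hr : x.var .root = L[m])
    (hrL : L[m] ∉ L₂) (h0 : x.var .found = 0)
    (hR : ∀ t' y N, t' ≤ t + 9 * ((I.V + 1) * N.length) + 7 * I.n1 + 6 * I.n2 + 8 * N.length + 23 →
      Frame (.assign .start (.var .cnt) ;; dfs true 2 ;; check) x y →
      (L₂ ++ N).length ≤ I.V →
      (y.var .found = 0 → Visited I.V al (fun s s' => I.Sub al s' s) 2 y (L₂ ++ N) ∧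
        L[m] ∈ N ∧ ∀ r ∈ N, I.Harmless f al r) →
      (y.var .found ≠ 0 → Found I N L[m] f y) → R t' y) :
    wp inp (.assign .start (.var .cnt) ;; dfs true 2 ;; check) R t x := by
  suffices H : wp inp (.assign .start (.var .cnt) ;; dfs true 2 ;; check) (fun t' y =>
      Frame (.assign .start (.var .cnt) ;; dfs true 2 ;; check) x y → R t' y) t x from
    H.mono fun t' y _ hF h => h hF
  have hral : al L[m] := (hL _).2 (List.getElem_mem hm)
  simp only [wp_seq, wp_assign, eval]
  refine wp_dfs (L := L₂) (root := L[m]) (hG.congr (by simp) (by simp) (by simp)) ?_ (by simp [hr])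
    (hal _ hral).1 hral hrL ?_
  · obtain ⟨h1, h2, h3, h4, h5, h6, h7⟩ := hv
    exact ⟨by simpa using h1, by simpa using h2, h3, h4, by simpa using h5, h6, h7⟩
  intro t' y N ht' hFy hvy hrN htree
  have hC1 : Ctx I y := (hC.set (v := .start) (n := x.var .cnt) (by decide)).frame hFy
    (by decide) (by decide)
  have hst : y.var .start = L₂.length := by
    rw [hFy.var (by decide)]; simp [hv.cnt]
  have hdis : ∀ s ∈ N, s ∉ L₂ := fun s hs hs' =>
    (List.nodup_append'.1 hvy.nodup).2.2 hs' hs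
  have hNal : ∀ s ∈ N, al s := fun s hs => (hvy.mem s (List.mem_append_right _ hs)).2
  have hNlen : N.length ≤ I.V := by
    have := hvy.length_le; rw [List.length_append] at this; omega
  have hcomp : ∀ s, s ∈ N ↔ s ∈ I.comp al L[m] := mem_component_iff hnd hord (fun s => (hL s).1) hm
    hL₂ hrL hv.closed hvy.closed hdis hNal hrN fun s hs => (htree s hs).imp fun d h => h.2
  have hcomp' : {s | s ∈ N} = I.comp al L[m] := Set.ext hcomp
  have hseg : Segment N y := by
    constructor
    · rw [hvy.cnt, hst, List.length_append]
    · intro k hk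
      rw [hst, hvy.ord _ (by rw [List.length_append]; omega)]
      simp
  have hry : y.var .root = L[m] := by rw [hFy.var (by decide)]; simp [hr]
  refine (runs_check hC1 hseg (fun s hs => (hal s (hNal s hs)).1) hry (hal _ hral).1
    (f := f) (by rw [hFy.var (by decide)]; simp [hf]) hfI
    (by rw [hFy.var (by decide)]; simp [h0])).wp ?_
  rintro t'' z ht'' hFz ⟨hz1, hz0⟩ hFxz
  refine hR t'' z N (by omega) hFxz hvy.length_le (fun hz => ⟨?_, hrN, fun r hr' => ?_⟩)
    (fun hz => ?_)
  · obtain ⟨h1, h2, h3, h4, h5, h6, h7⟩ := hvy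
    exact ⟨by rwa [hFz.var (by decide)], by rwa [hFz.arr (by decide)], h3, h4,
      by rwa [hFz.arr (by decide)], h6, h7⟩
  · refine Inst.Harmless.of_mem_comp (r := L[m]) ?_ ((hcomp r).1 hr')
    rintro ⟨s, hs, hE⟩
    rw [← hcomp']
    exact hz0 hz ⟨s, (hcomp s).2 hs, hE⟩
  · refine ⟨by rwa [hFz.var (by decide)], hseg.frame hFz (by decide) (by decide) (by decide), hNlen,
      hrN, fun s hs => hal s (hNal s hs), hfI, hz1 hz, fun s hs => ?_, fun s hs => ?_⟩
    · obtain ⟨d, hd, h⟩ := htree s hs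
      refine ⟨d, by omega, ?_⟩
      rw [hFz.arr (by decide)]
      clear hd
      induction h with
      | root h => exact .root h
      | step h1 h2 h3 h4 ih => exact .step h1 h2 h3.1 (ih h4.mem)
    · have := Inst.reflTransGen_of_mem_comp ((hcomp s).1 hs)
      rwa [← hcomp'] at this

/-- The second pass goes through the finishing order backwards; its invariant says that all nodes
from `L[m]` on have been visited, and that their components are harmless. -/
theorem runs_pass2 {L : List ℕ} (hC : Ctx I x) (hf : x.var .f = f) (hfI : f < I.f1)
    (hal : ∀ s, al s → s < I.V ∧ I.Reach s) (ha : ∀ s < I.V, (x.arr .alive s 0 ≠ 0 ↔ al s))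
    (hv : Visited I.V al (I.Sub al) 1 x L) (hL : ∀ s, al s → s ∈ L)
    (h2 : ∀ s < I.V, x.arr (.vis 2) s 0 = 0) (h0 : x.var .found = 0) :
    Runs inp pass2 x ((7 * I.n1 + 6 * I.n2 + 30) * I.V + (9 * (I.V + 1) + 8) * I.V + 3)
      (Outcome I (∀ r, al r → I.Harmless f al r)) := by
  have hlen := hv.length_le
  have hL' : ∀ s, al s ↔ s ∈ L := fun s => ⟨hL s, fun h => (hv.mem s h).2⟩
  simp only [Runs, pass2]
  refine wp_seq.2 (wp_assign.2 (wp_seq.2 (wp_assign.2 ?_)))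
  set K₁ := 7 * I.n1 + 6 * I.n2 + 30
  set K₂ := 9 * (I.V + 1) + 8
  refine wp_while (fun t y => ∃ L₂ : List ℕ, L₂.length ≤ I.V ∧ y.var .m ≤ L.length ∧
    t ≤ 2 + K₁ * (L.length - y.var .m) + K₂ * L₂.length ∧
    (y.var .found = 0 → Visited I.V al (fun s s' => I.Sub al s' s) 2 y L₂ ∧
      (∀ k (h : k < L.length), y.var .m ≤ k → L[k] ∈ L₂) ∧ ∀ r ∈ L₂, I.Harmless f al r) ∧
    (y.var .found ≠ 0 → ∃ N r f, Found I N r f y)) (2 + K₁ * I.V + K₂ * I.V) ?_ ?_ ?_ ?_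
  · rintro t y ⟨L₂, h1, h2, h3, -⟩
    have e1 : K₁ * (L.length - y.var .m) ≤ K₁ * I.V := Nat.mul_le_mul_left _ (by omega)
    have e2 : K₂ * L₂.length ≤ K₂ * I.V := Nat.mul_le_mul_left _ h1
    omega
  · refine ⟨[], by simp, by simp [eval, hv.cnt], by simp [eval], fun _ => ⟨.nil ?_ ?_, ?_, by simp⟩,
      fun h => ?_⟩
    · simp [eval]
    · simpa using h2
    · intro k hk hmk
      simp [eval, hv.cnt] at hmk; omega
    · simp [h0] at h
  · rintro t y ⟨L₂, hlen₂, hm, ht, hy0, -⟩ hFy hne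
    simp only [eval] at hne
    have hfound : y.var .found = 0 := by omega
    obtain ⟨hvy, hLm, hharm⟩ := hy0 hfound
    obtain ⟨m, hm'⟩ : ∃ m, y.var .m = m + 1 := ⟨y.var .m - 1, by omega⟩
    have hmL : m < L.length := by omega
    have hCy : Ctx I y := ((hC.set (v := .m) (n := x.var .cnt) (by decide)).set (v := .cnt)
      (n := 0) (by decide)).frame hFy (by decide) (by decide)
    have hordy : y.arr (.ord 1) m 0 = L[m] := by
      rw [hFy.arr (by decide)]; exact hv.ord m hmL
    have hGy : GraphRep true I.V al (fun s s' => I.Sub al s' s) y :=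
      .of_matrix_transpose hCy.numbered.V hCy.matrix (by rw [hFy.arr (by decide)]; exact ha)
    have hfy : y.var .f = f := by rw [hFy.var (by decide)]; exact hf
    have hrV : L[m] < I.V := (hv.mem _ (List.getElem_mem hmL)).1
    have hvr := hvy.vis L[m] hrV
    rw [wp_seq, wp_assign, wp_seq, wp_assign, wp_ite]
    simp only [eval, hm', Nat.add_sub_cancel, WState.set_var, WState.set_arr, if_true, hordy]
    have hmul : K₁ * (L.length - m) = K₁ * (L.length - (m + 1)) + K₁ := by
      rw [show L.length - m = L.length - (m + 1) + 1 by omega, mul_add, mul_one]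
    have hvis2 : ∀ z : St, z.var .cnt = y.var .cnt → z.arr = y.arr →
        Visited I.V al (fun s s' => I.Sub al s' s) 2 z L₂ := by
      intro z hz1 hz2
      obtain ⟨h1, h2, h3, h4, h5, h6, h7⟩ := hvy
      exact ⟨by rwa [hz1], by rwa [hz2], h3, h4, by rwa [hz2], h6, h7⟩
    rw [hm'] at ht
    refine ⟨fun hold => wp_skip.2 ?_, fun hnew => ?_⟩
    · have hmem : L[m] ∈ L₂ := by
        by_contra h
        rw [if_neg h] at hvr
        exact hold hvr
      refine ⟨L₂, hlen₂, by simp; omega, ?_, fun _ => ⟨hvis2 _ (by simp) (by simp), ?_, hharm⟩,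
        fun h => by simp [hfound] at h⟩
      · simp only [WState.set_var, reduceCtorEq, if_false, if_true, hmul]; omega
      · intro k hk hmk
        simp only [WState.set_var, reduceCtorEq, if_false, if_true] at hmk
        rcases Nat.eq_or_lt_of_le hmk with rfl | hmk
        · exact hmem
        · exact hLm k hk (by omega)
    · have hmem : L[m] ∉ L₂ := by
        intro h
        rw [if_pos h] at hvr
        omega
      refine wp_testComponent (L := L) (m := m) (f := f) ((hCy.set (v := .m) (by decide)).set
        (v := .root) (by decide)) (by simp [hfy]) hfI hal (hGy.congr (by simp) (by simp) (by simp))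
        hv.nodup hv.order hL' (hvis2 _ (by simp) (by simp)) hmL
        (fun k hk hmk => hLm k hk (by omega)) (by simp) hmem (by simp [hfound]) ?_
      intro t' z N ht' hFz hzlen hz0 hz1
      have hzm : z.var .m = m := by rw [hFz.var (by decide)]; simp
      have e3 : K₂ * (L₂ ++ N).length = K₂ * L₂.length + (9 * ((I.V + 1) * N.length) +
          8 * N.length) := by
        simp only [K₂, List.length_append]; ring
      refine ⟨L₂ ++ N, hzlen, by omega, ?_, fun h => ?_, fun h => ⟨_, _, _, hz1 h⟩⟩
      · rw [hzm, hmul, e3]; omega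
      · obtain ⟨h1, h2, h3⟩ := hz0 h
        refine ⟨h1, fun k hk hmk => ?_, fun r hr => ?_⟩
        · rw [hzm] at hmk
          rcases Nat.eq_or_lt_of_le hmk with rfl | hmk
          · exact List.mem_append_right _ h2
          · exact List.mem_append_left _ (hLm k hk (by omega))
        · rcases List.mem_append.1 hr with hr | hr
          · exact hharm r hr
          · exact h3 r hr
  · rintro t y ⟨L₂, hlen₂, hm, ht, hy0, hy1⟩ - heq
    have e1 : K₁ * (L.length - y.var .m) ≤ K₁ * I.V := Nat.mul_le_mul_left _ (by omega)
    have e2 : K₂ * L₂.length ≤ K₂ * I.V := Nat.mul_le_mul_left _ hlen₂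
    refine ⟨by omega, ?_⟩
    by_cases hfound : y.var .found = 0
    · refine .inl ⟨hfound, fun r hr => ?_⟩
      obtain ⟨-, h1, h2⟩ := hy0 hfound
      simp only [eval, hfound] at heq
      obtain ⟨k, hk, rfl⟩ := List.mem_iff_getElem.1 (hL r hr)
      exact h2 _ (h1 k hk (by omega))
    · exact .inr ⟨hfound, hy1 hfound⟩

theorem runs_components (hC : Ctx I x) (hf : x.var .f = f) (hfI : f < I.f1)
    (ha : ∀ p < I.n2, (x.arr .alw p 0 ≠ 0 ↔ alw p)) (h0 : x.var .found = 0) :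
    Runs inp components x (120 * (I.V * I.V))
      (Outcome I (∀ r, I.Alive f alw r → I.Harmless f (I.Alive f alw) r)) := by
  unfold components
  refine (runs_restrict hC hf hfI ha).seq (T₂ := 120 * (I.V * I.V) - (5 * I.V + 2)) ?_ ?_
  · intro y hFy hy
    have hCy := hC.frame hFy (by decide) (by decide)
    refine (runs_pass1 hCy (al := I.Alive f alw) (fun s hs => hs.1) (fun s hs => (hy s hs).1)
      (fun s hs => (hy s hs).2.1)).seq (T₂ := 120 * (I.V * I.V) - (5 * I.V + 2) -
        (9 * ((I.V + 1) * I.V) + 9 * I.V + 3)) ?_ ?_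
    · rintro z hFz ⟨L, hL, hLal⟩
      have hCz := hCy.frame hFz (by decide) (by decide)
      refine (runs_pass2 hCz (f := f) ?_ hfI (fun s hs => ⟨hs.1, hs.2.1⟩) ?_ hL hLal ?_ ?_).mono ?_
        fun _ _ h => h
      · rw [hFz.var (by decide), hFy.var (by decide), hf]
      · rw [hFz.arr (by decide)]; exact fun s hs => (hy s hs).1
      · rw [hFz.arr (by decide)]; exact fun s hs => (hy s hs).2.2
      · rw [hFz.var (by decide), hFy.var (by decide), h0]
      · have h1 : I.n1 ≤ I.V := Nat.le_mul_of_pos_right _ I.n2_pos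
        have h2 : I.n2 ≤ I.V := Nat.le_mul_of_pos_left _ I.n1_pos
        have h3 := I.V_pos
        have h4 : (7 * I.n1 + 6 * I.n2 + 30) * I.V ≤ (43 * I.V) * I.V :=
          Nat.mul_le_mul_right _ (by omega)
        have h5 : I.V ≤ I.V * I.V := Nat.le_mul_of_pos_left _ h3
        have h6 : (9 * (I.V + 1) + 8) * I.V = 9 * (I.V * I.V) + 17 * I.V := by ring
        have h7 : (I.V + 1) * I.V = I.V * I.V + I.V := by ring
        rw [mul_assoc] at h4
        omega
    · have h3 := I.V_pos
      have h5 : I.V ≤ I.V * I.V := Nat.le_mul_of_pos_left _ h3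
      have h7 : (I.V + 1) * I.V = I.V * I.V + I.V := by ring
      omega
  · have h3 := I.V_pos
    have h5 : I.V ≤ I.V * I.V := Nat.le_mul_of_pos_left _ h3
    omega

end Prog

/-! ### The search through all restrictions -/

namespace Prog

open WExpr WProg Relation

variable {inp : List ℕ} {I : Inst} {x y : St} {P : Pr}

theorem Outcome.frame {Q Q' : Prop} (h : Outcome I Q x) (hF : Frame P x y) (hQ : Q → Q')
    (hv : ∀ v ∈ [Var.found, .root, .cnt, .start, .sn], v ∉ P.vars)
    (ha : ∀ a ∈ [Arr.ord 2, .par 2], a ∉ P.arrs) : Outcome I Q' y := by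
  have hfound : y.var .found = x.var .found := hF.var (hv _ (by decide))
  rcases h with ⟨h, hq⟩ | ⟨h, N, r, f, hN⟩
  · exact .inl ⟨hfound.trans h, hQ hq⟩
  · exact .inr ⟨by rwa [hfound], N, r, f, hN.frame hF (fun v hm => hv v (List.mem_cons_of_mem _ hm))
      ha⟩

theorem Outcome.set {Q Q' : Prop} {v : Var} {n : ℕ} (h : Outcome I Q x) (hQ : Q → Q')
    (hv : v ∉ [Var.found, .root, .cnt, .start, .sn]) : Outcome I Q' (x.set v n) := by
  refine h.frame (P := .assign v (.lit n)) (y := x.set v n) ⟨fun {w} hw => ?_, fun _ => rfl⟩ hQ ?_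
    (by simp [arrs])
  · simp only [vars, List.mem_singleton] at hw; simp [hw]
  · intro w hw
    simp only [vars, List.mem_singleton]
    rintro rfl; exact hv hw

/-- Membership in the final state set number `g` of the second acceptor without the element `q`. -/
abbrev without (I : Inst) (g q p : ℕ) : Prop := I.m2 g p ≠ 0 ∧ p ≠ q

/-- No component refutes the inclusion after the restriction of the second components to `alw`. -/
def AllHarmless (I : Inst) (f : ℕ) (alw : ℕ → Prop) : Prop :=
  ∀ r, I.Alive f alw r → I.Harmless f (I.Alive f alw) r

theorem runs_search_without {f g q : ℕ} {Q : Prop} (hC : Ctx I x) (hf : x.var .f = f)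
    (hfI : f < I.f1) (hg : x.var .g = g) (hgI : g < I.f2) (hq : x.var .qq = q)
    (h : Outcome I Q x) :
    Runs inp (.ite (.var .found) .skip
      (upTo .s .n2 (put1 .alw .s (.get .memb2 (.var .g) (.var .s))) ;;
        put1 .alw .qq (.lit 0) ;; components)) x (3 * I.n2 + 4 + 120 * (I.V * I.V))
      (Outcome I (Q ∧ AllHarmless I f (without I g q))) := by
  simp only [Runs, wp_ite, wp_skip, eval]
  refine ⟨fun hne => ⟨by omega, ?_⟩, fun h0 => ?_⟩
  · rcases h with ⟨h, -⟩ | h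
    · exact absurd h hne
    · exact .inr h
  have hQ : Q := by
    rcases h with ⟨-, h⟩ | ⟨h, -⟩
    · exact h
    · exact absurd h0 h
  rw [wp_seq]
  refine Runs.wp (T := I.n2 * 3 + 2)
    (Q := fun y => ∀ p < I.n2, y.arr .alw p 0 = I.m2 g p) ?_ ?_
  · refine runs_upTo (N := I.n2) (b := 1) (by decide) (by decide) (by decide) hC.loaded.n2
      (fun k y => ∀ p < k, y.arr .alw p 0 = I.m2 g p) (by simp) ?_ (fun _ _ _ h => h) le_rfl
    intro k y hk hyk hF hy
    have hC := hC.frame hF (by decide) (by decide)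
    have hg : y.var .g = g := (hF.var (by decide)).trans hg
    simp only [Runs, wp_store, eval, hyk, hg, hC.loaded.memb2 g hgI k hk]
    refine ⟨le_rfl, fun s hs => ?_⟩
    by_cases hsk : s = k
    · simp [hsk]
    · simpa [hsk] using hy s (by omega)
  intro t y ht hF hy
  replace hC := hC.frame hF (by decide) (by decide)
  have hq : y.var .qq = q := (hF.var (by decide)).trans hq
  have hf : y.var .f = f := (hF.var (by decide)).trans hf
  have h0 : y.var .found = 0 := (hF.var (by decide)).trans h0
  rw [wp_seq, wp_store]
  simp only [eval, hq]
  have hC' : Ctx I (y.put .alw q 0 0) := by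
    refine hC.frame (P := put1 .alw .qq (.lit 0)) ⟨fun _ => rfl, fun {a} ha => ?_⟩ (by decide)
      (by decide)
    simp only [arrs, List.mem_singleton] at ha
    simp [ha]
  refine (runs_components hC' (f := f) (alw := without I g q) (by simpa using hf) hfI ?_
    (by simpa using h0)).wp ?_
  · intro p hp
    by_cases hpq : p = q
    · simp [hpq]
    · simp [hpq, hy p hp]
  · intro t' z ht' _ hz
    refine ⟨by omega, ?_⟩
    rcases hz with ⟨hz, h⟩ | hz
    · exact .inl ⟨hz, hQ, h⟩
    · exact .inr hz

/-- A bound for the time of the search. -/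
def searchTime (I : Inst) : ℕ :=
  I.f1 * (3 * I.n2 + 7 + 120 * (I.V * I.V) +
    I.f2 * (I.n2 * (3 * I.n2 + 4 + 120 * (I.V * I.V) + 2) + 4)) + 3

/-- The search is exhaustive by `Inst.not_bad_of_harmless`. -/
theorem runs_search (hC : Ctx I x) :
    Runs inp search x (searchTime I) (Outcome I (∀ w, ¬ I.Bad w)) := by
  unfold search
  refine Runs.seq (T₁ := 1) (T₂ := searchTime I - 1) (Q := fun y => y.var .found = 0) ?_ ?_ ?_
  · simp [Runs, wp_assign, eval]
  · intro y hF hy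
    replace hC := hC.frame hF (by decide) (by decide)
    refine runs_upTo (N := I.f1) (b := 3 * I.n2 + 5 + 120 * (I.V * I.V) +
        I.f2 * (I.n2 * (3 * I.n2 + 4 + 120 * (I.V * I.V) + 2) + 4))
      (by decide) (by decide) (by decide) hC.loaded.f1
      (fun k => Outcome I (∀ f < k, AllHarmless I f (fun _ => True) ∧
        ∀ g < I.f2, ∀ q < I.n2, AllHarmless I f (without I g q))) ?_ ?_ ?_ ?_
    · exact .inl ⟨by simpa using hy, by simp⟩
    · intro f z hfI hzf hFz hz
      replace hC := hC.frame hFz (by decide) (by decide)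
      simp only [Runs, wp_ite, wp_skip, eval]
      refine ⟨fun hne => ⟨by omega, ?_⟩, fun h0 => ?_⟩
      · refine Outcome.set (Q := False) ?_ False.elim (by decide)
        rcases hz with ⟨h, -⟩ | h
        · exact absurd h hne
        · exact .inr h
      have hz' : ∀ k < f, AllHarmless I k (fun _ => True) ∧
          ∀ g < I.f2, ∀ q < I.n2, AllHarmless I k (without I g q) := by
        rcases hz with ⟨-, h⟩ | ⟨h, -⟩
        · exact h
        · exact absurd h0 h
      rw [wp_seq]
      refine Runs.wp (T := I.n2 * 3 + 2) (Q := fun y => ∀ p < I.n2, y.arr .alw p 0 = 1) ?_ ?_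
      · refine runs_upTo (N := I.n2) (b := 1) (by decide) (by decide) (by decide) hC.loaded.n2
          (fun k y => ∀ p < k, y.arr .alw p 0 = 1) (by simp) ?_ (fun _ _ _ h => h) le_rfl
        intro k y hk hyk hF hy
        simp only [Runs, wp_store, eval, hyk]
        refine ⟨le_rfl, fun s hs => ?_⟩
        by_cases hsk : s = k
        · simp [hsk]
        · simpa [hsk] using hy s (by omega)
      intro t u ht hFu hu
      replace hC := hC.frame hFu (by decide) (by decide)
      replace h0 : u.var .found = 0 := (hFu.var (by decide)).trans h0
      have huf : u.var .f = f := (hFu.var (by decide)).trans hzf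
      rw [wp_seq]
      refine (runs_components hC (f := f) (alw := fun _ => True) huf hfI
        (fun p hp => by simp [hu p hp]) h0).wp ?_
      intro t' v ht' hFv hv
      replace hC := hC.frame hFv (by decide) (by decide)
      have hvf : v.var .f = f := (hFv.var (by decide)).trans huf
      refine (runs_upTo (T := I.f2 * (I.n2 * (3 * I.n2 + 4 + 120 * (I.V * I.V) + 2) + 4) + 2)
        (N := I.f2) (b := I.n2 * (3 * I.n2 + 4 + 120 * (I.V * I.V) + 2) + 2)
        (by decide) (by decide) (by decide) hC.loaded.f2
        (fun j => Outcome I (AllHarmless I f (fun _ => True) ∧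
          ∀ g < j, ∀ q < I.n2, AllHarmless I f (without I g q)))
        (hv.set (fun h => ⟨h, by simp⟩) (by decide)) ?_ (fun _ _ _ h => h) le_rfl).wp ?_
      · intro g a hgI hag hFa ha
        replace hC := hC.frame hFa (by decide) (by decide)
        have haf : a.var .f = f := (hFa.var (by decide)).trans hvf
        refine runs_upTo (N := I.n2) (b := 3 * I.n2 + 4 + 120 * (I.V * I.V))
          (by decide) (by decide) (by decide) hC.loaded.n2
          (fun l => Outcome I ((AllHarmless I f (fun _ => True) ∧
            ∀ k < g, ∀ q < I.n2, AllHarmless I f (without I k q)) ∧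
            ∀ q < l, AllHarmless I f (without I g q)))
          (ha.set (fun h => ⟨h, by simp⟩) (by decide)) ?_ ?_ le_rfl
        · intro q b hqI hbq hFb hb
          refine (runs_search_without (hC.frame hFb (by decide) (by decide))
            ((hFb.var (by decide)).trans haf) hfI ((hFb.var (by decide)).trans hag) hgI hbq
            hb).mono le_rfl fun c _ hc => hc.set ?_ (by decide)
          rintro ⟨⟨h1, h2⟩, h3⟩
          refine ⟨h1, fun k hk => ?_⟩
          rcases Nat.lt_succ_iff_lt_or_eq.1 hk with hk | rfl
          · exact h2 k hk
          · exact h3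
        · intro b _ _ hb
          refine hb.set ?_ (by decide)
          rintro ⟨⟨h1, h2⟩, h3⟩
          refine ⟨h1, fun k hk => ?_⟩
          rcases Nat.lt_succ_iff_lt_or_eq.1 hk with hk | rfl
          · exact h2 k hk
          · exact h3
      · intro t'' a ht'' _ ha
        refine ⟨by omega, ha.set ?_ (by decide)⟩
        intro h k hk
        rcases Nat.lt_succ_iff_lt_or_eq.1 hk with hk | rfl
        · exact hz' k hk
        · exact h
    · intro z _ _ hz
      rcases hz with ⟨h, hz⟩ | hz
      · refine .inl ⟨h, I.not_bad_of_harmless (fun f hf => (hz f hf).1)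
          fun f hf g hg q hq => (hz f hf).2 g hg q hq⟩
      · exact .inr hz
    · simp only [searchTime]
      rw [show 3 * I.n2 + 5 + 120 * (I.V * I.V) +
        I.f2 * (I.n2 * (3 * I.n2 + 4 + 120 * (I.V * I.V) + 2) + 4) + 2 = 3 * I.n2 + 7 +
        120 * (I.V * I.V) +
        I.f2 * (I.n2 * (3 * I.n2 + 4 + 120 * (I.V * I.V) + 2) + 4) by omega]
      omega
  · have : 3 ≤ searchTime I := Nat.le_add_left _ _
    omega

end Prog

/-! ### Extraction of a counterexample -/

namespace Inst

variable (I : Inst)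

/-- The word `l` leads from `s` to `y` through states in `S`. -/
def Path (S : ℕ → Prop) : ℕ → List ℕ → ℕ → Prop
  | s, [], y => S s ∧ s = y
  | s, a :: l, y => S s ∧ a < I.A ∧ Path S (I.D s a) l y

/-- The state `s` occurs when the word `v` is read from state `r` on. -/
def Visits (r : ℕ) (v : List ℕ) (s : ℕ) : Prop := ∃ l, l <+: v ∧ l.foldl I.D r = s

variable {I} {S : ℕ → Prop}

theorem Path.append {s m y : ℕ} {l l' : List ℕ} (h : I.Path S s l m) (h' : I.Path S m l' y) :
    I.Path S s (l ++ l') y := by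
  induction l generalizing s with
  | nil => obtain ⟨-, rfl⟩ := h; exact h'
  | cons a l ih => exact ⟨h.1, h.2.1, ih h.2.2⟩

theorem Path.foldl_eq {s y : ℕ} {l : List ℕ} (h : I.Path S s l y) : l.foldl I.D s = y := by
  induction l generalizing s with
  | nil => exact h.2
  | cons a l ih => exact ih h.2.2

theorem Path.lt {s y : ℕ} {l : List ℕ} (h : I.Path S s l y) : ∀ a ∈ l, a < I.A := by
  induction l generalizing s with
  | nil => simp
  | cons a l ih => exact List.forall_mem_cons.2 ⟨h.2.1, ih h.2.2⟩

theorem Path.of_visits {s y z : ℕ} {l : List ℕ} (h : I.Path S s l y) (hz : I.Visits s l z) :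
    S z := by
  obtain ⟨k, hk, rfl⟩ := hz
  induction l generalizing s k with
  | nil => rw [List.prefix_nil.1 hk]; exact h.1
  | cons a l ih =>
    rcases List.prefix_cons_iff.1 hk with rfl | ⟨k, rfl, hk'⟩
    · exact h.1
    · exact ih h.2.2 k hk'

theorem Visits.append {r s : ℕ} {v : List ℕ} (h : I.Visits r v s) (v' : List ℕ) :
    I.Visits r (v ++ v') s := by
  obtain ⟨l, hl, h⟩ := h
  exact ⟨l, hl.trans (List.prefix_append _ _), h⟩

end Inst

namespace Prog

open WExpr WProg Relation

variable {inp : List ℕ} {I : Inst} {x y : St} {P : Pr}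

theorem MatrixRep.congr (h : MatrixRep I x) (hm : y.arr .mat = x.arr .mat) : MatrixRep I y := by
  unfold MatrixRep at *
  rwa [hm]

theorem TreePath.mono_edge {E E' : ℕ → ℕ → Prop} {par : ℕ → ℕ} {S : ℕ → Prop} {root s d : ℕ}
    (h : TreePath E par S root s d) (hE : ∀ s s', E s s' → E' s s') :
    TreePath E' par S root s d := by
  induction h with
  | root h => exact .root h
  | step h1 h2 h3 _ ih => exact .step h1 h2 (hE _ _ h3) ih

/-- The word `w` has been written to the output. -/
structure Written (w : List ℕ) (x : St) : Prop where
  pos : x.var .pos = w.length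
  out : ∀ i (h : i < w.length), x.arr .out i 0 = w[i]

theorem Written.congr {w : List ℕ} (h : Written w x) (hp : y.var .pos = x.var .pos)
    (ho : y.arr .out = x.arr .out) : Written w y :=
  ⟨hp.trans h.pos, by rw [ho]; exact h.out⟩

theorem Written.put {w : List ℕ} (h : Written w x) (a n : ℕ) (hn : n = w.length + 1) :
    Written (w ++ [a]) ((x.put .out w.length 0 a).set .pos n) := by
  refine ⟨by simp [hn], fun i hi => ?_⟩
  rw [List.length_append, List.length_singleton] at hi
  by_cases hiw : i = w.length
  · simp [hiw]
  · rw [List.getElem_append_left (by omega)]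
    simpa [hiw] using h.out i (by omega)

/-- The path along the parents runs from `s` up to the root `r`, hence the letters are written
backwards, after the depth of `s` has been determined. -/
theorem runs_upPath {b : Fin 3} {S : ℕ → Prop} {r s d : ℕ} {w : List ℕ} (hM : MatrixRep I x)
    (hr : x.var .r = r) (hs : x.var .y = s) (hw : Written w x)
    (hT : TreePath I.Ed (fun s => x.arr (.par b) s 0) S r s d) :
    Runs inp (upPath b) x (7 * d + 7) fun z =>
      ∃ l, l.length = d ∧ Written (w ++ l) z ∧ I.Path S r l s := by
  have hp : x.var .pos = w.length := hw.pos
  simp only [upPath, Runs, wp_seq, wp_assign]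
  refine wp_while (fun t y => ∃ k, k ≤ d ∧ y.var .e = w.length + (d - k) ∧
      TreePath I.Ed (fun s => x.arr (.par b) s 0) S r (y.var .s) k ∧ t ≤ 2 + 3 * (d - k) ∧
      (∀ v ∉ [Var.e, .s], y.var v = x.var v) ∧ y.arr = x.arr) (2 + 3 * d) ?_ ?_ ?_ ?_
  · rintro t y ⟨k, hk, -, -, ht, -⟩
    omega
  · refine ⟨d, le_rfl, by simp [eval, hp], by simpa [eval, hs] using hT, by omega, ?_, rfl⟩
    intro v hv
    simp only [List.mem_cons, List.not_mem_nil, or_false, not_or] at hv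
    simp [hv]
  · rintro t y ⟨k, hk, he, hk', ht, hvar, harr⟩ - hne
    have hyr : y.var .r = r := (hvar _ (by decide)).trans hr
    simp only [eval, hyr] at hne
    simp only [wp_seq, wp_assign, eval, WState.set_var, WState.set_arr, reduceCtorEq, if_false,
      harr]
    cases hk' with
    | root => simp at hne
    | @step _ k h1 h2 h3 h4 =>
      refine ⟨k, by omega, by simp [he]; omega, by simpa using h4, by omega, ?_, trivial⟩
      intro v hv
      have hv' := hv
      simp only [List.mem_cons, List.not_mem_nil, or_false, not_or] at hv'
      simp [hv', hvar v hv]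
  rintro t y ⟨k, hk, he, hk', ht, hvar, harr⟩ - heq
  have hyr : y.var .r = r := (hvar _ (by decide)).trans hr
  simp only [eval, hyr] at heq
  have hk0 : k = 0 := by
    cases hk' with
    | root => rfl
    | step h1 h2 h3 h4 => exact absurd (by omega) h2
  subst hk0
  simp only [wp_seq, wp_assign, eval, WState.set_var, reduceCtorEq, if_false, he, Nat.sub_zero,
    (hvar .y (by decide)).trans hs]
  refine wp_while (fun t z => ∃ k l, k + l.length = d ∧ z.var .e = w.length + k ∧
      TreePath I.Ed (fun s => x.arr (.par b) s 0) S r (z.var .s) k ∧ I.Path S (z.var .s) l s ∧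
      t ≤ 5 + 3 * d + 4 * (d - k) ∧ z.var .np = w.length + d ∧ z.var .pos = w.length ∧
      z.arr (.par b) = x.arr (.par b) ∧ z.arr .mat = x.arr .mat ∧
      (∀ i (h : i < w.length), z.arr .out i 0 = w[i]) ∧
      ∀ i (h : i < l.length), z.arr .out (w.length + k + i) 0 = l[i]) (5 + 7 * d) ?_ ?_ ?_ ?_
  · rintro t z ⟨k, l, hk, -, -, -, ht, -⟩
    omega
  · refine ⟨d, [], by simp, by simp [he], by simpa using hT, ⟨?_, by simp⟩, by omega, by simp,
      by simpa [hvar Var.pos (by decide)] using hp, by simp [harr], by simp [harr], ?_, by simp⟩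
    · simpa using hT.mem
    · simpa [harr] using hw.out
  · rintro t z ⟨k, l, hkl, he, hk, hl, ht, hnp, hpos, hpar, hmat, hout, hout'⟩ - hne
    simp only [eval, he, hpos] at hne
    simp only [wp_seq, wp_assign, wp_store, eval, WState.set_var, WState.set_arr, WState.put_var,
      reduceCtorEq, if_false, if_true, ne_eq, not_false_eq_true, WState.put_arr_of_ne, hpar, hmat,
      he]
    cases hk with
    | root => simp at hne
    | @step _ k h1 h2 h3 h4 =>
      have hmt := hM _ (h3.lt I).1 _ (h3.lt I).2
      have hmt' := hmt.2 fun h => hmt.1 h h3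
      refine ⟨k, _ :: l, by simp; omega, by simp, by simpa using h4,
        ⟨by simpa using h4.mem, hmt'.1, ?_⟩, by omega, by simpa using hnp, by simpa using hpos,
        by simp, by simp, fun i hi => ?_, fun i hi => ?_⟩
      · simpa [hmt'.2] using hl
      · have : i ≠ w.length + k := by omega
        simpa [this] using hout i hi
      · rcases i with _ | i
        · simp [← add_assoc]
        · have h1 : w.length + (k + 1) + i ≠ w.length + k := by omega
          have h2 : w.length + k + (i + 1) = w.length + (k + 1) + i := by omega
          simpa [h1, h2] using hout' i (by simpa using hi)
  · rintro t z ⟨k, l, hkl, he, hk, hl, ht, hnp, hpos, hpar, hmat, hout, hout'⟩ - heq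
    simp only [eval, he, hpos] at heq
    have hk0 : k = 0 := by omega
    subst hk0
    simp only [wp_assign, eval, hnp]
    have hzs : z.var .s = r := by
      generalize z.var .s = s' at hk
      cases hk; rfl
    rw [hzs] at hl
    refine ⟨by omega, l, by omega, ⟨by simp; omega, fun i hi => ?_⟩, hl⟩
    rcases Nat.lt_or_ge i w.length with h | h
    · rw [List.getElem_append_left h]
      simpa using hout i h
    · rw [List.getElem_append_right h]
      rw [List.length_append] at hi
      simpa [Nat.add_sub_cancel' h] using hout' (i - w.length) (by omega)

/-- In a search tree of the transposed graph, the path along the parents runs in the direction of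
the edges. -/
theorem runs_downPath {S : ℕ → Prop} {r s d : ℕ} {w : List ℕ} (hM : MatrixRep I x)
    (hr : x.var .r = r) (hs : x.var .s = s) (hw : Written w x)
    (hT : TreePath (fun s s' => I.Ed s' s) (fun s => x.arr (.par 2) s 0) S r s d) :
    Runs inp downPath x (4 * d + 1) fun z =>
      ∃ l, l.length = d ∧ Written (w ++ l) z ∧ I.Path S s l r := by
  simp only [downPath, Runs]
  refine wp_while (fun t z => ∃ k l, k + l.length = d ∧ t ≤ 4 * (d - k) ∧ Written (w ++ l) z ∧
    TreePath (fun s s' => I.Ed s' s) (fun s => x.arr (.par 2) s 0) S r (z.var .s) k ∧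
    ∀ l', I.Path S (z.var .s) l' r → I.Path S s (l ++ l') r) (4 * d) ?_ ?_ ?_ ?_
  · rintro t z ⟨k, l, hk, ht, -⟩
    omega
  · exact ⟨d, [], by simp, by omega, by simpa using hw, by rwa [hs], by rw [hs]; simp⟩
  · rintro t z ⟨k, l, hkl, ht, hz, hk, hl⟩ hF hne
    have hzr : z.var .r = r := (hF.var (by decide)).trans hr
    have hpar : z.arr (.par 2) = x.arr (.par 2) := hF.arr (by decide)
    have hmat : z.arr .mat = x.arr .mat := hF.arr (by decide)
    simp only [eval, hzr] at hne
    simp only [wp_seq, wp_assign, wp_store, eval, WState.set_var, WState.set_arr, WState.put_var,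
      reduceCtorEq, if_false, ne_eq, not_false_eq_true, WState.put_arr_of_ne, hpar,
      hmat, hz.pos]
    cases hk with
    | root => simp at hne
    | @step _ k h1 h2 h3 h4 =>
      have hmt := hM _ (h3.lt I).1 _ (h3.lt I).2
      have hmt' := hmt.2 fun h => hmt.1 h h3
      refine ⟨k, l ++ [x.arr .mat (z.var .s) (x.arr (.par 2) (z.var .s) 0) - 1],
        by simp; omega, by omega, ?_, by simpa using h4, fun l' hl' => ?_⟩
      · rw [← List.append_assoc]
        exact (hz.put _ _ rfl).congr (by simp) (by simp)
      · rw [List.append_assoc]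
        refine hl _ ⟨h1, hmt'.1, ?_⟩
        simpa [hmt'.2] using hl'
  · rintro t z ⟨k, l, hkl, ht, hz, hk, hl⟩ hF heq
    have hzr : z.var .r = r := (hF.var (by decide)).trans hr
    simp only [eval, hzr] at heq
    have hzs : z.var .s = r := by omega
    have := hl [] ⟨hk.mem, hzs⟩
    rw [List.append_nil] at this
    exact ⟨by omega, l, by
      rw [hzs] at hk
      cases hk with
      | root => omega
      | step _ h => exact absurd rfl h, hz, this⟩

/-- What `componentTree` adds to `Found`: a search tree with root `r` that spans the component. -/
structure Spanned (I : Inst) (N : List ℕ) (r : ℕ) (x : St) : Prop where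
  fin : x.var .fin = x.var .start + N.length
  tree : ∀ s ∈ N, ∃ d < I.V, TreePath I.Ed (fun s => x.arr (.par 1) s 0) (· ∈ N) r s d

theorem runs_componentTree {N : List ℕ} {r f : ℕ} (hC : Ctx I x) (h : Found I N r f x) :
    Runs inp componentTree x (9 * ((I.V + 1) * I.V) + 8 * I.V + 12) (Spanned I N r) := by
  have hNV := h.length_le
  unfold componentTree
  refine Runs.seq (T₁ := I.V * 4 + 2) (T₂ := 9 * ((I.V + 1) * I.V) + 4 * I.V + 10)
    (Q := fun y => ∀ s < I.V, y.arr .alive s 0 = 0 ∧ y.arr (.vis 1) s 0 = 0) ?_ ?_ (by omega)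
  · refine runs_upTo (N := I.V) (b := 2) (by decide) (by decide) (by decide) hC.numbered.V
      (fun k y => ∀ s < k, y.arr .alive s 0 = 0 ∧ y.arr (.vis 1) s 0 = 0) (by simp) ?_
      (fun _ _ _ h => h) le_rfl
    intro k y hk hyk hF hy
    simp only [Runs, wp_seq, wp_store, eval, hyk, WState.put_var]
    refine ⟨le_rfl, fun s hs => ?_⟩
    by_cases hsk : s = k
    · simp [hsk]
    · simpa [hsk] using hy s (by omega)
  intro y hFy hy
  replace hC := hC.frame hFy (by decide) (by decide)
  replace h := h.frame hFy (by decide) (by decide)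
  refine Runs.seq (T₁ := 1) (T₂ := 9 * ((I.V + 1) * I.V) + 4 * I.V + 9)
    (Q := fun y => y.var .k = y.var .start) ?_ ?_ (by omega)
  · simp [Runs, wp_assign, eval]
  intro z hFz hz
  replace hC := hC.frame hFz (by decide) (by decide)
  replace h := h.frame hFz (by decide) (by decide)
  rw [← hFz.arr (by decide), ← hFz.arr (by decide)] at hy
  generalize hst : z.var .start = st at hz
  refine Runs.seq (T₁ := N.length * (2 + 2) + 1) (T₂ := 9 * ((I.V + 1) * I.V) + 7)
    (Q := fun y => ∀ s < I.V, (y.arr .alive s 0 ≠ 0 ↔ s ∈ N)) ?_ ?_ (by omega)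
  · refine runs_upFrom (N := st + N.length) (k₀ := st) (b := 2) (by decide) (by decide)
      (by decide) (by rw [h.segment.cnt, hst]) hz (by omega)
      (fun k y => ∀ s < I.V, (y.arr .alive s 0 ≠ 0 ↔ s ∈ N.take (k - st)))
      (fun s hs => by simp [(hy s hs).1]) ?_ ?_ (by rw [Nat.add_sub_cancel_left])
    · intro k v hk hkN hvk hFv hv
      replace h := h.frame hFv (by decide) (by decide)
      replace hst : v.var .start = st := (hFv.var (by decide)).trans hst
      obtain ⟨j, rfl⟩ : ∃ j, k = st + j := ⟨k - st, by omega⟩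
      have hj : j < N.length := by omega
      have hord := h.segment.ord j hj
      rw [hst] at hord
      simp only [Runs, wp_seq, wp_store, wp_assign, eval, WState.set_var, WState.set_arr, hvk, hord,
        if_true]
      refine ⟨le_rfl, fun s hs => ?_⟩
      rw [show st + j + 1 - st = j + 1 by omega, List.take_succ_eq_append_getElem hj,
        List.mem_append, List.mem_singleton]
      have hv := hv s hs
      rw [show st + j - st = j by omega] at hv
      rw [← hv]
      by_cases hsj : s = N[j]
      · simp [hsj]
      · simp [hsj]
    · intro v _ _ hv
      rwa [Nat.add_sub_cancel_left, List.take_length] at hv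
  intro u hFu hu
  replace hC := hC.frame hFu (by decide) (by decide)
  replace h := h.frame hFu (by decide) (by decide)
  have hvis : ∀ s < I.V, u.arr (.vis 1) s 0 = 0 := by
    rw [hFu.arr (by decide)]; exact fun s hs => (hy s hs).2
  have hG := GraphRep.of_matrix hC.numbered.V hC.matrix hu
  simp only [Runs, wp_seq, wp_assign]
  refine wp_dfs (L := []) (root := r) (hG.congr (by simp) (by simp) (by simp))
    (.nil (by simp [eval]) (by simpa using hvis)) (by simpa using h.root)
    (h.mem r h.root_mem).1 h.root_mem (by simp) ?_
  intro t' v M ht hF hV hroot htree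
  rw [List.nil_append] at hV
  have hlen := hV.length_le
  have hsub : ∀ s ∈ N, s ∈ M := by
    intro s hs
    have hp := h.reachable s hs
    induction hp with
    | refl => exact hroot
    | tail _ hE ih => exact hV.closed _ (ih hE.2.1) _ hE
  have hle : (I.V + 1) * M.length ≤ (I.V + 1) * I.V := Nat.mul_le_mul_left _ hlen
  refine ⟨by omega, ?_, fun s hs => ?_⟩
  · rw [hF.var (by decide), hF.var (by decide)]
    simpa [eval] using h.segment.cnt
  · obtain ⟨d, hd, hT⟩ := htree s (hsub s hs)
    exact ⟨d, by omega, (hT.mono_edge fun _ _ h => h.1).mono (fun s hs => (hV.mem s hs).2)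
      fun _ _ => rfl⟩

/-- The words `u` and `v` stand in the output and refute the inclusion. -/
structure Witness (I : Inst) (u v : List ℕ) (x : St) : Prop where
  ne_nil : v ≠ []
  lenU : x.var .lenU = u.length
  lenV : x.var .lenV = v.length
  out : ∀ i (h : i < (u ++ v).length), x.arr .out i 0 = (u ++ v)[i]
  length_le : u.length + v.length ≤ 5 * (I.V * I.V)
  bad : I.Bad (ultPeriodic u v ne_nil)

theorem witness_of_path {N u v : List ℕ} {r f : ℕ} (hv : v ≠ []) (h : Found I N r f x)
    (hU : y.var .lenU = u.length) (hV : y.var .lenV = v.length)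
    (hout : ∀ i (h : i < (u ++ v).length), y.arr .out i 0 = (u ++ v)[i])
    (hlen : u.length + v.length ≤ 5 * (I.V * I.V)) (hu : I.Path (fun _ => True) I.ini u r)
    (hr : I.Path (· ∈ N) r v r) (hvis : ∀ s ∈ N, I.Visits r v s) : Witness I u v y where
  ne_nil := hv
  lenU := hU
  lenV := hV
  out := hout
  length_le := hlen
  bad := by
    refine I.bad_ultPeriodic hv hu.foldl_eq hr.foldl_eq (fun a ha => ?_) (S := {s | s ∈ N})
      (fun s => ⟨fun hs => ?_, ?_⟩) ⟨f, h.f_lt, h.refuting.final1⟩ h.refuting.final2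
    · rcases List.mem_append.1 ha with ha | ha
      · exact hu.lt a ha
      · exact hr.lt a ha
    · obtain ⟨l, hl, hls⟩ := hvis s hs
      exact ⟨l.length, hl.length_le, by rwa [← List.prefix_iff_eq_take.1 hl]⟩
    · rintro ⟨j, -, hj⟩
      exact hr.of_visits ⟨_, List.take_prefix _ _, hj⟩

/-- The cycle consists of an edge inside of the component followed by a path back to `r`, which
makes it nonempty, and of a path from `r` to each state of the component and back to `r`. Each of
these paths has length less than `I.V`. -/
theorem runs_extract {N : List ℕ} {r f : ℕ} (hC : Ctx I x) (h : Found I N r f x) :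
    Runs inp extract x (100 * (I.V * I.V)) fun y => ∃ u v, Witness I u v y := by
  have hV0 := I.V_pos
  have hVV : I.V ≤ I.V * I.V := Nat.le_mul_of_pos_left _ hV0
  have hNV := h.length_le
  have e1 : (I.V + 1) * I.V = I.V * I.V + I.V := by ring
  unfold extract
  refine Runs.seq (T₂ := 90 * (I.V * I.V) - 17 * I.V - 12) (runs_componentTree hC h) ?_ (by omega)
  intro y hFy hy
  replace hC := hC.frame hFy (by decide) (by decide)
  have hroot : y.var .root = r := (hFy.var (by decide)).trans h.root
  have hsnx : y.var .sn = x.var .sn := hFy.var (by decide)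
  have hsn := h.refuting.mem
  have hedge := h.refuting.edge
  have htree := h.tree
  have hord := h.segment.ord
  rw [← hFy.arr (by decide)] at htree
  rw [← hFy.arr (by decide), ← hFy.var (by decide)] at hord
  rw [← hsnx] at hsn hedge
  simp only [Runs, wp_seq, wp_assign, eval, WState.set_var, reduceCtorEq, if_false]
  obtain ⟨d, hd, hT⟩ := hC.reach.tree r (h.mem r h.root_mem).2
  -- the path from the initial state to the component
  refine (runs_upPath (I := I) (b := 0) (S := fun _ => True) (r := I.ini) (s := r) (d := d)
    (w := []) (hC.matrix.congr (by simp)) (by simp [hC.reach.ini]) (by simp [hroot]) ⟨by simp, by simp⟩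
    (by simpa using hT)).wp ?_
  rintro t z ht hFz ⟨u, hu, hw, hP⟩
  have hvar : ∀ v ∉ [Var.pos, .y, .r, .e, .s, .np], z.var v = y.var v := by
    intro v hv
    have hv' : v ∉ (upPath 0).vars := by revert hv; cases v <;> decide
    rw [hFz.var hv']
    simp only [List.mem_cons, List.not_mem_nil, or_false, not_or] at hv
    simp [hv]
  have harr : ∀ a ≠ Arr.out, z.arr a = y.arr a := by
    intro a ha
    rw [hFz.arr (by simpa [upPath, arrs] using ha)]
    rfl
  clear hFz
  rw [List.nil_append] at hw
  have hmat := hC.matrix.ne_zero_iff (h.mem r h.root_mem).1 (h.mem _ hsn).1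
  have hm2 := (hC.matrix r (h.mem r h.root_mem).1 _ (h.mem _ hsn).1).2 (hmat.2 hedge)
  simp only [wp_seq, wp_assign, wp_store, eval, WState.set_var, WState.set_arr, WState.put_var,
    reduceCtorEq, if_false, hvar .root (by decide), hroot, hvar .sn (by decide), hw.pos,
    harr .mat (by decide)]
  -- the first edge of the cycle, and the path back to the root
  obtain ⟨d', hd', hT'⟩ := htree _ hsn
  set a := y.arr .mat r (y.var .sn) - 1 with ha
  refine (runs_downPath (I := I) (S := (· ∈ N)) (r := r) (s := y.var .sn) (d := d') (w := u ++ [a])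
    ?_ (by simp) (by simp) ?_ ?_).wp ?_
  · exact hC.matrix.congr (by simp [harr .mat (by decide)])
  · exact (hw.put a _ rfl).congr (by simp) (by simp [WState.put])
  · simpa [harr (.par 2) (by decide)] using hT'
  rintro t' w ht' hFw ⟨l, hl, hwl, hPl⟩
  have hwvar : ∀ v ∉ [Var.pos, .y, .r, .e, .s, .np, .lenU], w.var v = y.var v := by
    intro v hv
    simp only [List.mem_cons, List.not_mem_nil, or_false, not_or] at hv
    rw [hFw.var (by simp [downPath, WProg.vars, hv])]
    simp [hv, hvar]
  have hwarr : ∀ a ≠ Arr.out, w.arr a = y.arr a := by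
    intro a ha
    rw [hFw.arr (by simpa [downPath, arrs] using ha)]
    simp [ha, harr]
  have hwr : w.var .r = r := by rw [hFw.var (by decide)]; simp
  have hwU : w.var .lenU = u.length := by rw [hFw.var (by decide)]; simp
  clear hFw hvar harr
  simp only [wp_assign, wp_seq, eval]
  generalize hst : y.var .start = st
  rw [hst] at hord
  rw [hwvar _ (by decide), hst]
  -- for each state of the component, a path to this state and back
  refine (runs_upFrom (T := N.length * (11 * I.V + 10 + 2) + 1) (N := st + N.length) (k₀ := st)
    (b := 11 * I.V + 10) (by decide) (by decide)
    (by decide) (by simp [hwvar Var.fin (by decide), hy.fin, hst]) (by simp) (by omega)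
    (Q := fun z => ∃ v, v ≠ [] ∧ Written (u ++ v) z ∧ I.Path (· ∈ N) r v r ∧
      v.length ≤ I.V + N.length * (2 * I.V) ∧ ∀ s ∈ N, I.Visits r v s)
    (fun k z => ∃ v, v ≠ [] ∧ Written (u ++ v) z ∧ I.Path (· ∈ N) r v r ∧
      v.length ≤ I.V + (k - st) * (2 * I.V) ∧ ∀ s ∈ N.take (k - st), I.Visits r v s) ?_ ?_ ?_
    (by rw [Nat.add_sub_cancel_left])).wp ?_
  · refine ⟨a :: l, by simp, ?_, ⟨h.root_mem, hm2.1, by rwa [hm2.2]⟩, by simp; omega, by simp⟩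
    rw [List.append_assoc] at hwl
    exact hwl.congr (by simp) (by simp)
  · rintro k z hk hkN hzk hFz ⟨v, hv, hwv, hPv, hlv, hvis⟩
    obtain ⟨j, rfl⟩ : ∃ j, k = st + j := ⟨k - st, by omega⟩
    have hj : j < N.length := by omega
    have hz2 : z.arr (.ord 2) = y.arr (.ord 2) := by
      rw [hFz.arr (by decide)]; exact hwarr _ (by decide)
    have hz3 : z.arr (.par 2) = y.arr (.par 2) := by
      rw [hFz.arr (by decide)]; exact hwarr _ (by decide)
    have hz4 : z.arr (.par 1) = y.arr (.par 1) := by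
      rw [hFz.arr (by decide)]; exact hwarr _ (by decide)
    have hz5 : z.arr .mat = y.arr .mat := by
      rw [hFz.arr (by decide)]; exact hwarr _ (by decide)
    have hz6 : z.var .r = r := by
      rw [hFz.var (by decide)]; simpa using hwr
    obtain ⟨d₁, hd₁, hT₁⟩ := hy.tree N[j] (List.getElem_mem hj)
    obtain ⟨d₂, hd₂, hT₂⟩ := htree N[j] (List.getElem_mem hj)
    simp only [Runs, wp_seq, wp_assign, eval, hzk, hz2, hord j hj]
    refine (runs_upPath (I := I) (b := 1) (S := (· ∈ N)) (r := r) (s := N[j]) (d := d₁)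
      (w := u ++ v) (hC.matrix.congr (by simp [hz5])) (by simp [hz6]) (by simp)
      (hwv.congr (by simp) (by simp)) (by simpa [hz4] using hT₁)).wp ?_
    rintro t₁ z₁ ht₁ hF₁ ⟨l₁, hl₁, hw₁, hP₁⟩
    simp only [wp_seq, wp_assign, eval, hF₁.var (show Var.y ∉ _ by decide), WState.set_var, if_true]
    refine (runs_downPath (I := I) (S := (· ∈ N)) (r := r) (s := N[j]) (d := d₂)
      (w := u ++ v ++ l₁) (hC.matrix.congr ?_) ?_ (by simp)
      (hw₁.congr (by simp) (by simp)) ?_).wp ?_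
    · rw [WState.set_arr, hF₁.arr (by decide)]; simp [hz5]
    · simp [hF₁.var (show Var.r ∉ _ by decide), hz6]
    · rw [WState.set_arr, hF₁.arr (by decide)]; simpa [hz3] using hT₂
    rintro t₂ z₂ ht₂ - ⟨l₂, hl₂, hw₂, hP₂⟩
    refine ⟨by omega, v ++ (l₁ ++ l₂), by simp [hv], ?_, hPv.append (hP₁.append hP₂), ?_, ?_⟩
    · simp only [List.append_assoc] at hw₂ ⊢
      exact hw₂.congr (by simp) (by simp)
    · rw [show st + j + 1 - st = (st + j - st) + 1 by omega, add_mul]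
      simp only [List.length_append]; omega
    · rw [show st + j + 1 - st = j + 1 by omega, List.take_succ_eq_append_getElem hj]
      rw [show st + j - st = j by omega] at hvis
      intro s hs
      rcases List.mem_append.1 hs with hs | hs
      · exact (hvis s hs).append _
      · rw [List.mem_singleton.1 hs]
        refine ⟨v ++ l₁, by rw [← List.append_assoc]; exact List.prefix_append _ _, ?_⟩
        rw [List.foldl_append, hPv.foldl_eq, hP₁.foldl_eq]
  · rintro z - - h
    rwa [Nat.add_sub_cancel_left, List.take_length] at h
  rintro t'' z ht'' hFz ⟨v, hv, hwv, hPv, hlv, hvis⟩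
  have hzU : z.var .lenU = u.length := by rw [hFz.var (by decide)]; simpa using hwU
  have e2 : N.length * (11 * I.V + 10 + 2) ≤ I.V * (11 * I.V + 10 + 2) := Nat.mul_le_mul_right _ hNV
  have e3 : I.V * (11 * I.V + 10 + 2) = 11 * (I.V * I.V) + 12 * I.V := by ring
  have e4 : N.length * (2 * I.V) ≤ I.V * (2 * I.V) := Nat.mul_le_mul_right _ hNV
  have e5 : I.V * (2 * I.V) = 2 * (I.V * I.V) := by ring
  have e6 : 1 * 1 ≤ I.V * I.V := Nat.mul_le_mul hV0 hV0
  rw [wp_assign]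
  refine ⟨by omega, u, v, witness_of_path hv h (by simp [hzU]) ?_ ?_ (by omega) hP hPv hvis⟩
  · simp [eval, hwv.pos, hzU]
  · simpa using hwv.out

end Prog

/-! ### The decision procedure -/

namespace Prog

open WExpr WProg Relation

variable {inp : List ℕ} {I : Inst} {x y : St} {P : Pr}

/-- The answer to the question whether no word refutes the inclusion. -/
def Answer (I : Inst) (x : St) : Prop :=
  x.var .ans = 1 ∧ (∀ w, ¬ I.Bad w) ∨ x.var .ans = 0 ∧ ∃ u v, Witness I u v x

/-- The two summands of the running time. -/
def decideTime (I : Inst) : ℕ :=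
  I.f1 * I.f2 * (I.V * I.V) * I.n2 + I.A * I.f1 * (I.V * I.V)

/-- The factor `600` absorbs the constants of all phases; `0 < I.A` and `0 < I.f1` are needed
because otherwise the time bound may vanish. -/
theorem runs_decide (hL : Loaded I x) (hA : 0 < I.A) (hf : 0 < I.f1) :
    Runs inp decide x (600 * decideTime I) (Answer I) := by
  unfold Prog.decide
  have hT : 13 * I.V + ((15 * (I.V * I.V) + 3 * (I.A * I.V)) + ((I.f2 * (I.n2 * 9 + 5) + 8) +
      ((9 * ((I.V + 1) * I.V) + 4 * I.V + 15) +
        (searchTime I + (100 * (I.V * I.V) + 2))))) ≤ 600 * decideTime I := by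
    have hV := I.V_pos
    have hn := I.n2_pos
    have hn2 : I.n2 ≤ I.V := Nat.le_mul_of_pos_left _ I.n1_pos
    have hVV : I.V ≤ I.V * I.V := Nat.le_mul_of_pos_left _ hV
    have hAf : 1 * (I.V * I.V) ≤ (I.A * I.f1) * (I.V * I.V) :=
      Nat.mul_le_mul_right _ (Nat.mul_pos hA hf)
    have hA1 : I.A * I.V ≤ I.A * I.f1 * (I.V * I.V) :=
      Nat.mul_le_mul (Nat.le_mul_of_pos_right _ hf) hVV
    have hf1 : I.f1 * (I.V * I.V) ≤ I.A * I.f1 * (I.V * I.V) :=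
      Nat.mul_le_mul_right _ (Nat.le_mul_of_pos_left _ hA)
    have h2 : I.f2 * I.n2 ≤ I.f1 * I.f2 * (I.V * I.V) * I.n2 :=
      Nat.mul_le_mul_right _ ((Nat.le_mul_of_pos_left _ hf).trans
        (Nat.le_mul_of_pos_right _ (by omega)))
    have h3 : I.f2 * (I.n2 * 9 + 5) ≤ I.f2 * (I.n2 * 14) := Nat.mul_le_mul_left _ (by omega)
    have h4 : I.f2 * (I.n2 * 14) = 14 * (I.f2 * I.n2) := by ring
    have h5 : (I.V + 1) * I.V = I.V * I.V + I.V := by ring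
    have h6 : searchTime I ≤
        I.f1 * (130 * (I.V * I.V) + I.f2 * (I.n2 * (133 * (I.V * I.V)))) + 3 := by
      refine Nat.add_le_add_right (Nat.mul_le_mul_left _ (Nat.add_le_add (by omega)
        (Nat.mul_le_mul_left _ ?_))) _
      have : I.n2 * (3 * I.n2 + 4 + 120 * (I.V * I.V) + 2) ≤ I.n2 * (129 * (I.V * I.V)) :=
        Nat.mul_le_mul_left _ (by omega)
      have h7 : I.n2 * (133 * (I.V * I.V)) =
          I.n2 * (129 * (I.V * I.V)) + 4 * (I.n2 * (I.V * I.V)) := by ring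
      have h8 : 1 * 1 ≤ I.n2 * (I.V * I.V) := Nat.mul_le_mul hn (by omega)
      omega
    have h9 : I.f1 * (130 * (I.V * I.V) + I.f2 * (I.n2 * (133 * (I.V * I.V)))) =
        130 * (I.f1 * (I.V * I.V)) + 133 * (I.f1 * I.f2 * (I.V * I.V) * I.n2) := by ring
    unfold decideTime
    omega
  refine (runs_numbering hL).seq ?_ hT
  intro y hFy hy
  replace hL := hL.frame hFy (by decide) (by decide)
  refine (runs_matrix hL hy).seq ?_ le_rfl
  intro z hFz hM
  replace hL := hL.frame hFz (by decide) (by decide)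
  replace hy := hy.frame hFz (by decide) (by decide)
  refine (runs_trie hL).seq ?_ le_rfl
  intro u hFu hT
  replace hL := hL.frame hFu (by decide) (by decide)
  replace hy := hy.frame hFu (by decide) (by decide)
  replace hM := hM.frame hFu (by decide)
  refine (runs_reach hL hy hM).seq ?_ le_rfl
  intro v hFv hR
  have hC : Ctx I v := ⟨hL.frame hFv (by decide) (by decide), hy.frame hFv (by decide) (by decide),
    hM.frame hFv (by decide), hT.frame hFv (by decide), hR⟩
  refine (runs_search hC).seq ?_ le_rfl
  intro w hFw hw
  replace hC := hC.frame hFw (by decide) (by decide)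
  simp only [Runs, wp_ite, wp_seq, wp_assign, eval]
  refine ⟨fun hne => ?_, fun h0 => ?_⟩
  · rcases hw with ⟨h, -⟩ | ⟨-, N, r, f, h⟩
    · exact absurd h hne
    · refine (runs_extract hC h).wp ?_
      rintro t a ht - ⟨p, q, h1, h2, h3, h4, h5, h6⟩
      rw [wp_assign]
      exact ⟨by omega, .inr ⟨by simp [eval], p, q, h1, by simpa using h2, by simpa using h3,
        by simpa using h4, h5, h6⟩⟩
  · rcases hw with ⟨-, h⟩ | ⟨h, -⟩
    · exact ⟨by omega, .inl ⟨by simp, h⟩⟩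
    · exact absurd h0 h

end Prog

/-! ### Reading the input -/

namespace Prog

open WExpr WProg Relation

variable {inp : List ℕ} {I : Inst} {x y : St} {P : Pr}

/-- The table `T` with `n` rows and `m` columns stands in the input from position `p` on. -/
def TableAt (inp : List ℕ) (p n m : ℕ) (T : ℕ → ℕ → ℕ) : Prop :=
  ∀ i < n, ∀ j < m, inp[p + (i * m + j)]? = some (T i j)

/-- An acceptor stands in the input from position `p` on. -/
structure AcceptorAt (inp : List ℕ) (p A n f i : ℕ) (d m : ℕ → ℕ → ℕ) : Prop where
  start : inp[p]? = some i
  step : TableAt inp (p + 1) n A d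
  memb : TableAt inp (p + 1 + n * A) f n m

/-- The auxiliary variables for reading. -/
abbrev readVars : List Var := [.row, .col, .tmp, .p]

theorem runs_loadTable {rows cols : Var} {a : Arr} {p n m : ℕ} {T : ℕ → ℕ → ℕ}
    (hr : rows ∉ readVars) (hc : cols ∉ readVars) (hT : TableAt inp p n m T) (hp : x.var .p = p)
    (hn : x.var rows = n) (hm : x.var cols = m) :
    Runs inp (loadTable rows cols a) x (n * (m * 5 + 4) + 2) fun y =>
      y.var .p = p + n * m ∧ ∀ i < n, ∀ j < m, y.arr a i j = T i j := by
  simp only [readVars, List.mem_cons, List.not_mem_nil, or_false, not_or] at hr hc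
  have hr' : rows ∉ (loadTable rows cols a).vars := by
    simp [loadTable, upTo, upFrom, WProg.vars, hr]
  have hc' : cols ∉ (loadTable rows cols a).vars := by
    simp [loadTable, upTo, upFrom, WProg.vars, hc]
  have hc'' : cols ∉ (upTo .col cols
      (.read .tmp (.var .p) ;; .store a (.var .row) (.var .col) (.var .tmp) ;; inc .p)).vars := by
    simp [upTo, upFrom, WProg.vars, hc]
  unfold loadTable at *
  refine runs_upTo (N := n) (b := m * 5 + 2) (by simp [upTo, upFrom, WProg.vars])
    (by simp [upTo, upFrom, WProg.vars, hr]) hr.1 hn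
    (fun k z => z.var .p = p + k * m ∧ ∀ i < k, ∀ j < m, z.arr a i j = T i j) (by simp [hp]) ?_
    (fun _ _ _ h => h) le_rfl
  rintro k y hk hyk hF ⟨hyp, hy⟩
  refine runs_upTo (N := m) (b := 3) (by simp [WProg.vars])
    (by simp [WProg.vars, hc]) hc.2.1 ((hF.var hc').trans hm)
    (fun l z => z.var .p = p + (k * m + l) ∧ (∀ i < k, ∀ j < m, z.arr a i j = T i j) ∧
      ∀ j < l, z.arr a k j = T k j) ⟨by simpa using hyp, by simpa using hy, by simp⟩ ?_ ?_ le_rfl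
  · rintro l z hl hzl hFz ⟨hzp, hz, hz'⟩
    have hzk : z.var .row = k := by
      rw [hFz.var (by simp [upTo, upFrom, WProg.vars])]; exact hyk
    obtain ⟨hlen, hget⟩ := List.getElem?_eq_some_iff.1 (hT k hk l hl)
    simp only [Runs, wp_seq, wp_read, wp_store, wp_assign, eval, hzp, WState.set_var,
      WState.set_arr, WState.put_var, reduceCtorEq, if_false, if_true, hget, hzk, hzl]
    refine ⟨hlen, le_rfl, by ring, fun i hi j hj => ?_, fun j hj => ?_⟩
    · simpa [show i ≠ k by omega] using hz i hi j hj
    · by_cases hjl : j = l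
      · simp [hjl]
      · simpa [hjl] using hz' j (by omega)
  · rintro z - - ⟨h1, h2, h3⟩
    refine ⟨by simp [h1]; ring, fun i hi j hj => ?_⟩
    rcases Nat.lt_succ_iff_lt_or_eq.1 hi with hi | rfl
    · simpa using h2 i hi j hj
    · simpa using h3 j hj

theorem runs_loadAcceptor {vn vf vi : Var} {st mb : Arr} {p kA kn kf ki : ℕ} {d m : ℕ → ℕ → ℕ}
    (hn : vn ∉ readVars) (hf : vf ∉ readVars) (hi : vi ∉ readVars)
    (hiA : vi ≠ .A) (hin : vi ≠ vn) (hif : vi ≠ vf) (hsm : st ≠ mb)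
    (h : AcceptorAt inp p kA kn kf ki d m) (hp : x.var .p = p)
    (hxA : x.var .A = kA) (hxn : x.var vn = kn) (hxf : x.var vf = kf) :
    Runs inp (loadAcceptor vn vf vi st mb) x (kn * (kA * 5 + 4) + kf * (kn * 5 + 4) + 6) fun y =>
      y.var .p = p + 1 + kn * kA + kf * kn ∧ y.var vi = ki ∧
      (∀ q < kn, ∀ a < kA, y.arr st q a = d q a) ∧ ∀ g < kf, ∀ q < kn, y.arr mb g q = m g q := by
  have hn' := hn
  have hf' := hf
  have hi' := hi
  simp only [readVars, List.mem_cons, List.not_mem_nil, or_false, not_or] at hn' hf' hi'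
  obtain ⟨hlen, hget⟩ := List.getElem?_eq_some_iff.1 h.start
  simp only [loadAcceptor, Runs, wp_seq, wp_read, wp_assign, eval, hp, WState.set_var, hget,
    Ne.symm hi'.2.2.2, if_false]
  refine ⟨hlen, ?_⟩
  refine (runs_loadTable (a := st) hn (by decide) h.step (by simp) (by simp [hn', hin.symm, hxn])
    (by simp [hiA.symm, hxA])).wp ?_
  rintro t y ht hF ⟨hyp, hy⟩
  have key : ∀ v ∉ readVars, v ∉ (loadTable vn .A st).vars := by
    intro v hv
    simp only [readVars, List.mem_cons, List.not_mem_nil, or_false, not_or] at hv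
    simp [loadTable, upTo, upFrom, WProg.vars, hv]
  have key' : ∀ v ∉ readVars, v ∉ (loadTable vf vn mb).vars := by
    intro v hv
    simp only [readVars, List.mem_cons, List.not_mem_nil, or_false, not_or] at hv
    simp [loadTable, upTo, upFrom, WProg.vars, hv]
  refine (runs_loadTable (a := mb) hf hn h.memb hyp
    (by rw [hF.var (key _ hf)]; simp [hf', hif.symm, hxf])
    (by rw [hF.var (key _ hn)]; simp [hn', hin.symm, hxn])).wp ?_
  rintro t' z ht' hFz ⟨hzp, hz⟩
  refine ⟨by omega, hzp, ?_, ?_, hz⟩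
  · rw [hFz.var (key' _ hi), hF.var (key _ hi)]
    simp [hi']
  · rwa [hFz.arr (by simp [loadTable, upTo, upFrom, WProg.arrs, hsm])]

/-- The two acceptors stand in the input, in opposite order if `sw` holds. -/
structure InputRep (inp : List ℕ) (sw : Bool) (I : Inst) : Prop where
  A : inp[0]? = some I.A
  n1 : inp[if sw then 2 else 1]? = some I.n1
  n2 : inp[if sw then 1 else 2]? = some I.n2
  f1 : inp[if sw then 4 else 3]? = some I.f1
  f2 : inp[if sw then 3 else 4]? = some I.f2
  acc1 : AcceptorAt inp (if sw then 5 + 1 + I.n2 * I.A + I.f2 * I.n2 else 5)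
    I.A I.n1 I.f1 I.i1 I.d1 I.m1
  acc2 : AcceptorAt inp (if sw then 5 else 5 + 1 + I.n1 * I.A + I.f1 * I.n1)
    I.A I.n2 I.f2 I.i2 I.d2 I.m2

/-- The parameters stand in the variables. -/
def Params (I : Inst) (x : St) : Prop :=
  x.var .A = I.A ∧ x.var .n1 = I.n1 ∧ x.var .n2 = I.n2 ∧ x.var .f1 = I.f1 ∧ x.var .f2 = I.f2

theorem runs_loadParams {sw : Bool} (h : InputRep inp sw I) :
    Runs inp (loadParams sw) x 5 (Params I) := by
  obtain ⟨h1, h2, h3, h4, h5, -, -⟩ := h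
  cases sw <;> simp only [Bool.false_eq_true, if_false, if_true] at h2 h3 h4 h5 <;>
  · obtain ⟨l1, g1⟩ := List.getElem?_eq_some_iff.1 h1
    obtain ⟨l2, g2⟩ := List.getElem?_eq_some_iff.1 h2
    obtain ⟨l3, g3⟩ := List.getElem?_eq_some_iff.1 h3
    obtain ⟨l4, g4⟩ := List.getElem?_eq_some_iff.1 h4
    obtain ⟨l5, g5⟩ := List.getElem?_eq_some_iff.1 h5
    simp [loadParams, Runs, wp_seq, wp_read, eval, Params, *]

/-- The time for reading two acceptors. -/
def loadTime (I : Inst) : ℕ :=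
  1 + (I.n1 * (I.A * 5 + 4) + I.f1 * (I.n1 * 5 + 4) + 6) +
    (I.n2 * (I.A * 5 + 4) + I.f2 * (I.n2 * 5 + 4) + 6)

theorem runs_loadBoth {sw : Bool} (h : InputRep inp sw I) (hx : Params I x) :
    Runs inp (loadBoth sw) x (loadTime I) (Loaded I) := by
  obtain ⟨hA, hn1, hn2, hf1, hf2⟩ := hx
  obtain ⟨-, -, -, -, -, h1, h2⟩ := h
  unfold loadBoth
  refine Runs.seq (T₁ := 1) (T₂ := loadTime I - 1) (Q := fun y => y.var .p = 5) ?_ ?_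
    (by unfold loadTime; omega)
  · simp [Runs, wp_assign, eval]
  intro y hF hy
  rw [← hF.var (by decide)] at hA hn1 hn2 hf1 hf2
  cases sw <;> simp only [Bool.false_eq_true, if_false, if_true] at h1 h2 ⊢
  · refine (runs_loadAcceptor (by decide) (by decide) (by decide) (by decide) (by decide)
      (by decide) (by decide) h1 hy hA hn1 hf1).seq ?_
      (T₂ := I.n2 * (I.A * 5 + 4) + I.f2 * (I.n2 * 5 + 4) + 6) (by unfold loadTime; omega)
    rintro z hFz ⟨z1, z2, z3, z4⟩
    rw [← hFz.var (by decide)] at hA hn1 hn2 hf1 hf2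
    refine (runs_loadAcceptor (by decide) (by decide) (by decide) (by decide) (by decide)
      (by decide) (by decide) h2 z1 hA hn2 hf2).mono le_rfl ?_
    rintro u hFu ⟨-, u2, u3, u4⟩
    rw [← hFu.var (by decide)] at hA hn1 hn2 hf1 hf2 z2
    rw [← hFu.arr (by decide)] at z3 z4
    exact ⟨hA, hn1, hn2, hf1, hf2, z2, u2, z3, u3, z4, u4⟩
  · refine (runs_loadAcceptor (by decide) (by decide) (by decide) (by decide) (by decide)
      (by decide) (by decide) h2 hy hA hn2 hf2).seq ?_
      (T₂ := I.n1 * (I.A * 5 + 4) + I.f1 * (I.n1 * 5 + 4) + 6) (by unfold loadTime; omega)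
    rintro z hFz ⟨z1, z2, z3, z4⟩
    rw [← hFz.var (by decide)] at hA hn1 hn2 hf1 hf2
    refine (runs_loadAcceptor (by decide) (by decide) (by decide) (by decide) (by decide)
      (by decide) (by decide) h1 z1 hA hn1 hf1).mono le_rfl ?_
    rintro u hFu ⟨-, u2, u3, u4⟩
    rw [← hFu.var (by decide)] at hA hn1 hn2 hf1 hf2 z2
    rw [← hFu.arr (by decide)] at z3 z4
    exact ⟨hA, hn1, hn2, hf1, hf2, u2, z2, u3, z3, u4, z4⟩

/-- If there are no letters, or no final state sets of the first acceptor, then the inclusion holds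
trivially, and the time bound does not permit reading the tables. -/
theorem runs_inclusion {sw : Bool} (h : InputRep inp sw I) :
    Runs inp (inclusion sw) x (700 * (decideTime I + 1)) (Answer I) := by
  unfold inclusion
  refine (runs_loadParams h).seq (T₂ := 700 * (decideTime I + 1) - 5) ?_ (by omega)
  intro y hF hy
  obtain ⟨hA, -, -, hf1, -⟩ := id hy
  simp only [Runs, wp_ite, wp_assign, eval, hA, hf1]
  refine ⟨fun hne => ?_, fun h0 => ⟨by omega, .inl ⟨by simp, fun w hw => ?_⟩⟩⟩
  · have hA0 : 0 < I.A := by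
      rcases Nat.eq_zero_or_pos I.A with h | h
      · simp [h] at hne
      · exact h
    have hf0 : 0 < I.f1 := by
      rcases Nat.eq_zero_or_pos I.f1 with h | h
      · simp [h] at hne
      · exact h
    rw [wp_seq]
    refine (runs_loadBoth h hy).wp fun t z ht _ hz => ?_
    refine (runs_decide hz hA0 hf0).wp fun t' u ht' _ hu => ⟨?_, hu⟩
    have hT : loadTime I ≤ 50 * decideTime I + 50 := by
      have hV := I.V_pos
      have hn := I.n2_pos
      have hn1 : I.n1 ≤ I.V := Nat.le_mul_of_pos_right _ I.n2_pos
      have hn2 : I.n2 ≤ I.V := Nat.le_mul_of_pos_left _ I.n1_pos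
      have hVV : I.V ≤ I.V * I.V := Nat.le_mul_of_pos_left _ hV
      have h1 : I.A * I.V ≤ I.A * I.f1 * (I.V * I.V) :=
        Nat.mul_le_mul (Nat.le_mul_of_pos_right _ hf0) hVV
      have h2 : I.f1 * I.V ≤ I.A * I.f1 * (I.V * I.V) :=
        Nat.mul_le_mul (Nat.le_mul_of_pos_left _ hA0) hVV
      have h3 : I.f2 * I.n2 ≤ I.f1 * I.f2 * (I.V * I.V) * I.n2 :=
        Nat.mul_le_mul_right _ ((Nat.le_mul_of_pos_left _ hf0).trans
          (Nat.le_mul_of_pos_right _ (by omega)))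
      have h4 : I.n1 * (I.A * 5 + 4) ≤ I.V * (I.A * 9) := Nat.mul_le_mul hn1 (by omega)
      have h5 : I.n2 * (I.A * 5 + 4) ≤ I.V * (I.A * 9) := Nat.mul_le_mul hn2 (by omega)
      have h6 : I.f1 * (I.n1 * 5 + 4) ≤ I.f1 * (9 * I.V) := Nat.mul_le_mul_left _ (by omega)
      have h7 : I.f2 * (I.n2 * 5 + 4) ≤ I.f2 * (9 * I.n2) := Nat.mul_le_mul_left _ (by omega)
      have e1 : I.V * (I.A * 9) = 9 * (I.A * I.V) := by ring
      have e2 : I.f1 * (9 * I.V) = 9 * (I.f1 * I.V) := by ring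
      have e3 : I.f2 * (9 * I.n2) = 9 * (I.f2 * I.n2) := by ring
      unfold loadTime decideTime
      omega
    omega
  · obtain ⟨hw, ⟨f, hf, -⟩, -⟩ := hw
    have := hw 0
    omega

theorem runs_equivalence {I' : Inst} (h : InputRep inp false I) (h' : InputRep inp true I') :
    Runs inp equivalence x (700 * (decideTime I + decideTime I' + 3)) fun y =>
      y.var .ans = 1 ∧ (∀ w, ¬ I.Bad w) ∧ (∀ w, ¬ I'.Bad w) ∨
      y.var .ans = 0 ∧ ((∃ u v, Witness I u v y) ∨ ∃ u v, Witness I' u v y) := by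
  unfold equivalence
  refine (runs_inclusion h).seq (T₂ := 700 * (decideTime I' + 1) + 2) ?_ (by omega)
  intro y _ hy
  simp only [Runs, wp_ite, wp_skip, eval]
  rcases hy with ⟨ha, hy⟩ | ⟨ha, hy⟩
  · refine ⟨fun _ => ?_, fun h0 => absurd (ha.symm.trans h0) one_ne_zero⟩
    refine (runs_inclusion h').wp ?_
    rintro t z ht - hz
    refine ⟨ht.trans (by rw [zero_add, add_comm]; exact Nat.add_le_add_left one_le_two _), ?_⟩
    rcases hz with ⟨hz, hz'⟩ | ⟨hz, hz'⟩
    · exact .inl ⟨hz, hy, hz'⟩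
    · exact .inr ⟨hz, .inr hz'⟩
  · exact ⟨fun h => absurd ha h, fun _ => ⟨by omega, .inr ⟨ha, .inl hy⟩⟩⟩

end Prog

/-! ### The machine program -/

namespace Prog

open RAMProgram

/-- Add the input word number `k` to register `0`. -/
def addParam (k : ℕ) : RAMProgram :=
  .seq (.instr (.const 2 k)) (.seq (.instr (.load 4 2)) (.instr (.arith .add 0 0 4)))

/-- Compute the base address of the arrays from the five parameters. -/
def prelude : RAMProgram :=
  .seq (.instr (.const 0 3)) <| .seq (addParam 0) <| .seq (addParam 1) <| .seq (addParam 2) <|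
  .seq (addParam 3) <| .seq (addParam 4) (.instr (.arith .mul 0 0 0))

/-- The register for a variable. -/
abbrev regOf (v : Var) : ℕ := 2 * layout.varCode v + 1

/-- Set register `r` to the address of entry number `reg 4` of the array `out`. -/
def outAddr (r : ℕ) : RAMProgram :=
  .seq (.instr (.arith .mul r 4 4)) <| .seq (.instr (.arith .add r r 4)) <|
  .seq (.instr (.const 8 24)) <|
  .seq (.instr (.arith .mul r 8 r)) <| .seq (.instr (.arith .add r 0 r)) <|
  .seq (.instr (.const 8 14)) (.instr (.arith .add r r 8))

/-- Copy the first `reg 4` entries of the array `out` to consecutive addresses from `reg 6` on. -/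
def copyLoop : RAMProgram :=
  .loop 4 <| .seq (.instr (.const 8 1)) <| .seq (.instr (.arith .sub 4 4 8)) <|
    .seq (outAddr 10) <| .seq (.instr (.load 12 10)) <|
    .seq (.instr (.arith .add 10 6 4)) (.instr (.store 10 12))

/-- Move the result to the prescribed registers, and the words of a counterexample to consecutive
addresses above all entries of the array `out` that are in use. -/
def postlude : RAMProgram :=
  .cond (regOf .ans) (.instr (.const 0 1)) <|
    .seq (.instr (.arith .add 4 (regOf .lenU) (regOf .lenV))) <| .seq (outAddr 6) <|
    .seq copyLoop <| .seq (.instr (.const 0 0)) <|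
    .seq (.instr (.arith .add 1 0 (regOf .lenU))) <|
    .seq (.instr (.arith .add 2 0 (regOf .lenV))) (.instr (.arith .add 3 0 6))

/-- The machine program for a program of the while language. -/
def machine (P : Pr) : RAMProgram := .seq prelude (.seq (layout.compile P) postlude)

variable {W t : ℕ} {X : RAMState} {R : ℕ → RAMState → Prop}

theorem wp_addParam {k n : ℕ} (hk : k < W) (hn : X.reg 0 + X.mem k ≤ n) (hW : n < W)
    (h : ∀ Y, Y.mem = X.mem → Y.reg 0 = X.reg 0 + X.mem k →
      (∀ r, r % 2 = 1 → Y.reg r = X.reg r) → R (t + 3) Y) : wp W (addParam k) R t X := by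
  refine wp_seq (wp_const hk (wp_seq (wp_load ?_ (wp_arith ?_ (h _ rfl ?_ fun r hr => ?_)))))
  · simp; omega
  · simp [RAMOp.eval]; omega
  · simp [RAMOp.eval]
  · have h0 : r ≠ 0 := by omega
    have h2 : r ≠ 2 := by omega
    have h4 : r ≠ 4 := by omega
    simp [h0, h2, h4]

theorem wp_prelude {n : ℕ}
    (hn : X.mem 0 + X.mem 1 + X.mem 2 + X.mem 3 + X.mem 4 + 3 = n) (hW : n * n < W)
    (h : ∀ Y, Y.mem = X.mem → Y.reg 0 = n * n →
      (∀ r, r % 2 = 1 → Y.reg r = X.reg r) → R (t + 17) Y) : wp W prelude R t X := by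
  have hnn : n ≤ n * n := Nat.le_mul_of_pos_left _ (by omega)
  have h9 : 3 * 3 ≤ n * n := Nat.mul_le_mul (by omega) (by omega)
  refine wp_seq (wp_const (by omega) (wp_seq (wp_addParam (n := n) (by omega) ?_ (by omega) ?_)))
  · simp; omega
  intro Y₀ (m0 : Y₀.mem = X.mem) b0 r0
  simp only [Function.update_self] at b0
  refine wp_seq (wp_addParam (n := n) (by omega) (by rw [m0, b0]; omega) (by omega) ?_)
  intro Y₁ m1 b1 r1
  rw [m0, b0] at b1
  rw [m0] at m1
  refine wp_seq (wp_addParam (n := n) (by omega) (by rw [m1, b1]; omega) (by omega) ?_)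
  intro Y₂ m2 b2 r2
  rw [m1, b1] at b2
  rw [m1] at m2
  refine wp_seq (wp_addParam (n := n) (by omega) (by rw [m2, b2]; omega) (by omega) ?_)
  intro Y₃ m3 b3 r3
  rw [m2, b2] at b3
  rw [m2] at m3
  refine wp_seq (wp_addParam (n := n) (by omega) (by rw [m3, b3]; omega) (by omega) ?_)
  intro Y₄ m4 b4 r4
  rw [m3, b3] at b4
  rw [m3] at m4
  have hb : Y₄.reg 0 = n := by rw [b4]; omega
  refine wp_arith ?_ (h _ m4 ?_ fun r hr => ?_)
  · simpa [RAMOp.eval, hb] using hW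
  · simp [RAMOp.eval, hb]
  · have h0 : r ≠ 0 := by omega
    simp only [Function.update_of_ne h0]
    rw [r4 r hr, r3 r hr, r2 r hr, r1 r hr, r0 r hr]
    exact Function.update_of_ne h0 _ _

/-- The address of entry number `i` of the array `out`. -/
abbrev outAt (B i : ℕ) : ℕ := layout.addr B .out i 0

theorem outAt_eq (B i : ℕ) : outAt B i = B + 24 * (i * i + i) + 14 := by
  simp only [outAt, Layout.addr, add_zero]
  rfl

theorem outAt_lt {B i j : ℕ} (h : i < j) : outAt B i < outAt B j := by
  have : i * i ≤ j * j := Nat.mul_le_mul h.le h.le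
  rw [outAt_eq, outAt_eq]; omega

theorem wp_outAddr {r i B : ℕ} (hr : r ≠ 0) (hr4 : r ≠ 4) (hr8 : r ≠ 8) (h0 : X.reg 0 = B)
    (h4 : X.reg 4 = i) (hW : outAt B i < W) (hW' : 24 < W)
    (h : ∀ Y, Y.mem = X.mem → Y.reg r = outAt B i →
      (∀ s, s ≠ r → s ≠ 8 → Y.reg s = X.reg s) → R (t + 7) Y) : wp W (outAddr r) R t X := by
  rw [outAt_eq] at hW h
  have e0 := hr.symm
  have e4 := hr4.symm
  have e8 := hr8.symm
  refine wp_seq (wp_arith ?_ (wp_seq (wp_arith ?_ (wp_seq (wp_const ?_ (wp_seq (wp_arith ?_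
    (wp_seq (wp_arith ?_ (wp_seq (wp_const ?_ (wp_arith ?_ (h _ rfl ?_ ?_)))))))))))))
  all_goals try simp [Function.update_apply, RAMOp.eval, *]
  all_goals try omega
  intro s hs hs'
  simp [hs, hs']

/-- The effect of `copyLoop`. -/
theorem exec_copyLoop {B E L : ℕ} (hW' : 24 < W) (hEL : E + L < W) (hE : outAt B L ≤ E) :
    ∀ i ≤ L, ∀ X : RAMState, X.reg 0 = B → X.reg 4 = i → X.reg 6 = E →
    (∀ j < L, X.mem (outAt B j) < W) → ∃ Y, Exec W copyLoop X (13 * i + 1) Y ∧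
      (∀ r, r ≠ 4 → r ≠ 8 → r ≠ 10 → r ≠ 12 → Y.reg r = X.reg r) ∧
      (∀ j < i, Y.mem (E + j) = X.mem (outAt B j)) ∧
      ∀ m, (∀ j < i, m ≠ E + j) → Y.mem m = X.mem m := by
  intro i
  induction i with
  | zero =>
    intro _ X _ h4 _ _
    exact ⟨X, .loopStop h4, by simp, by simp, by simp⟩
  | succ i ih =>
    intro hi X h0 h4 h6 hM
    have hout : outAt B i < E := (outAt_lt (by omega)).trans_le hE
    have hbody : wp W (.seq (.instr (.const 8 1)) <| .seq (.instr (.arith .sub 4 4 8)) <|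
        .seq (outAddr 10) <| .seq (.instr (.load 12 10)) <|
        .seq (.instr (.arith .add 10 6 4)) (.instr (.store 10 12)))
        (fun t' Z => t' = 12 ∧ Z.reg 4 = i ∧
          (∀ r, r ≠ 4 → r ≠ 8 → r ≠ 10 → r ≠ 12 → Z.reg r = X.reg r) ∧
          Z.mem = Function.update X.mem (E + i) (X.mem (outAt B i))) 0 X := by
      refine wp_seq (wp_const (by omega) (wp_seq (wp_arith ?_ (wp_seq (wp_outAddr (i := i) (B := B)
        (by decide) (by decide) (by decide) ?_ ?_ (by omega) hW' ?_)))))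
      · simp [RAMOp.eval, h4]; omega
      · simp [h0]
      · simp [RAMOp.eval, h4]
      intro Z hZm hZ10 hZ
      have hZ4 : Z.reg 4 = i := by
        rw [hZ 4 (by decide) (by decide)]; simp [RAMOp.eval, h4]
      have hZ6 : Z.reg 6 = E := by
        rw [hZ 6 (by decide) (by decide)]; simp [h6]
      refine wp_seq (wp_load ?_ (wp_seq (wp_arith ?_ (wp_store ?_ ⟨rfl, ?_, ?_, ?_⟩))))
      · rw [hZ10, hZm]; exact hM i (by omega)
      · simp [RAMOp.eval, hZ6, hZ4]; omega
      · simp [hZ10, hZm]; exact hM i (by omega)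
      · simp [hZ4]
      · intro r r4 r8 r10 r12
        simp [r10, r12, hZ r r10 r8, r4, r8]
      · simp [RAMOp.eval, hZ6, hZ4, hZ10, hZm]
    obtain ⟨t', Z, hZ, ht', hZ4, hZr, hZm⟩ := hbody
    rw [zero_add] at ht'
    subst ht'
    have hsrc : ∀ j < L, Z.mem (outAt B j) = X.mem (outAt B j) := by
      intro j hj
      have : outAt B j < outAt B L := outAt_lt hj
      rw [hZm, Function.update_of_ne (by omega)]
    obtain ⟨Y, hY, hYr, hY1, hY2⟩ := ih (by omega) Z
      (by rw [hZr 0 (by decide) (by decide) (by decide) (by decide), h0]) hZ4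
      (by rw [hZr 6 (by decide) (by decide) (by decide) (by decide), h6])
      (fun j hj => by rw [hsrc j hj]; exact hM j hj)
    refine ⟨Y, ?_, fun r h1 h2 h3 h4 => (hYr r h1 h2 h3 h4).trans (hZr r h1 h2 h3 h4), ?_, ?_⟩
    · rw [show 13 * (i + 1) + 1 = 12 + (13 * i + 1) + 1 by ring]
      exact .loopStep (by omega) hZ hY
    · intro j hj
      rcases Nat.lt_succ_iff_lt_or_eq.1 hj with hj | rfl
      · rw [hY1 j hj, hsrc j (by omega)]
      · rw [hY2 _ (fun k hk => by omega), hZm, Function.update_self]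
    · intro m hm
      rw [hY2 m (fun j hj => hm j (by omega)), hZm, Function.update_of_ne (hm i (by omega))]

/-- The result of a program, where `Yes` holds for a positive answer, and `No u v` holds for the
two words that come with a negative answer. -/
def Result (Yes : Prop) (No : List ℕ → List ℕ → Prop) (y : St) : Prop :=
  y.var .ans = 1 ∧ Yes ∨ y.var .ans = 0 ∧ ∃ u v, No u v ∧ y.var .lenU = u.length ∧
    y.var .lenV = v.length ∧ ∀ i (h : i < (u ++ v).length), y.arr .out i 0 = (u ++ v)[i]

/-- The result of a program of the machine. -/
def MachineResult (Yes : Prop) (No : List ℕ → List ℕ → Prop) (Y : RAMState) : Prop :=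
  Y.reg 0 = 1 ∧ Yes ∨ Y.reg 0 = 0 ∧ ∃ u v, No u v ∧ Y.reg 1 = u.length ∧
    Y.reg 2 = v.length ∧ ∀ i (h : i < (u ++ v).length), Y.mem (Y.reg 3 + i) = (u ++ v)[i]

theorem exec_postlude {Yes : Prop} {No : List ℕ → List ℕ → Prop} {y : St} {B M D : ℕ}
    {inp : List ℕ} (h : Result Yes No y) (hX : layout.Rep B inp y X) (hy : y.Bounded M)
    (hW : layout.word B (2 * M) ≤ W) (hD : ∀ u v, No u v → u.length + v.length ≤ D) :
    ∃ t Y, Exec W postlude X t Y ∧ t ≤ 13 * D + 14 ∧ MachineResult Yes No Y := by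
  have hK : layout.K = 24 := rfl
  have hans := hX.var .ans
  simp only [Layout.word, hK] at hW
  rcases h with ⟨h1, hYes⟩ | ⟨h0, u, v, hNo, hU, hV, hout⟩
  · refine ⟨2, _, .condTrue (by rw [hans, h1]; decide) (.instr _ _ ?_), by omega, .inl ⟨?_, hYes⟩⟩
    · simp only [RAMInstr.value]; omega
    · simp [RAMInstr.apply, RAMInstr.value]
  set L := u.length + v.length with hL
  have hLD : L ≤ D := hD u v hNo
  have hLM : L ≤ 2 * M := by
    have := hy.1 .lenU
    have := hy.1 .lenV
    omega
  have hLL : L * L ≤ 2 * (2 * M) * (2 * (2 * M)) := Nat.mul_le_mul (by omega) (by omega)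
  have hBL := outAt_eq B L
  have hUX : X.reg (regOf .lenU) = u.length := (hX.var .lenU).trans hU
  have hVX : X.reg (regOf .lenV) = v.length := (hX.var .lenV).trans hV
  have key : wp W (.seq (.instr (.arith .add 4 (regOf .lenU) (regOf .lenV))) <|
      .seq (outAddr 6) <| .seq copyLoop <| .seq (.instr (.const 0 0)) <|
      .seq (.instr (.arith .add 1 0 (regOf .lenU))) <|
      .seq (.instr (.arith .add 2 0 (regOf .lenV))) (.instr (.arith .add 3 0 6)))
      (fun t Y => t = 13 * L + 13 ∧ MachineResult Yes No Y) 0 X := by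
    refine wp_seq (wp_arith ?_ (wp_seq (wp_outAddr (i := L) (B := B)
        (by decide) (by decide) (by decide) ?_ ?_ (by omega) (by omega) ?_)))
    · simp only [RAMOp.eval, hUX, hVX]; omega
    · simp [hX.base]
    · simp [RAMOp.eval, hUX, hVX, hL]
    intro Z hZm hZ6 hZ
    replace hZm : Z.mem = X.mem := hZm
    have hmem : ∀ j, Z.mem (outAt B j) = y.arr .out j 0 := fun j => by
      rw [hZm]; exact hX.arr .out j 0
    have hZ' : ∀ r, r ≠ 4 → r ≠ 6 → r ≠ 8 → Z.reg r = X.reg r := by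
      intro r h4 h6 h8
      rw [hZ r h6 h8]; simp [h4]
    have hcopy := exec_copyLoop (W := W) (B := B) (E := outAt B L) (L := L) (by omega) (by omega)
      le_rfl L le_rfl Z ((hZ' 0 (by decide) (by decide) (by decide)).trans hX.base)
      (by rw [hZ 4 (by decide) (by decide)]; simp [RAMOp.eval, hUX, hVX, hL]) hZ6
      (fun j _ => by rw [hmem]; have := hy.2 .out j 0; omega)
    obtain ⟨Y, hY, hYr, hY1, -⟩ := hcopy
    have hYU : Y.reg (regOf .lenU) = u.length := by
      rw [hYr _ (by decide) (by decide) (by decide) (by decide),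
        hZ' _ (by decide) (by decide) (by decide), hUX]
    have hYV : Y.reg (regOf .lenV) = v.length := by
      rw [hYr _ (by decide) (by decide) (by decide) (by decide),
        hZ' _ (by decide) (by decide) (by decide), hVX]
    have hY6 : Y.reg 6 = outAt B L := by
      rw [hYr _ (by decide) (by decide) (by decide) (by decide), hZ6]
    refine wp_seq ⟨_, Y, hY, ?_⟩
    have n0U : regOf .lenU ≠ 0 := by decide
    have n1U : regOf .lenU ≠ 1 := by decide
    have n0V : regOf .lenV ≠ 0 := by decide
    have n1V : regOf .lenV ≠ 1 := by decide
    have n2V : regOf .lenV ≠ 2 := by decide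
    refine wp_seq (wp_const (by omega) (wp_seq (wp_arith ?_ (wp_seq (wp_arith ?_ (wp_arith ?_
      ⟨?_, .inr ⟨?_, u, v, hNo, ?_, ?_, fun i hi => ?_⟩⟩))))))
    · simp only [RAMOp.eval, Function.update_self, Function.update_of_ne n0U, hYU]; omega
    · simp only [RAMOp.eval, Function.update_of_ne n1V, Function.update_of_ne n0V, hYV,
        Function.update_of_ne (show (0 : ℕ) ≠ 1 by decide), Function.update_self]; omega
    · simp [RAMOp.eval, hY6]; omega
    · ring
    · simp
    · simp only [RAMOp.eval, ne_eq, OfNat.one_ne_ofNat, not_false_eq_true, Function.update_of_ne,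
        Function.update_self, n0U, hYU, zero_add]
    · simp only [RAMOp.eval, Function.update_of_ne (show (2 : ℕ) ≠ 3 by decide),
        Function.update_self, Function.update_of_ne (show (0 : ℕ) ≠ 1 by decide), zero_add]
      rw [Function.update_of_ne n1V, Function.update_of_ne n0V, hYV]
    · have hi' : i < L := by simpa using hi
      simp [RAMOp.eval, hY6, hY1 i hi', hmem, hout i hi]
  obtain ⟨t, Y, hY, ht, hR⟩ := key
  exact ⟨_, Y, .condFalse (by rw [hans, h0]) hY, by omega, hR⟩

/-- The machine program computes the result of the program `P`. -/
theorem exec_machine {P : Pr} {Yes : Prop} {No : List ℕ → List ℕ → Prop} {n M T D : ℕ}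
    {inp : List ℕ}
    (hn : inp.getD 0 0 + inp.getD 1 0 + inp.getD 2 0 + inp.getD 3 0 + inp.getD 4 0 + 3 = n)
    (hlen : inp.length ≤ n * n) (hM : ∀ k ∈ inp, k ≤ M)
    (hP : WProg.Runs inp P ⟨fun _ => 0, fun _ _ _ => 0⟩ T (Result Yes No))
    (hW : layout.word (n * n) (2 * (M + P.size * T)) ≤ W)
    (hD : ∀ u v, No u v → u.length + v.length ≤ D) :
    ∃ t Y, Exec W (machine P) ⟨fun _ => 0, fun i => inp.getD i 0⟩ t Y ∧
      t ≤ P.size * T + 13 * D + 31 ∧ MachineResult Yes No Y := by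
  obtain ⟨t', y, hE, ht', hy⟩ := hP
  rw [zero_add] at ht'
  have hsT : P.size * t' ≤ P.size * T := Nat.mul_le_mul_left _ ht'
  have hpre : n * n < W := by
    refine lt_of_lt_of_le ?_ hW
    unfold Layout.word; omega
  have key : wp W (machine P) (fun t Y => t ≤ P.size * T + 13 * D + 31 ∧ MachineResult Yes No Y) 0
      ⟨fun _ => 0, fun i => inp.getD i 0⟩ := by
    refine wp_seq (wp_prelude hn hpre fun Y hm h0 hr => wp_seq ?_)
    obtain ⟨hb, hcomp⟩ := layout.exec_compile (B := n * n) (W := W) hM hE le_rfl M le_rfl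
      ⟨by simp, by simp⟩ ((layout.word_mono _ (by omega)).trans hW)
    obtain ⟨t₁, Z, hZ, ht₁, hrep⟩ := hcomp Y ⟨h0, hlen, fun i hi => by
      rw [hm]; exact List.getD_eq_getElem _ _ hi, fun v => by rw [hr _ (by omega)], fun a i j => by
      rw [hm]; exact List.getD_eq_default _ _ (hlen.trans (layout.le_addr _ _ _ _))⟩
    refine ⟨t₁, Z, hZ, ?_⟩
    obtain ⟨t₂, Z', hZ', ht₂, hres⟩ := exec_postlude hy hrep hb
      ((layout.word_mono _ (by omega)).trans hW) hD
    exact ⟨t₂, Z', hZ', by omega, hres⟩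
  obtain ⟨t, Y, hY, ht⟩ := key
  rw [zero_add] at ht
  exact ⟨t, Y, hY, ht⟩

end Prog

/-! ### Presentation of acceptors by tables -/

namespace DMA

variable {A Q : Type*} [Fintype Q] (U : DMA A Q) (state : Q ≃ Fin (Fintype.card Q))
  (final : U.family ≃ Fin U.family.card)

open Classical in
/-- The membership table of the final state sets. -/
noncomputable def membTable (f q : ℕ) : ℕ :=
  if ∃ (hf : f < U.family.card) (hq : q < Fintype.card Q),
    state.symm ⟨q, hq⟩ ∈ (final.symm ⟨f, hf⟩ : Finset Q) then 1 else 0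

theorem membTable_le (f q : ℕ) : U.membTable state final f q ≤ 1 := by
  unfold membTable
  split <;> omega

variable [Fintype A] (letter : A ≃ Fin (Fintype.card A))

/-- The transition table. Entries outside the table are filled with the initial state. -/
def stepTable (q a : ℕ) : ℕ :=
  if h : q < Fintype.card Q ∧ a < Fintype.card A then
    state (U.step (state.symm ⟨q, h.1⟩) (letter.symm ⟨a, h.2⟩))
  else state U.start

theorem stepTable_lt (q a : ℕ) : U.stepTable state letter q a < Fintype.card Q := by
  unfold stepTable
  split <;> exact Fin.isLt _

theorem stepTable_apply (q : Q) (a : A) :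
    U.stepTable state letter (state q) (letter a) = state (U.step q a) := by
  simp [stepTable]

theorem length_encode : (U.encode letter state final).length =
    1 + Fintype.card Q * Fintype.card A + U.family.card * Fintype.card Q := by
  simp only [encode, List.length_append, List.length_ofFn, List.length_singleton]

theorem le_of_mem_encode {k : ℕ} (hk : k ∈ U.encode letter state final) : k ≤ Fintype.card Q := by
  have := (state U.start).isLt
  simp only [encode, List.mem_append, List.mem_singleton, List.mem_ofFn] at hk
  rcases hk with (rfl | ⟨i, rfl⟩) | ⟨i, rfl⟩
  · omega
  · exact (Fin.isLt _).le
  · split <;> omega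

theorem mul_add_lt {i j n m : ℕ} (hi : i < n) (hj : j < m) : i * m + j < n * m := by
  have : (i + 1) * m ≤ n * m := Nat.mul_le_mul_right _ hi
  rw [add_mul] at this
  omega

theorem getElem?_append_of_lt (pre l post : List ℕ) {i : ℕ} (h : i < l.length) :
    (pre ++ (l ++ post))[pre.length + i]? = l[i]? := by
  rw [List.getElem?_append_right (by omega), Nat.add_sub_cancel_left, List.getElem?_append_left h]

open Classical in
theorem acceptorAt_encode (pre post : List ℕ) :
    Prog.AcceptorAt (pre ++ (U.encode letter state final ++ post)) pre.length (Fintype.card A)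
      (Fintype.card Q) U.family.card (state U.start) (U.stepTable state letter)
      (U.membTable state final) where
  start := by
    have := getElem?_append_of_lt pre (U.encode letter state final) post (i := 0)
      (by rw [length_encode]; omega)
    rw [add_zero] at this
    rw [this]
    simp [encode]
  step i hi j hj := by
    have hij := mul_add_lt hi hj
    rw [add_assoc, getElem?_append_of_lt _ _ _ (by rw [length_encode]; omega)]
    simp only [encode]
    rw [List.getElem?_append_left (by simp; omega), List.getElem?_append_right (by simp),
      List.length_singleton, Nat.add_sub_cancel_left, List.getElem?_ofFn, dif_pos hij]
    have h1 : (Fin.divNat ⟨i * Fintype.card A + j, hij⟩ : Fin (Fintype.card Q)) = ⟨i, hi⟩ := by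
      ext
      simp only [Fin.divNat, Fin.val_mk]
      rw [mul_comm, Nat.mul_add_div (by omega), Nat.div_eq_of_lt hj, add_zero]
    have h2 : (Fin.modNat ⟨i * Fintype.card A + j, hij⟩ : Fin (Fintype.card A)) = ⟨j, hj⟩ := by
      ext
      simp only [Fin.modNat, Fin.val_mk]
      rw [mul_comm, Nat.mul_add_mod, Nat.mod_eq_of_lt hj]
    simp [stepTable, hi, hj, h1, h2]
  memb i hi j hj := by
    have hij := mul_add_lt hi hj
    rw [add_assoc, add_assoc, getElem?_append_of_lt _ _ _ (by rw [length_encode]; omega)]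
    simp only [encode]
    rw [List.getElem?_append_right (by simp; omega)]
    simp only [List.length_append, List.length_singleton, List.length_ofFn]
    rw [← add_assoc, Nat.add_sub_cancel_left, List.getElem?_ofFn, dif_pos hij]
    have h1 : (Fin.divNat ⟨i * Fintype.card Q + j, hij⟩ : Fin U.family.card) = ⟨i, hi⟩ := by
      ext
      simp only [Fin.divNat, Fin.val_mk]
      rw [mul_comm, Nat.mul_add_div (by omega), Nat.div_eq_of_lt hj, add_zero]
    have h2 : (Fin.modNat ⟨i * Fintype.card Q + j, hij⟩ : Fin (Fintype.card Q)) = ⟨j, hj⟩ := by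
      ext
      simp only [Fin.modNat, Fin.val_mk]
      rw [mul_comm, Nat.mul_add_mod, Nat.mod_eq_of_lt hj]
    rw [h1, h2]
    unfold membTable
    exact congrArg some (if_congr ⟨fun h => ⟨hi, hj, h⟩, fun ⟨_, _, h⟩ => h⟩ rfl rfl)

end DMA

namespace PairNumbering

variable {A Q₁ Q₂ : Type*} [Fintype A] [Fintype Q₁] [Fintype Q₂]
  {U₁ : DMA A Q₁} {U₂ : DMA A Q₂}

/-- The numbering of the two acceptors in opposite order. -/
def swap (N : PairNumbering U₁ U₂) : PairNumbering U₂ U₁ where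
  letter := N.letter
  state₁ := N.state₂
  state₂ := N.state₁
  final₁ := N.final₂
  final₂ := N.final₁

/-- The tables of the two acceptors. -/
noncomputable def inst (N : PairNumbering U₁ U₂) : Inst where
  A := Fintype.card A
  n1 := Fintype.card Q₁
  n2 := Fintype.card Q₂
  f1 := U₁.family.card
  f2 := U₂.family.card
  i1 := N.state₁ U₁.start
  i2 := N.state₂ U₂.start
  d1 := U₁.stepTable N.state₁ N.letter
  d2 := U₂.stepTable N.state₂ N.letter
  m1 := U₁.membTable N.state₁ N.final₁
  m2 := U₂.membTable N.state₂ N.final₂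
  i1_lt := Fin.isLt _
  i2_lt := Fin.isLt _
  d1_lt := U₁.stepTable_lt _ _
  d2_lt := U₂.stepTable_lt _ _
  m1_le := U₁.membTable_le _ _
  m2_le := U₂.membTable_le _ _

variable (N : PairNumbering U₁ U₂)

theorem acceptorAt_first : Prog.AcceptorAt N.input 5 (Fintype.card A) (Fintype.card Q₁)
    U₁.family.card (N.state₁ U₁.start) (U₁.stepTable N.state₁ N.letter)
    (U₁.membTable N.state₁ N.final₁) := by
  have := U₁.acceptorAt_encode N.state₁ N.final₁ N.letter
    [Fintype.card A, Fintype.card Q₁, Fintype.card Q₂, U₁.family.card, U₂.family.card]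
    (U₂.encode N.letter N.state₂ N.final₂)
  rwa [← List.append_assoc] at this

theorem acceptorAt_second : Prog.AcceptorAt N.input
    (5 + 1 + Fintype.card Q₁ * Fintype.card A + U₁.family.card * Fintype.card Q₁)
    (Fintype.card A) (Fintype.card Q₂) U₂.family.card (N.state₂ U₂.start)
    (U₂.stepTable N.state₂ N.letter) (U₂.membTable N.state₂ N.final₂) := by
  have := U₂.acceptorAt_encode N.state₂ N.final₂ N.letter
    ([Fintype.card A, Fintype.card Q₁, Fintype.card Q₂, U₁.family.card, U₂.family.card] ++
      U₁.encode N.letter N.state₁ N.final₁) []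
  rw [List.append_nil, List.length_append, DMA.length_encode] at this
  convert this using 1
  · rfl
  · rw [show [Fintype.card A, Fintype.card Q₁, Fintype.card Q₂, U₁.family.card,
      U₂.family.card].length = 5 from rfl]
    omega

theorem inputRep : Prog.InputRep N.input false N.inst where
  A := by simp [input, inst]
  n1 := by simp [input, inst]
  n2 := by simp [input, inst]
  f1 := by simp [input, inst]
  f2 := by simp [input, inst]
  acc1 := N.acceptorAt_first
  acc2 := N.acceptorAt_second

theorem inputRep_swap : Prog.InputRep N.input true N.swap.inst where
  A := by simp [input, inst]
  n1 := by simp [input, inst]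
  n2 := by simp [input, inst]
  f1 := by simp [input, inst]
  f2 := by simp [input, inst]
  acc1 := N.acceptorAt_second
  acc2 := N.acceptorAt_first

/-- The sum of the five parameters. -/
def total (_ : PairNumbering U₁ U₂) : ℕ :=
  Fintype.card A + Fintype.card Q₁ + Fintype.card Q₂ + U₁.family.card + U₂.family.card

theorem le_total_of_mem {k : ℕ} (hk : k ∈ N.input) : k ≤ N.total := by
  unfold total
  simp only [input, List.mem_append, List.mem_cons, List.not_mem_nil, or_false] at hk
  rcases hk with (h | h) | h
  · omega
  · have := U₁.le_of_mem_encode _ _ _ h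
    omega
  · have := U₂.le_of_mem_encode _ _ _ h
    omega

theorem length_input_le : N.input.length ≤ (N.total + 3) * (N.total + 3) := by
  simp only [input, List.length_append, DMA.length_encode, List.length_cons, List.length_nil, total]
  generalize Fintype.card A = a, Fintype.card Q₁ = b, Fintype.card Q₂ = c, U₁.family.card = d,
    U₂.family.card = e
  have h : (a + b + c + d + e + 3) * (a + b + c + d + e + 3) = b * a + d * b + (c * a + e * c) +
      (a * a + b * b + c * c + d * d + e * e + a * b + a * c + b * c + b * c + a * d + a * d +
      b * d + c * d + c * d + a * e + a * e + b * e + b * e + c * e + d * e + d * e +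
      6 * (a + b + c + d + e) + 9) := by ring
  omega

end PairNumbering

/-! ### Acceptors and their tables -/

open Filter in
/-- The projections of the states that occur infinitely often in a run of the product are the
states that occur infinitely often in the run of the component. -/
theorem Inst.exists_mem_inf_iff (I : Inst) {Q : Type*} {n : ℕ} (state : Q ≃ Fin n) {w : ℕ → ℕ}
    {ρ : ℕ → Q} {proj : ℕ → ℕ} (h : ∀ k, proj (I.run w k) = state (ρ k)) (q : Q) :
    (∃ s ∈ I.inf w, proj s = state q) ↔ ∃ᶠ i in atTop, ρ i = q := by
  have hρ : ∀ k, proj (I.run w k) = state q ↔ ρ k = q := fun k => by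
    rw [h, Fin.val_inj, state.apply_eq_iff_eq]
  constructor
  · rintro ⟨s, hs, hq⟩
    exact Frequently.mono hs fun i hi => (hρ i).1 (by rw [hi, hq])
  · intro hq
    obtain ⟨k₀, hk₀⟩ := I.exists_forall_mem_inf w
    obtain ⟨i, hi, hiq⟩ := frequently_atTop.1 hq k₀
    exact ⟨_, hk₀ i hi, (hρ i).2 hiq⟩

theorem DMA.membTable_eq_one_iff {A Q : Type*} [Fintype Q] (U : DMA A Q)
    (state : Q ≃ Fin (Fintype.card Q)) (final : U.family ≃ Fin U.family.card) (F : U.family)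
    (q : Q) : U.membTable state final (final F) (state q) = 1 ↔ q ∈ (F : Finset Q) := by
  simp [membTable]

/-- The acceptance condition in terms of the tables. -/
theorem DMA.mem_language_iff {A Q : Type*} [Fintype Q] (U : DMA A Q)
    (state : Q ≃ Fin (Fintype.card Q)) (final : U.family ≃ Fin U.family.card) (I : Inst)
    {w : ℕ → A} {c proj : ℕ → ℕ} (h : ∀ k, proj (I.run c k) = state (U.run w k)) :
    (∃ f < U.family.card, ∀ q < Fintype.card Q,
      (U.membTable state final f q = 1 ↔ ∃ s ∈ I.inf c, proj s = q)) ↔ w ∈ U.language := by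
  have key : ∀ F : U.family, (∀ q < Fintype.card Q,
      (U.membTable state final (final F) q = 1 ↔ ∃ s ∈ I.inf c, proj s = q)) ↔
      ((F : Finset Q) : Set Q) = U.infSet w := by
    intro F
    constructor
    · intro hF
      ext q
      have := hF (state q) (Fin.isLt _)
      rw [U.membTable_eq_one_iff, I.exists_mem_inf_iff state h] at this
      exact this
    · intro hF q hq
      obtain ⟨q, rfl⟩ : ∃ q', (state q' : ℕ) = q := ⟨state.symm ⟨q, hq⟩, by simp⟩
      rw [U.membTable_eq_one_iff, I.exists_mem_inf_iff state h, ← Finset.mem_coe, hF]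
      rfl
  constructor
  · rintro ⟨f, hf, hF⟩
    refine ⟨final.symm ⟨f, hf⟩, Subtype.prop _, (key _).1 ?_⟩
    simpa using hF
  · rintro ⟨F, hF, hFw⟩
    exact ⟨final ⟨F, hF⟩, Fin.isLt _, (key ⟨F, hF⟩).2 hFw⟩

theorem ultPeriodic_map {A B : Type*} (f : A → B) {u v : List A} (hv : v ≠ [])
    (hv' : v.map f ≠ []) (i : ℕ) :
    ultPeriodic (u.map f) (v.map f) hv' i = f (ultPeriodic u v hv i) := by
  unfold ultPeriodic
  by_cases h : i < u.length
  · simp [h]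
  · simp [h]

theorem exists_map_eq {A B : Type*} (f : A → B) {l : List B} (h : ∀ b ∈ l, ∃ a, f a = b) :
    ∃ l' : List A, l'.map f = l := by
  induction l with
  | nil => exact ⟨[], rfl⟩
  | cons b l ih =>
    obtain ⟨a, ha⟩ := h b (by simp)
    obtain ⟨l', hl⟩ := ih fun b hb => h b (by simp [hb])
    exact ⟨a :: l', by simp [ha, hl]⟩

namespace PairNumbering

variable {A Q₁ Q₂ : Type*} [Fintype A] [Fintype Q₁] [Fintype Q₂]
  {U₁ : DMA A Q₁} {U₂ : DMA A Q₂} (N : PairNumbering U₁ U₂)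

/-- The number of a letter. -/
abbrev code (a : A) : ℕ := N.letter a

theorem run_eq (w : ℕ → A) (k : ℕ) : N.inst.run (fun i => N.code (w i)) k =
    N.inst.pair (N.state₁ (U₁.run w k)) (N.state₂ (U₂.run w k)) := by
  induction k with
  | zero => rfl
  | succ k ih =>
    have h2 : (N.state₂ (U₂.run w k) : ℕ) < N.inst.n2 := Fin.isLt _
    simp only [Inst.run, ih, Inst.D, N.inst.pair_div _ h2, N.inst.pair_mod _ h2]
    simp only [inst, DMA.stepTable_apply, DMA.run]

theorem bad_iff (w : ℕ → A) :
    N.inst.Bad (fun i => N.code (w i)) ↔ w ∈ U₁.language ∧ w ∉ U₂.language := by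
  have hlt : ∀ k, (N.state₂ (U₂.run w k) : ℕ) < N.inst.n2 := fun k => Fin.isLt _
  have h1 : ∀ k, N.inst.run (fun i => N.code (w i)) k / N.inst.n2 = N.state₁ (U₁.run w k) :=
    fun k => by rw [run_eq, N.inst.pair_div _ (hlt k)]
  have h2 : ∀ k, N.inst.run (fun i => N.code (w i)) k % N.inst.n2 = N.state₂ (U₂.run w k) :=
    fun k => by rw [run_eq, N.inst.pair_mod _ (hlt k)]
  rw [← U₁.mem_language_iff N.state₁ N.final₁ N.inst (proj := (· / N.inst.n2)) h1,
    ← U₂.mem_language_iff N.state₂ N.final₂ N.inst (proj := (· % N.inst.n2)) h2]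
  unfold Inst.Bad
  push Not
  constructor
  · rintro ⟨-, ha, hb⟩
    refine ⟨ha, fun f hf => ?_⟩
    have := hb f hf
    unfold Inst.Final2 at this
    push Not at this
    exact this
  · rintro ⟨ha, hb⟩
    refine ⟨fun i => Fin.isLt _, ha, fun f hf => ?_⟩
    have := hb f hf
    unfold Inst.Final2
    push Not
    exact this

theorem forall_not_bad_iff : (∀ w, ¬ N.inst.Bad w) ↔ U₁.language ⊆ U₂.language := by
  constructor
  · intro h w hw
    by_contra hw'
    exact h _ ((N.bad_iff w).2 ⟨hw, hw'⟩)
  · intro h c hc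
    have : ∀ i, ∃ a, N.code a = c i := fun i => by
      have hlt : c i < Fintype.card A := hc.1 i
      exact ⟨N.letter.symm ⟨c i, hlt⟩, by simp [code]⟩
    choose w hw using this
    have := N.bad_iff w
    simp only [hw] at this
    exact (this.1 hc).2 (h (this.1 hc).1)

theorem exists_ultPeriodic {u v : List ℕ} {hv : v ≠ []} (h : N.inst.Bad (ultPeriodic u v hv)) :
    ∃ (u' v' : List A) (hv' : v' ≠ []), u'.map N.code = u ∧ v'.map N.code = v ∧
      ultPeriodic u' v' hv' ∈ U₁.language ∧ ultPeriodic u' v' hv' ∉ U₂.language := by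
  have hcode : ∀ i, ∃ a, N.code a = ultPeriodic u v hv i := fun i => by
    have hlt : ultPeriodic u v hv i < Fintype.card A := h.1 i
    exact ⟨N.letter.symm ⟨_, hlt⟩, by simp [code]⟩
  obtain ⟨u', rfl⟩ : ∃ u' : List A, u'.map N.code = u := by
    refine exists_map_eq _ fun b hb => ?_
    obtain ⟨i, hi, rfl⟩ := List.mem_iff_getElem.1 hb
    obtain ⟨a, ha⟩ := hcode i
    exact ⟨a, by rw [ha]; simp [ultPeriodic, hi]⟩
  obtain ⟨v', rfl⟩ : ∃ v' : List A, v'.map N.code = v := by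
    refine exists_map_eq _ fun b hb => ?_
    obtain ⟨i, hi, rfl⟩ := List.mem_iff_getElem.1 hb
    obtain ⟨a, ha⟩ := hcode ((u'.map N.code).length + i)
    exact ⟨a, by rw [ha]; simp [ultPeriodic, Nat.mod_eq_of_lt hi]⟩
  have hv' : v' ≠ [] := by
    rintro rfl
    exact hv rfl
  refine ⟨u', v', hv', rfl, rfl, ?_⟩
  rw [← N.bad_iff]
  convert h using 1
  funext i
  exact (ultPeriodic_map N.code hv' hv i).symm

/-! ### Resource bounds -/

/-- The words `u`, `v` encode an ultimately periodic word with the property `IsWitness`, and their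
lengths are bounded by `len` and by the running time `D`. -/
def Encodes (IsWitness : (ℕ → A) → Prop) (len D : ℕ) (u v : List ℕ) : Prop :=
  (∃ (u' v' : List A) (hv : v' ≠ []), u'.map N.code = u ∧ v'.map N.code = v ∧
    IsWitness (ultPeriodic u' v' hv)) ∧ u.length + v.length ≤ len ∧ u.length + v.length ≤ D

theorem two_le_total : 2 ≤ N.total := by
  have h1 : 0 < Fintype.card Q₁ := Fintype.card_pos_iff.2 ⟨U₁.start⟩
  have h2 : 0 < Fintype.card Q₂ := Fintype.card_pos_iff.2 ⟨U₂.start⟩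
  unfold total; omega

/-- From a program of the while language to an execution of the machine on the encoded input. -/
theorem exec_initial {P : Prog.Pr} {Holds : Prop} {IsWitness : (ℕ → A) → Prop} {T D len W : ℕ}
    (hI : ∀ w, IsWitness w → ¬ Holds)
    (hP : WProg.Runs N.input P ⟨fun _ => 0, fun _ _ _ => 0⟩ T
      (Prog.Result Holds (N.Encodes IsWitness len D)))
    (hW : layout.word ((N.total + 3) * (N.total + 3)) (2 * (N.total + P.size * T)) ≤ W) :
    ∃ t y, Exec W (Prog.machine P) N.initial t y ∧
      CorrectAnswer y (fun a => (N.letter a : ℕ)) Holds IsWitness len ∧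
      t ≤ P.size * T + 13 * D + 31 := by
  obtain ⟨t, y, hE, ht, hy⟩ := Prog.exec_machine (n := N.total + 3) (by simp [input, total])
    N.length_input_le (fun k => N.le_total_of_mem) hP hW (fun u v h => h.2.2)
  refine ⟨t, y, hE, ?_, ht⟩
  rcases hy with ⟨h1, hy⟩ | ⟨h0, u, v, ⟨⟨u', v', hv, rfl, rfl, hw⟩, hlen, -⟩, h1, h2, h3⟩
  · exact ⟨fun _ => h1, fun h => absurd hy h⟩
  · refine ⟨fun h => absurd h (hI _ hw), fun _ => ⟨h0, u', v', hv, by simpa using h1,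
      by simpa using h2, fun i hi => ?_, hw, by simpa using hlen⟩⟩
    rw [h3 i (by simpa using hi)]
    simp only [← List.map_append, List.getElem_map]

theorem decideTime_inst : Prog.decideTime N.inst = timeBound U₁ U₂ := by
  simp only [Prog.decideTime, timeBound, inst, Inst.V]
  ring

theorem encodes_of_witness {u v : List ℕ} {y : Prog.St} (h : Prog.Witness N.inst u v y) :
    N.Encodes (fun w => w ∈ U₁.language ∧ w ∉ U₂.language)
      (5 * (Fintype.card Q₁ * Fintype.card Q₂) ^ 2) (5 * timeBound U₁ U₂) u v := by
  obtain ⟨hA, ⟨f, hf, -⟩, -⟩ := h.bad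
  have hlen := h.length_le
  refine ⟨N.exists_ultPeriodic h.bad, by rw [sq]; exact hlen, hlen.trans ?_⟩
  refine Nat.mul_le_mul_left _ ?_
  rw [← decideTime_inst]
  unfold Prog.decideTime
  have hpos : 0 < N.inst.A * N.inst.f1 :=
    Nat.mul_pos (by have := hA 0; omega) (by omega)
  exact (Nat.le_mul_of_pos_left _ hpos).trans (Nat.le_add_left _ _)

theorem timeBound_le_total : timeBound U₁ U₂ ≤ 2 * (N.total + 1) ^ 7 := by
  have ha : Fintype.card A ≤ N.total + 1 := by unfold total; omega
  have h1 : Fintype.card Q₁ ≤ N.total + 1 := by unfold total; omega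
  have h2 : Fintype.card Q₂ ≤ N.total + 1 := by unfold total; omega
  have h3 : U₁.family.card ≤ N.total + 1 := by unfold total; omega
  have h4 : U₂.family.card ≤ N.total + 1 := by unfold total; omega
  unfold timeBound
  generalize N.total + 1 = n at *
  have e1 : U₁.family.card * U₂.family.card * Fintype.card Q₁ ^ 2 * Fintype.card Q₂ ^ 3 ≤
      n * n * n ^ 2 * n ^ 3 := by gcongr
  have e2 : Fintype.card A * U₁.family.card * Fintype.card Q₁ ^ 2 * Fintype.card Q₂ ^ 2 ≤
      n * n * n ^ 2 * n ^ 2 := by gcongr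
  have hn : 0 < n := lt_of_lt_of_le (Fintype.card_pos_iff.2 ⟨U₁.start⟩) h1
  have e3 : n * n * n ^ 2 * n ^ 2 ≤ n * n * n ^ 2 * n ^ 2 * n := Nat.le_mul_of_pos_right _ hn
  have e4 : n * n * n ^ 2 * n ^ 3 = n ^ 7 := by ring
  have e5 : n * n * n ^ 2 * n ^ 2 * n = n ^ 7 := by ring
  omega

end PairNumbering

/-- The words of the machine are bounded by a power of the sum `s` of the parameters, if the values
of the program are. -/
theorem exists_word_le_pow (K : ℕ) : ∃ d, ∀ s ≥ 2, ∀ m ≤ K * (s + 1) ^ 7,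
    layout.word ((s + 3) * (s + 3)) m ≤ (s + 1) ^ d := by
  -- words are quadratic in the values, whence `14 = 2 * 7`; the other summand of the exponent is
  -- the constant factor, which is absorbed by `k ≤ (s + 1) ^ k`
  refine ⟨(9 + 96 * (K * K) + 24 * K + 50 + 2 * K) + 14, fun s hs m hm => ?_⟩
  obtain ⟨n, rfl⟩ : ∃ n, s = n + 2 := ⟨s - 2, by omega⟩
  have h24 : layout.K = 24 := rfl
  simp only [Layout.word, h24]
  rw [pow_add]
  have h1 : (9 + 96 * (K * K) + 24 * K + 50 + 2 * K) * (n + 2 + 1) ^ 14 ≤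
      (n + 2 + 1) ^ (9 + 96 * (K * K) + 24 * K + 50 + 2 * K) * (n + 2 + 1) ^ 14 :=
    Nat.mul_le_mul_right _ (Nat.lt_pow_self (by omega)).le
  refine le_trans ?_ h1
  have h2 : m * m ≤ K * (n + 2 + 1) ^ 7 * (K * (n + 2 + 1) ^ 7) := Nat.mul_le_mul hm hm
  have h3 : (n + 2 + 1) ^ 7 ≤ (n + 2 + 1) ^ 14 := Nat.pow_le_pow_right (by omega) (by omega)
  have h4 : (n + 2 + 1) ^ 2 ≤ (n + 2 + 1) ^ 14 := Nat.pow_le_pow_right (by omega) (by omega)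
  have h5 : 1 ≤ (n + 2 + 1) ^ 14 := Nat.one_le_pow _ _ (by omega)
  have h6 : K * (n + 2 + 1) ^ 7 ≤ K * (n + 2 + 1) ^ 14 := Nat.mul_le_mul_left _ h3
  have h7 : K * (n + 2 + 1) ^ 7 * (K * (n + 2 + 1) ^ 7) = K * K * (n + 2 + 1) ^ 14 := by ring
  have h8 : (n + 2 + 3) * (n + 2 + 3) ≤ 9 * (n + 2 + 1) ^ 2 := by nlinarith
  generalize (n + 2 + 1) ^ 14 = X at *
  have h9 : 2 * m * (2 * m) = 4 * (m * m) := by ring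
  have h10 : (9 + 96 * (K * K) + 24 * K + 50 + 2 * K) * X =
      9 * X + 96 * (K * K * X) + 24 * (K * X) + 50 * X + 2 * (K * X) := by ring
  omega

/-- The time bound is polynomial in the size of the acceptors. A vanishing parameter, which the
size does not see, makes the respective summand vanish. -/
theorem timeBound_le_size {A Q₁ Q₂ : Type*} [Fintype A] [Fintype Q₁] [Fintype Q₂]
    (U₁ : DMA A Q₁) (U₂ : DMA A Q₂) {s : ℕ} (hs : U₁.size + U₂.size ≤ s) :
    timeBound U₁ U₂ ≤ s ^ 7 + s ^ 6 := by
  unfold DMA.size at hs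
  unfold timeBound
  have hq1 : 0 < Fintype.card Q₁ := Fintype.card_pos_iff.2 ⟨U₁.start⟩
  have hq2 : 0 < Fintype.card Q₂ := Fintype.card_pos_iff.2 ⟨U₂.start⟩
  generalize Fintype.card A = a, Fintype.card Q₁ = b, Fintype.card Q₂ = c, U₁.family.card = d,
    U₂.family.card = e at *
  refine Nat.add_le_add ?_ ?_
  · rcases Nat.eq_zero_or_pos d with rfl | hd
    · simp
    rcases Nat.eq_zero_or_pos e with rfl | he
    · simp
    have h1 : b ≤ b * d := Nat.le_mul_of_pos_right _ hd
    have h2 : d ≤ b * d := Nat.le_mul_of_pos_left _ hq1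
    have h3 : c ≤ c * e := Nat.le_mul_of_pos_right _ he
    have h4 : e ≤ c * e := Nat.le_mul_of_pos_left _ hq2
    calc d * e * b ^ 2 * c ^ 3 ≤ s * s * s ^ 2 * s ^ 3 := by gcongr <;> omega
      _ = s ^ 7 := by ring
  · rcases Nat.eq_zero_or_pos a with rfl | ha
    · simp
    rcases Nat.eq_zero_or_pos d with rfl | hd
    · simp
    have h1 : b ≤ b * d := Nat.le_mul_of_pos_right _ hd
    have h2 : d ≤ b * d := Nat.le_mul_of_pos_left _ hq1
    have h3 : c ≤ c * a := Nat.le_mul_of_pos_right _ ha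
    have h4 : a ≤ c * a := Nat.le_mul_of_pos_left _ hq2
    calc a * d * b ^ 2 * c ^ 2 ≤ s * s * s ^ 2 * s ^ 2 := by gcongr <;> omega
      _ = s ^ 6 := by ring

/-! ### The inclusion test and the equivalence test -/

namespace PairNumbering

variable {A Q₁ Q₂ : Type*} [Fintype A] [Fintype Q₁] [Fintype Q₂]
  {U₁ : DMA A Q₁} {U₂ : DMA A Q₂} (N : PairNumbering U₁ U₂)

theorem Encodes.mono {N : PairNumbering U₁ U₂} {Is Is' : (ℕ → A) → Prop} {len len' D D' : ℕ}
    {u v : List ℕ} (h : N.Encodes Is len D u v) (hIs : ∀ w, Is w → Is' w) (hlen : len ≤ len')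
    (hD : D ≤ D') : N.Encodes Is' len' D' u v := by
  obtain ⟨⟨u', v', hv, hu, hv', hw⟩, h1, h2⟩ := h
  exact ⟨⟨u', v', hv, hu, hv', hIs _ hw⟩, h1.trans hlen, h2.trans hD⟩

theorem runs_inclusion (N : PairNumbering U₁ U₂) {len : ℕ}
    (hlen : 5 * (Fintype.card Q₁ * Fintype.card Q₂) ^ 2 ≤ len) :
    WProg.Runs N.input (Prog.inclusion false) ⟨fun _ => 0, fun _ _ _ => 0⟩
      (700 * (timeBound U₁ U₂ + 1))
      (Prog.Result (U₁.language ⊆ U₂.language)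
        (N.Encodes (fun w => w ∈ U₁.language ∧ w ∉ U₂.language) len (5 * timeBound U₁ U₂))) := by
  have := Prog.runs_inclusion (x := ⟨fun _ => 0, fun _ _ _ => 0⟩) N.inputRep
  rw [decideTime_inst] at this
  refine this.mono le_rfl fun y _ hy => ?_
  rcases hy with ⟨h1, h⟩ | ⟨h0, u, v, h⟩
  · exact .inl ⟨h1, N.forall_not_bad_iff.1 h⟩
  · exact .inr ⟨h0, u, v, (N.encodes_of_witness h).mono (fun _ => id) hlen le_rfl,
      h.lenU, h.lenV, h.out⟩

theorem runs_equivalence (N : PairNumbering U₁ U₂) {len : ℕ}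
    (hlen : 5 * (Fintype.card Q₁ * Fintype.card Q₂) ^ 2 ≤ len) :
    WProg.Runs N.input Prog.equivalence ⟨fun _ => 0, fun _ _ _ => 0⟩
      (700 * (timeBound U₁ U₂ + timeBound U₂ U₁ + 3))
      (Prog.Result (U₁.language = U₂.language)
        (N.Encodes (fun w => (w ∈ U₁.language ∧ w ∉ U₂.language) ∨
          (w ∈ U₂.language ∧ w ∉ U₁.language)) len
          (5 * (timeBound U₁ U₂ + timeBound U₂ U₁)))) := by
  have := Prog.runs_equivalence (x := ⟨fun _ => 0, fun _ _ _ => 0⟩) N.inputRep N.inputRep_swap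
  rw [decideTime_inst, decideTime_inst] at this
  refine this.mono le_rfl fun y _ hy => ?_
  rcases hy with ⟨h1, h, h'⟩ | ⟨h0, ⟨u, v, h⟩ | ⟨u, v, h⟩⟩
  · exact .inl ⟨h1, (N.forall_not_bad_iff.1 h).antisymm (N.swap.forall_not_bad_iff.1 h')⟩
  · exact .inr ⟨h0, u, v, (N.encodes_of_witness h).mono (fun _ => .inl) hlen (by omega),
      h.lenU, h.lenV, h.out⟩
  · have hE : N.Encodes (fun w => w ∈ U₂.language ∧ w ∉ U₁.language)
        (5 * (Fintype.card Q₂ * Fintype.card Q₁) ^ 2) (5 * timeBound U₂ U₁) u v :=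
      N.swap.encodes_of_witness h
    exact .inr ⟨h0, u, v, hE.mono (fun _ => .inr) (by rwa [mul_comm (Fintype.card Q₂)])
      (by omega), h.lenU, h.lenV, h.out⟩

end PairNumbering

theorem mainTheorem1 :
    -- inclusion
    (∃ (P : RAMProgram) (C d : ℕ) (p : Polynomial ℕ),
      ∀ (A : Type*) (Q₁ : Type*) (Q₂ : Type*) [Fintype A] [Fintype Q₁] [Fintype Q₂]
        (U₁ : DMA A Q₁) (U₂ : DMA A Q₂) (N : PairNumbering U₁ U₂),
      ∃ (t : ℕ) (y : RAMState),
        Exec (wordBound U₁ U₂ d) P N.initial t y ∧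
        CorrectAnswer y (fun a => (N.letter a : ℕ))
          (U₁.language ⊆ U₂.language)
          (fun w => w ∈ U₁.language ∧ w ∉ U₂.language)
          (C * (Fintype.card Q₁ * Fintype.card Q₂) ^ 2) ∧
        t ≤ C * (timeBound U₁ U₂ + 1) ∧
        t ≤ p.eval (U₁.size + U₂.size)) ∧
    -- equivalence
    (∃ (P : RAMProgram) (C d : ℕ) (p : Polynomial ℕ),
      ∀ (A : Type*) (Q₁ : Type*) (Q₂ : Type*) [Fintype A] [Fintype Q₁] [Fintype Q₂]
        (U₁ : DMA A Q₁) (U₂ : DMA A Q₂) (N : PairNumbering U₁ U₂),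
      ∃ (t : ℕ) (y : RAMState),
        Exec (wordBound U₁ U₂ d) P N.initial t y ∧
        CorrectAnswer y (fun a => (N.letter a : ℕ))
          (U₁.language = U₂.language)
          (fun w => (w ∈ U₁.language ∧ w ∉ U₂.language) ∨ (w ∈ U₂.language ∧ w ∉ U₁.language))
          (C * (Fintype.card Q₁ * Fintype.card Q₂) ^ 2) ∧
        t ≤ C * (timeBound U₁ U₂ + timeBound U₂ U₁ + 1) ∧
        t ≤ p.eval (U₁.size + U₂.size)) := by
  constructor
  · set g := (Prog.inclusion false).size with hg
    obtain ⟨d, hd⟩ := exists_word_le_pow (2 * (1 + g * 2100))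
    refine ⟨Prog.machine (Prog.inclusion false), 700 * g + 100, d,
      Polynomial.C (700 * g + 100) * (Polynomial.X ^ 7 + Polynomial.X ^ 6 + 1), ?_⟩
    intro A Q₁ Q₂ _ _ _ U₁ U₂ N
    have hpow : N.total + 1 ≤ (N.total + 1) ^ 7 := Nat.le_self_pow (by decide) _
    have htime := N.timeBound_le_total
    have hsize := timeBound_le_size U₁ U₂ le_rfl
    have hW : 2 * (N.total + g * (700 * (timeBound U₁ U₂ + 1))) ≤
        2 * (1 + g * 2100) * (N.total + 1) ^ 7 := by
      have e : g * (700 * (timeBound U₁ U₂ + 1)) ≤ g * (2100 * (N.total + 1) ^ 7) :=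
        Nat.mul_le_mul_left _ (by omega)
      calc 2 * (N.total + g * (700 * (timeBound U₁ U₂ + 1)))
          ≤ 2 * ((N.total + 1) ^ 7 + g * (2100 * (N.total + 1) ^ 7)) := by omega
        _ = _ := by ring
    obtain ⟨t, y, hE, hy, ht⟩ := N.exec_initial
      (len := (700 * g + 100) * (Fintype.card Q₁ * Fintype.card Q₂) ^ 2)
      (fun w hw h => hw.2 (h hw.1)) (N.runs_inclusion (Nat.mul_le_mul_right _ (by omega)))
      (hd _ N.two_le_total _ hW)
    · have hC : t ≤ (700 * g + 100) * (timeBound U₁ U₂ + 1) := by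
        refine ht.trans ?_
        rw [← hg]
        generalize timeBound U₁ U₂ = T
        have e : g * (700 * (T + 1)) = 700 * g * (T + 1) := by ring
        rw [add_mul, e]
        omega
      refine ⟨t, y, hE, hy, hC, hC.trans ?_⟩
      simp only [Polynomial.eval_mul, Polynomial.eval_C, Polynomial.eval_add, Polynomial.eval_pow,
        Polynomial.eval_X, Polynomial.eval_one]
      gcongr
  · set g := Prog.equivalence.size with hg
    obtain ⟨d, hd⟩ := exists_word_le_pow (2 * (1 + g * 4900))
    refine ⟨Prog.machine Prog.equivalence, 2100 * g + 100, d,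
      Polynomial.C (2100 * g + 100) * (2 * (Polynomial.X ^ 7 + Polynomial.X ^ 6) + 1), ?_⟩
    intro A Q₁ Q₂ _ _ _ U₁ U₂ N
    have hpow : N.total + 1 ≤ (N.total + 1) ^ 7 := Nat.le_self_pow (by decide) _
    have htime := N.timeBound_le_total
    have hswap : N.swap.total = N.total := by unfold PairNumbering.total; omega
    have htime' := N.swap.timeBound_le_total
    rw [hswap] at htime'
    have hsize := timeBound_le_size U₁ U₂ le_rfl
    have hsize' := timeBound_le_size U₂ U₁ (Nat.add_comm _ _).le
    have hW : 2 * (N.total + g * (700 * (timeBound U₁ U₂ + timeBound U₂ U₁ + 3))) ≤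
        2 * (1 + g * 4900) * (N.total + 1) ^ 7 := by
      have e : g * (700 * (timeBound U₁ U₂ + timeBound U₂ U₁ + 3)) ≤
          g * (4900 * (N.total + 1) ^ 7) := Nat.mul_le_mul_left _ (by omega)
      calc 2 * (N.total + g * (700 * (timeBound U₁ U₂ + timeBound U₂ U₁ + 3)))
          ≤ 2 * ((N.total + 1) ^ 7 + g * (4900 * (N.total + 1) ^ 7)) := by omega
        _ = _ := by ring
    obtain ⟨t, y, hE, hy, ht⟩ := N.exec_initial
      (len := (2100 * g + 100) * (Fintype.card Q₁ * Fintype.card Q₂) ^ 2)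
      (fun w hw h => by
        rw [h] at hw
        exact hw.elim (fun h => h.2 h.1) fun h => h.2 h.1)
      (N.runs_equivalence (Nat.mul_le_mul_right _ (by omega))) (hd _ N.two_le_total _ hW)
    · have hC : t ≤ (2100 * g + 100) * (timeBound U₁ U₂ + timeBound U₂ U₁ + 1) := by
        refine ht.trans ?_
        rw [← hg]
        generalize timeBound U₁ U₂ + timeBound U₂ U₁ = T
        have e : g * (700 * (T + 3)) ≤ g * (2100 * (T + 1)) := Nat.mul_le_mul_left _ (by omega)
        have e' : g * (2100 * (T + 1)) = 2100 * g * (T + 1) := by ring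
        rw [add_mul, ← e', Nat.add_assoc]
        exact Nat.add_le_add e (by omega)
      refine ⟨t, y, hE, hy, hC, hC.trans ?_⟩
      simp only [Polynomial.eval_mul, Polynomial.eval_C, Polynomial.eval_add, Polynomial.eval_pow,
        Polynomial.eval_X, Polynomial.eval_one, Polynomial.eval_ofNat]
      gcongr
      omega
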